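/- **Model.** Data structures are static and are queried on a word RAM with word size $w=w(m)$, where $\lfloor\log_2 m\rfloor+1\le w(m)\le\kappa(\lfloor\log_2 m\rfloor+1)$ for all $m\ge1$ and a constant $\kappa$. The machine has the usual unit-cost arithmetic, bitwise, shift, comparison, memory and control instructions on $w$-bit words, registers, and a working memory of $2^w$ words with arbitrary initial contents, and it reads the bits of the data structure in blocks of $w$ consecutive bits. A *structure* consists of an encoding of each set $X\subseteq[m]=\{1,\dots,m\}$ as a bit string and one fixed program per type of query. The program has random access to the bit string and receives as free parameters the query, $n=|X|$, $m$, $w$ and the binary length of $m$. Let $\mathcal D\subseteq\mathbb N\times\mathbb N$ be any set of parameter pairs, and let $t,s:\mathbb N\times\mathbb N\to\mathbb R$. Structures are required to work for all $X\subseteq[m]$ with $m\ge1$ and $(n,m)\in\mathcal D$, $n=|X|$; time is the number of steps of a query and space is the length of the encoding in bits, both bounded for all such $X$ by functions of $(n,m)$. * Let $S[1..m]$ be the characteristic bit string of $X$. A *fully indexable dictionary* $\mathrm{FID}(t,s)$ uses at most $s(n,m)$ bits and supports, each in time at most $t(n,m)$ and for $b\in\{0,1\}$, the queries $\mathrm{rank}_b(S,i)$,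 the number of occurrences of $b$ in $S[1..i]$ ($0\le i\le m$), and $\mathrm{select}_b(S,i)$, the position of the $i$-th occurrence of $b$ in $S$ ($1\le i\le$ number of occurrences of $b$). * A *predecessor structure* $\mathrm{PRED}(t,s)$ uses at most $s(n,m)$ bits and, given $y\in[m]$, returns in time at most $t(n,m)$ the predecessor of $y$ in $X=\{x_1<\dots<x_n\}$, i.e. the largest $x_j<y$, together with its index $j$ (or $(0,0)$ if there is none). It is *set-preserving* if its encoding contains $x_1,\dots,x_n$ verbatim, in sorted order and in $\lfloor\log_2 m\rfloor+1$ bits each, in a contiguous block, whose starting position can be computed in time at most $t(n,m)$ from $n,m,w$ without reading the encoding. **Theorem.** For every $\kappa$ there is a constant $C>0$ such that the following hold for all such $w,\mathcal D,t,s$ (logarithms are to base 2, and $n\log n=n\log m=0$ for $n=0$). 1. If there is a $\mathrm{FID}(t,s)$, then there is a $\mathrm{PRED}(C\,t,\;s)$. 2. If there is a set-preserving $\mathrm{PRED}(t,s)$, then there is a $\mathrm{FID}(C\,t,\;s-n\log n+C\,n)$ that supports $\mathrm{select}_1$ in time at most $C$. Likewise there is a $\mathrm{FID}$ with these time bounds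 and with space at most $\lceil\log\binom mn\rceil+R$, where $R=s-n\log m+C\,n$. 3. If there is a $\mathrm{PRED}(t,s)$, set-preserving or not, then there is a $\mathrm{FID}(C\,t,\;2s+C\,n)$ that supports $\mathrm{select}_1$ in time at most $C$. -/

import Mathlib

/-! ### The word RAM

Words have `w` bits.  A program has finitely many registers, a random access working memory of
`2 ^ w` words, and read-only access to the bits of a static data structure, which is read in blocks
of `w` consecutive bits (one memory word).  Every instruction and every evaluation of a branching
condition takes one unit of time.  Programs are written with sequencing, branching and loops in
place of jumps. -/

namespace WordRAM

/-- The arithmetic, bitwise and shift instructions on words. -/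
inductive BinOp where
  | add | sub | mul | div | mod | and | or | xor | shl | shr

/-- Arithmetic is unsigned and modulo `2 ^ w`; `div` and `mod` are the integer quotient and
remainder. -/
def BinOp.eval {w : ℕ} : BinOp → BitVec w → BitVec w → BitVec w
  | .add, x, y => x + y
  | .sub, x, y => x - y
  | .mul, x, y => x * y
  | .div, x, y => x / y
  | .mod, x, y => x % y
  | .and, x, y => x &&& y
  | .or, x, y => x ||| y
  | .xor, x, y => x ^^^ y
  | .shl, x, y => x <<< y.toNat
  | .shr, x, y => x >>> y.toNat

/-- Comparisons of two registers (as unsigned integers). -/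
inductive Cond where
  | eq (x y : ℕ)
  | lt (x y : ℕ)

/-- Programs; natural numbers `dst`, `src`, `x`, `y`, `addr` are names of registers. -/
inductive Prog where
  /-- do nothing -/
  | skip
  /-- `dst := c`, a constant of the program -/
  | const (dst c : ℕ)
  /-- `dst := src` -/
  | move (dst src : ℕ)
  /-- `dst := x o y` -/
  | op (o : BinOp) (dst x y : ℕ)
  /-- read the word of the static data structure whose index is in register `addr` -/
  | probe (dst addr : ℕ)
  /-- read the word of the working memory whose index is in register `addr` -/
  | load (dst addr : ℕ)
  /-- write register `src` to the word of the working memory whose index is in register `addr` -/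
  | store (addr src : ℕ)
  | seq (p q : Prog)
  | branch (c : Cond) (p q : Prog)
  | loop (c : Cond) (p : Prog)

/-- Contents of the registers and of the working memory. -/
structure State (w : ℕ) where
  reg : ℕ → BitVec w
  mem : BitVec w → BitVec w

def State.setReg {w : ℕ} (σ : State w) (r : ℕ) (v : BitVec w) : State w :=
  { σ with reg := Function.update σ.reg r v }

def State.setMem {w : ℕ} (σ : State w) (a v : BitVec w) : State w :=
  { σ with mem := Function.update σ.mem a v }

def Cond.holds {w : ℕ} : Cond → State w → Prop
  | .eq x y, σ => (σ.reg x).toNat = (σ.reg y).toNat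
  | .lt x y, σ => (σ.reg x).toNat < (σ.reg y).toNat

/-- The `a`-th word of the data `D`: bits `a * w, …, a * w + w - 1`, least significant bit first,
where positions beyond the end of `D` read as zeros. -/
def dataWord {w : ℕ} (D : List Bool) (a : BitVec w) : BitVec w :=
  BitVec.ofFnLE fun i : Fin w => D.getD (a.toNat * w + i) false

/-- `Exec D p σ σ' k`: on the data `D`, the program `p` started in the state `σ` halts in the state
`σ'` after exactly `k` steps. -/
inductive Exec {w : ℕ} (D : List Bool) : Prog → State w → State w → ℕ → Prop where
  | skip (σ : State w) : Exec D .skip σ σ 1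
  | const (σ : State w) (dst c : ℕ) :
      Exec D (.const dst c) σ (σ.setReg dst (BitVec.ofNat w c)) 1
  | move (σ : State w) (dst src : ℕ) : Exec D (.move dst src) σ (σ.setReg dst (σ.reg src)) 1
  | op (σ : State w) (o : BinOp) (dst x y : ℕ) :
      Exec D (.op o dst x y) σ (σ.setReg dst (o.eval (σ.reg x) (σ.reg y))) 1
  | probe (σ : State w) (dst addr : ℕ) :
      Exec D (.probe dst addr) σ (σ.setReg dst (dataWord D (σ.reg addr))) 1
  | load (σ : State w) (dst addr : ℕ) :
      Exec D (.load dst addr) σ (σ.setReg dst (σ.mem (σ.reg addr))) 1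
  | store (σ : State w) (addr src : ℕ) :
      Exec D (.store addr src) σ (σ.setMem (σ.reg addr) (σ.reg src)) 1
  | seq {p q : Prog} {σ σ' σ'' : State w} {k l : ℕ} :
      Exec D p σ σ' k → Exec D q σ' σ'' l → Exec D (.seq p q) σ σ'' (k + l)
  | branch_true {c : Cond} {p q : Prog} {σ σ' : State w} {k : ℕ} :
      c.holds σ → Exec D p σ σ' k → Exec D (.branch c p q) σ σ' (k + 1)
  | branch_false {c : Cond} {p q : Prog} {σ σ' : State w} {k : ℕ} :
      ¬ c.holds σ → Exec D q σ σ' k → Exec D (.branch c p q) σ σ' (k + 1)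
  | loop_true {c : Cond} {p : Prog} {σ σ' σ'' : State w} {k l : ℕ} :
      c.holds σ → Exec D p σ σ' k → Exec D (.loop c p) σ' σ'' l →
        Exec D (.loop c p) σ σ'' (k + l + 1)
  | loop_false {c : Cond} {p : Prog} {σ : State w} :
      ¬ c.holds σ → Exec D (.loop c p) σ σ 1

/-- Start of a query with argument `q` to a data structure for `n` elements of `{1, …, m}`: the
registers `0, …, 4` hold `q`, `n`, `m`, the word size and the binary length of `m`, all other
registers are zero. -/
def State.init (w n m q : ℕ) (mem : BitVec w → BitVec w) : State w where
  reg := fun r =>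
    match r with
    | 0 => BitVec.ofNat w q
    | 1 => BitVec.ofNat w n
    | 2 => BitVec.ofNat w m
    | 3 => BitVec.ofNat w w
    | 4 => BitVec.ofNat w m.size
    | _ => 0
  mem := mem

/-- On the data `D`, the program `p` answers the query `q` in time at most `t`, leaving in the
registers `0` and `1` values that satisfy `ans`.  The working memory may initially hold anything,
for instance what earlier queries left there. -/
def Answers (w n m : ℕ) (D : List Bool) (p : Prog) (q : ℕ) (t : ℝ) (ans : ℕ → ℕ → Prop) : Prop :=
  ∀ mem : BitVec w → BitVec w, ∃ (σ : State w) (k : ℕ),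
    Exec D p (State.init w n m q mem) σ k ∧ (k : ℝ) ≤ t ∧ ans (σ.reg 0).toNat (σ.reg 1).toNat

end WordRAM

/-! ### Rank, select and predecessor

A set `X ⊆ {1, …, m}` is identified with the bit string `S[1..m]` for which `S[j]` is `1` (`true`)
if and only if `j ∈ X`. -/

/-- `rank_b(S, i)`: the number of occurrences of the bit `b` in `S[1..i]`. -/
def rank (X : Finset ℕ) (b : Bool) (i : ℕ) : ℕ :=
  ((Finset.Icc 1 i).filter fun j => decide (j ∈ X) = b).card

/-- `select_b(S, i) = p`: the `i`-th occurrence of the bit `b` in `S[1..m]` is at position `p`. -/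
def IsSelect (m : ℕ) (X : Finset ℕ) (b : Bool) (i p : ℕ) : Prop :=
  p ∈ Finset.Icc 1 m ∧ decide (p ∈ X) = b ∧ rank X b p = i

/-- `v` is the predecessor of `y` in `X = {x_1 < ⋯ < x_n}`, that is, the largest element of `X`
below `y`, and `j` is its index, so `v = x_j`; both are `0` if there is no predecessor. -/
def IsPredecessor (X : Finset ℕ) (y j v : ℕ) : Prop :=
  (v ∈ X ∧ v < y ∧ (∀ x ∈ X, x < y → x ≤ v) ∧ j = rank X true v) ∨
    ((∀ x ∈ X, y ≤ x) ∧ j = 0 ∧ v = 0)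

/-! ### Static data structures -/

/-- `X` is a subset of the nonempty universe `{1, …, m}`, of a size `n` such that `(n, m)` belongs
to the set `𝒟` of parameters that are considered. -/
def IsInstance (𝒟 : Set (ℕ × ℕ)) (m : ℕ) (X : Finset ℕ) : Prop :=
  1 ≤ m ∧ X ⊆ Finset.Icc 1 m ∧ (X.card, m) ∈ 𝒟

/-- The data structure that stores `X ⊆ {1, …, m}` as the bit string `enc m X` has at most
`s n m` bits and its program `pred` answers predecessor queries in time at most `t n m`. -/
def IsPRED (w : ℕ → ℕ) (𝒟 : Set (ℕ × ℕ)) (t s : ℕ → ℕ → ℝ)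
    (enc : ℕ → Finset ℕ → List Bool) (pred : WordRAM.Prog) : Prop :=
  ∀ (m : ℕ) (X : Finset ℕ), IsInstance 𝒟 m X →
    ((enc m X).length : ℝ) ≤ s X.card m ∧
    ∀ y ∈ Finset.Icc 1 m,
      WordRAM.Answers (w m) X.card m (enc m X) pred y (t X.card m) (IsPredecessor X y)

/-- The bits of `x_1 < ⋯ < x_n`, one after another, each number in binary in as many bits as are
needed for `m`. -/
def verbatim (m : ℕ) (X : Finset ℕ) : List Bool :=
  (X.sort (· ≤ ·)).flatMap fun x => List.ofFn fun i : Fin m.size => x.testBit i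

/-- The data structure stores `x_1, …, x_n` verbatim in a contiguous part of its memory, whose
starting position is known to the algorithm: a program finds it from the parameters, without
access to the data. -/
def IsSetPreserving (w : ℕ → ℕ) (𝒟 : Set (ℕ × ℕ)) (t : ℕ → ℕ → ℝ)
    (enc : ℕ → Finset ℕ → List Bool) : Prop :=
  ∃ loc : WordRAM.Prog, ∀ (m : ℕ) (X : Finset ℕ), IsInstance 𝒟 m X →
    ∃ pre post : List Bool, enc m X = pre ++ verbatim m X ++ post ∧
      WordRAM.Answers (w m) X.card m [] loc 0 (t X.card m) fun a _ => a = pre.length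

/-- There is a predecessor structure with time `t` and `s` bits, on machines with `w m`-bit words,
for all sets of `n` elements of `{1, …, m}` with `(n, m) ∈ 𝒟`. -/
def HasPRED (w : ℕ → ℕ) (𝒟 : Set (ℕ × ℕ)) (t s : ℕ → ℕ → ℝ) : Prop :=
  ∃ (enc : ℕ → Finset ℕ → List Bool) (pred : WordRAM.Prog), IsPRED w 𝒟 t s enc pred

/-- There is a set-preserving predecessor structure with time `t` and `s` bits. -/
def HasSetPreservingPRED (w : ℕ → ℕ) (𝒟 : Set (ℕ × ℕ)) (t s : ℕ → ℕ → ℝ) : Prop :=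
  ∃ (enc : ℕ → Finset ℕ → List Bool) (pred : WordRAM.Prog),
    IsPRED w 𝒟 t s enc pred ∧ IsSetPreserving w 𝒟 t enc

/-- There is a fully indexable dictionary with `s` bits that supports `select_1` in time `t₁` and
`rank_0`, `rank_1`, `select_0` in time `t`. -/
def HasFID (w : ℕ → ℕ) (𝒟 : Set (ℕ × ℕ)) (t t₁ s : ℕ → ℕ → ℝ) : Prop :=
  ∃ (enc : ℕ → Finset ℕ → List Bool) (rankProg selectProg : Bool → WordRAM.Prog),
    ∀ (m : ℕ) (X : Finset ℕ), IsInstance 𝒟 m X →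
      ((enc m X).length : ℝ) ≤ s X.card m ∧
      (∀ (b : Bool), ∀ i ∈ Finset.Icc 0 m,
        WordRAM.Answers (w m) X.card m (enc m X) (rankProg b) i (t X.card m)
          fun r _ => r = rank X b i) ∧
      (∀ i ∈ Finset.Icc 1 (rank X false m),
        WordRAM.Answers (w m) X.card m (enc m X) (selectProg false) i (t X.card m)
          fun p _ => IsSelect m X false i p) ∧
      (∀ i ∈ Finset.Icc 1 (rank X true m),
        WordRAM.Answers (w m) X.card m (enc m X) (selectProg true) i (t₁ X.card m)
          fun p _ => IsSelect m X true i p)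

/-- The information-theoretic minimum `⌈log₂ (m choose n)⌉` for storing `n` elements of
`{1, …, m}`. -/
noncomputable def infoBound (n m : ℕ) : ℝ :=
  (⌈Real.logb 2 (m.choose n)⌉₊ : ℝ)

/-! ### Executions -/

namespace WordRAM

/-! From a dictionary to predecessors: the predecessor of `y` has index rank₁(y − 1), and its value
is select₁ of that index, so two subroutine calls suffice (`answers_predProg`).

Conversely, the dictionary for `X` combines an index, which is a compressed array of `X`, with the
given structure built for an auxiliary set `Z`. Rank₁ is a predecessor query in `X`. Select₀(i)
equals `i` plus the number of elements with fewer than `i` zeros before them, which is a predecessor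
query in the set `K` of these zero counts. The given structure exists only for parameters in `𝒟`, so
both kinds of query must go to a single set of exactly `n` elements of {1, …, m}. Therefore every
second element of `X` and of `K` is taken and its last bit is dropped. The two halved sets fit side
by side, and an initial segment {1, …, p} brings the size to `n` (`exists_isAux`). Stored counts
translate a rank in `Z` into a rank in `X` or `K` up to a bounded error, and inspecting nine
consecutive elements removes the error (`ev_rank`, `ev_zeroRank`).

The index splits each element of `X` into size m − size n low bits, stored as they are, and a high
part. The high parts form a monotone sequence bounded by O(n). Such a sequence takes O(n) bits with
constant access time, by a two-level division and a decoding table (`exists_hasSeq`, `ev_seqVal`).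
The same holds for the counts above and for `runEnd`, from which `K` is recovered. In total the
index takes at most n log m − n log n + 94n bits.

For an arbitrary structure the encoding of `Z` is appended to the index. The answers determine the
set, so s + 1 is at least log of the binomial coefficient, hence at least n log m − n log n; this
yields 2s + O(n) (`exists_dictData`). In the set-preserving case the verbatim copy of `Z` is cut out
of its encoding, which saves n · size m bits. The removed words are recomputed from the index in
constant time, since a word meets boundedly many elements (`simulates_cutWord`).

Programs are reused through `Exec.simulate`: each access to the data becomes the evaluation of an
expression of constant cost. Sets with fewer than a constant number of elements are stored verbatim
and scanned. -/

theorem Exec.deterministic {w : ℕ} {D : List Bool} {p : Prog} {σ σ₁ σ₂ : State w} {k₁ k₂ : ℕ}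
    (h₁ : Exec D p σ σ₁ k₁) (h₂ : Exec D p σ σ₂ k₂) : σ₁ = σ₂ := by
  induction h₁ generalizing σ₂ k₂ with
  | skip | const | move | op | probe | load | store => cases h₂; rfl
  | seq _ _ ih₁ ih₂ =>
    cases h₂ with
    | seq a b => obtain rfl := ih₁ a; exact ih₂ b
  | branch_true hc _ ih =>
    cases h₂ with
    | branch_true _ a => exact ih a
    | branch_false h _ => exact absurd hc h
  | branch_false hc _ ih =>
    cases h₂ with
    | branch_true h _ => exact absurd h hc
    | branch_false _ a => exact ih a
  | loop_true hc _ _ ih₁ ih₂ =>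
    cases h₂ with
    | loop_true _ a b => obtain rfl := ih₁ a; exact ih₂ b
    | loop_false h => exact absurd hc h
  | loop_false hc =>
    cases h₂ with
    | loop_true h _ _ => exact absurd h hc
    | loop_false _ => rfl

theorem Exec.one_le {w : ℕ} {D : List Bool} {p : Prog} {σ σ' : State w} {k : ℕ}
    (h : Exec D p σ σ' k) : 1 ≤ k := by
  induction h <;> omega

theorem Answers.one_le {w n m q : ℕ} {D : List Bool} {p : Prog} {t : ℝ} {ans : ℕ → ℕ → Prop}
    (h : Answers w n m D p q t ans) : 1 ≤ t := by
  obtain ⟨σ, k, h, hk, -⟩ := h fun _ => 0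
  exact le_trans (by exact_mod_cast h.one_le) hk

theorem Answers.mono {w n m q : ℕ} {D : List Bool} {p : Prog} {t t' : ℝ} {ans : ℕ → ℕ → Prop}
    (h : Answers w n m D p q t ans) (ht : t ≤ t') : Answers w n m D p q t' ans := by
  intro mem
  obtain ⟨σ, k, h, hk, ha⟩ := h mem
  exact ⟨σ, k, h, hk.trans ht, ha⟩

/-- The registers that hold the variables and the intermediate values of expressions. -/
def varReg (i : ℕ) : ℕ := if i < 5 then i else 3 * i

/-- Registers of the two classes `c = 1, 2`, which are used for running other programs. -/
def classReg (c r : ℕ) : ℕ := 3 * r + 15 + c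

/-- Variables 0 to 4 are the input registers themselves. The other ones occupy the multiples of
three from 15 on, which leaves the residues 1 and 2 modulo 3 to the two register classes. -/
theorem varReg_injective : Function.Injective varReg := by
  intro i j h
  unfold varReg at h
  split_ifs at h <;> omega

theorem varReg_inj {i j : ℕ} : varReg i = varReg j ↔ i = j := varReg_injective.eq_iff

theorem classReg_inj {c i j : ℕ} : classReg c i = classReg c j ↔ i = j := by
  unfold classReg
  omega

theorem classReg_ne_varReg {c r i : ℕ} (hc : c = 1 ∨ c = 2) : classReg c r ≠ varReg i := by
  unfold varReg classReg
  split_ifs <;> omega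

/-! ### Expressions -/

/-- Expressions over eight variables; `ite a b x y` is the value of `x` if `a < b` and that of `y`
otherwise. -/
inductive Expr where
  | var (i : Fin 8)
  | lit (c : ℕ)
  | op (o : BinOp) (a b : Expr)
  | probe (a : Expr)
  | ite (a b x y : Expr)

namespace Expr

def eval {w : ℕ} (D : List Bool) (env : Fin 8 → BitVec w) : Expr → BitVec w
  | var i => env i
  | lit c => BitVec.ofNat w c
  | op o a b => o.eval (a.eval D env) (b.eval D env)
  | probe a => dataWord D (a.eval D env)
  | ite a b x y =>
    if (a.eval D env).toNat < (b.eval D env).toNat then x.eval D env else y.eval D env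

/-- The program that puts the value of an expression into the register `varReg d`. -/
def compile : Expr → ℕ → Prog
  | var i, d => .move (varReg d) (varReg i)
  | lit c, d => .const (varReg d) c
  | op o a b, d => .seq (a.compile d) (.seq (b.compile (d + 1))
      (.op o (varReg d) (varReg d) (varReg (d + 1))))
  | probe a, d => .seq (a.compile d) (.probe (varReg d) (varReg d))
  | ite a b x y, d => .seq (a.compile d) (.seq (b.compile (d + 1))
      (.branch (.lt (varReg d) (varReg (d + 1))) (x.compile d) (y.compile d)))

/-- An upper bound for the time needed to evaluate an expression. -/
def cost : Expr → ℕ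
  | var _ => 1
  | lit _ => 1
  | op _ a b => a.cost + b.cost + 1
  | probe a => a.cost + 1
  | ite a b x y => a.cost + b.cost + x.cost + y.cost + 1

end Expr

/-- The values of the variables. -/
def State.env {w : ℕ} (σ : State w) (i : Fin 8) : BitVec w := σ.reg (varReg i)

/-- Every register outside `S` and the memory have the same contents in both states. -/
def EqOff {w : ℕ} (S : Set ℕ) (σ τ : State w) : Prop :=
  τ.mem = σ.mem ∧ ∀ r ∉ S, τ.reg r = σ.reg r

theorem EqOff.trans {w : ℕ} {S T : Set ℕ} {σ τ ρ : State w} (h : EqOff S σ τ) (h' : EqOff T τ ρ)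
    (hST : S ⊆ T) : EqOff T σ ρ :=
  ⟨h'.1.trans h.1, fun r hr => (h'.2 r hr).trans (h.2 r fun hS => hr (hST hS))⟩

theorem EqOff.mono {w : ℕ} {S T : Set ℕ} {σ τ : State w} (h : EqOff S σ τ) (hST : S ⊆ T) :
    EqOff T σ τ := ⟨h.1, fun r hr => h.2 r fun hS => hr (hST hS)⟩

theorem EqOff.setReg {w : ℕ} {S : Set ℕ} (σ : State w) {r : ℕ} (v : BitVec w) (hr : r ∈ S) :
    EqOff S σ (σ.setReg r v) :=
  ⟨rfl, fun i hi => Function.update_of_ne (fun h => hi (by rwa [h])) _ _⟩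

@[simp] theorem State.setReg_reg_self {w : ℕ} (σ : State w) (r : ℕ) (v : BitVec w) :
    (σ.setReg r v).reg r = v := Function.update_self _ _ _

theorem State.setReg_reg_ne {w : ℕ} (σ : State w) {r i : ℕ} (v : BitVec w) (h : i ≠ r) :
    (σ.setReg r v).reg i = σ.reg i := Function.update_of_ne h _ _

/-- The registers for the intermediate values of an expression. -/
def tempRegs (d : ℕ) : Set ℕ := {r | ∃ j, d ≤ j ∧ r = varReg j}

theorem varReg_mem_tempRegs {d j : ℕ} : varReg j ∈ tempRegs d ↔ d ≤ j := by
  constructor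
  · rintro ⟨i, hi, h⟩
    rwa [varReg_injective h]
  · exact fun h => ⟨j, h, rfl⟩

theorem tempRegs_anti {d e : ℕ} (h : d ≤ e) : tempRegs e ⊆ tempRegs d := by
  rintro r ⟨j, hj, rfl⟩
  exact ⟨j, h.trans hj, rfl⟩

theorem EqOff.env_eq {w : ℕ} {d : ℕ} {σ τ : State w} (h : EqOff (tempRegs d) σ τ) (hd : 8 ≤ d) :
    τ.env = σ.env := by
  funext i
  refine h.2 _ ?_
  rw [varReg_mem_tempRegs]
  omega

/-- Temporary registers act as a stack: the result goes to depth `d`, a second operand to `d + 1`,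
and nothing below `d` changes. Since `d ≥ 8`, the variables survive. -/
theorem Expr.exec_compile {w : ℕ} (D : List Bool) (e : Expr) (d : ℕ) (hd : 8 ≤ d) (σ : State w) :
    ∃ σ' k, Exec D (e.compile d) σ σ' k ∧ k ≤ e.cost ∧ σ'.reg (varReg d) = e.eval D σ.env ∧
      EqOff (tempRegs d) σ σ' := by
  have self (d : ℕ) : varReg d ∈ tempRegs d := varReg_mem_tempRegs.2 le_rfl
  have keep {σ τ : State w} (d : ℕ) (h : EqOff (tempRegs (d + 1)) σ τ) :
      τ.reg (varReg d) = σ.reg (varReg d) := h.2 _ (by rw [varReg_mem_tempRegs]; omega)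
  induction e generalizing d σ with
  | var i =>
    exact ⟨_, _, .move _ _ _, le_rfl, by simp [eval, State.env], .setReg _ _ (self d)⟩
  | lit c => exact ⟨_, _, .const _ _ _, le_rfl, by simp [eval], .setReg _ _ (self d)⟩
  | op o a b iha ihb =>
    obtain ⟨σ₁, k₁, h₁, c₁, v₁, f₁⟩ := iha d hd σ
    obtain ⟨σ₂, k₂, h₂, c₂, v₂, f₂⟩ := ihb (d + 1) (by omega) σ₁
    refine ⟨_, _, .seq h₁ (.seq h₂ (.op _ _ _ _ _)), by simp only [cost]; omega, ?_, ?_⟩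
    · rw [State.setReg_reg_self, v₂, keep d f₂, v₁, f₁.env_eq hd, eval]
    · exact f₁.trans ((f₂.mono (tempRegs_anti (by omega))).trans (.setReg _ _ (self d)) subset_rfl)
        subset_rfl
  | probe a iha =>
    obtain ⟨σ₁, k₁, h₁, c₁, v₁, f₁⟩ := iha d hd σ
    refine ⟨_, _, .seq h₁ (.probe _ _ _), by simp only [cost]; omega, ?_, ?_⟩
    · rw [State.setReg_reg_self, v₁, eval]
    · exact f₁.trans (.setReg _ _ (self d)) subset_rfl
  | ite a b x y iha ihb ihx ihy =>
    obtain ⟨σ₁, k₁, h₁, c₁, v₁, f₁⟩ := iha d hd σ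
    obtain ⟨σ₂, k₂, h₂, c₂, v₂, f₂⟩ := ihb (d + 1) (by omega) σ₁
    have f₁₂ : EqOff (tempRegs d) σ σ₂ :=
      f₁.trans (f₂.mono (tempRegs_anti (by omega))) subset_rfl
    by_cases hc : (a.eval D σ.env).toNat < (b.eval D σ.env).toNat
    · obtain ⟨σ₃, k₃, h₃, c₃, v₃, f₃⟩ := ihx d hd σ₂
      refine ⟨σ₃, _, .seq h₁ (.seq h₂ (.branch_true ?_ h₃)), by simp only [cost]; omega, ?_,
        f₁₂.trans f₃ subset_rfl⟩
      · rwa [Cond.holds, v₂, keep d f₂, v₁, f₁.env_eq hd]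
      · rw [v₃, eval, if_pos hc, f₁₂.env_eq hd]
    · obtain ⟨σ₃, k₃, h₃, c₃, v₃, f₃⟩ := ihy d hd σ₂
      refine ⟨σ₃, _, .seq h₁ (.seq h₂ (.branch_false ?_ h₃)), by simp only [cost]; omega, ?_,
        f₁₂.trans f₃ subset_rfl⟩
      · rwa [Cond.holds, v₂, keep d f₂, v₁, f₁.env_eq hd]
      · rw [v₃, eval, if_neg hc, f₁₂.env_eq hd]

/-- The program that puts the value of the expression `e` into the register `r`. -/
def assign (r : ℕ) (e : Expr) : Prog := .seq (e.compile 8) (.move r (varReg 8))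

theorem exec_assign {w : ℕ} (D : List Bool) (r : ℕ) (e : Expr) (σ : State w) :
    ∃ σ' k, Exec D (assign r e) σ σ' k ∧ k ≤ e.cost + 1 ∧ σ'.reg r = e.eval D σ.env ∧
      EqOff (insert r (tempRegs 8)) σ σ' := by
  obtain ⟨σ₁, k₁, h₁, c₁, v₁, f₁⟩ := e.exec_compile D 8 le_rfl σ
  exact ⟨_, _, .seq h₁ (.move _ _ _), by omega, by rw [State.setReg_reg_self, v₁],
    f₁.trans (.setReg _ _ (Set.mem_insert _ _)) (Set.subset_insert _ _)⟩

/-! ### Running a program inside another one -/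

def Cond.rename (ρ : ℕ → ℕ) : Cond → Cond
  | .eq x y => .eq (ρ x) (ρ y)
  | .lt x y => .lt (ρ x) (ρ y)

/-- The program `p` on other registers, where accesses to the data are replaced by the evaluation
of the expression `e`, whose variable `5` holds the index of the requested word. -/
def Prog.simulate (ρ : ℕ → ℕ) (e : Expr) : Prog → Prog
  | .skip => .skip
  | .const dst c => .const (ρ dst) c
  | .move dst src => .move (ρ dst) (ρ src)
  | .op o dst x y => .op o (ρ dst) (ρ x) (ρ y)
  | .probe dst addr => .seq (.move (varReg 5) (ρ addr)) (assign (ρ dst) e)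
  | .load dst addr => .load (ρ dst) (ρ addr)
  | .store addr src => .store (ρ addr) (ρ src)
  | .seq p q => .seq (p.simulate ρ e) (q.simulate ρ e)
  | .branch c p q => .branch (c.rename ρ) (p.simulate ρ e) (q.simulate ρ e)
  | .loop c p => .loop (c.rename ρ) (p.simulate ρ e)

/-- The registers that a simulation in the class `c` changes. -/
def simRegs (c : ℕ) : Set ℕ := insert (varReg 5) (tempRegs 8) ∪ Set.range (classReg c)

/-- `e` computes the words of `D` from `D'`, for the given values of the variables but the
fifth. -/
def Simulates {w : ℕ} (D' D : List Bool) (e : Expr) (env : Fin 8 → BitVec w) : Prop :=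
  ∀ a, e.eval D' (Function.update env 5 a) = dataWord D a

theorem varReg_notMem_simRegs {c : ℕ} (hc : c = 1 ∨ c = 2) {i : ℕ} (hi : i < 8) (h5 : i ≠ 5) :
    varReg i ∉ simRegs c := by
  rintro ((h | h) | ⟨r, h⟩)
  · exact h5 (varReg_injective h)
  · rw [varReg_mem_tempRegs] at h
    omega
  · exact classReg_ne_varReg hc h

theorem EqOff.env_update {w : ℕ} {c : ℕ} (hc : c = 1 ∨ c = 2) {τ τ' : State w}
    (h : EqOff (simRegs c) τ τ') (a : BitVec w) :
    Function.update τ'.env 5 a = Function.update τ.env 5 a := by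
  funext i
  by_cases hi : i = 5
  · simp [hi]
  · rw [Function.update_of_ne hi, Function.update_of_ne hi]
    exact h.2 _ (varReg_notMem_simRegs hc i.2 fun h => hi (Fin.ext h))

/-- Induction on the execution, with the class registers mirroring the registers of the simulated
program and the working memory shared. The factor `e.cost + 2` comes from a data access: one move of
the address, then an assignment of `e`. All other steps are copied one to one. -/
theorem Exec.simulate {w : ℕ} {D D' : List Bool} {c : ℕ} (hc : c = 1 ∨ c = 2) {e : Expr}
    {p : Prog} {σ σ' : State w} {k : ℕ} (h : Exec D p σ σ' k) (τ : State w)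
    (hreg : ∀ r, τ.reg (classReg c r) = σ.reg r) (hmem : τ.mem = σ.mem)
    (hsim : Simulates D' D e τ.env) :
    ∃ τ' k', Exec D' (p.simulate (classReg c) e) τ τ' k' ∧ k' ≤ (e.cost + 2) * k ∧
      (∀ r, τ'.reg (classReg c r) = σ'.reg r) ∧ τ'.mem = σ'.mem ∧
      ∀ r ∉ simRegs c, τ'.reg r = τ.reg r := by
  have holds (b : Cond) {σ τ : State w} (h : ∀ r, τ.reg (classReg c r) = σ.reg r) :
      (b.rename (classReg c)).holds τ ↔ b.holds σ := by
    cases b <;> simp [Cond.rename, Cond.holds, h]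
  -- A simulation changes no variable other than the fifth, and `Simulates` quantifies over the
  -- value of that one, so the hypothesis persists along the run.
  have sim' {τ τ' : State w} (h : ∀ r ∉ simRegs c, τ'.reg r = τ.reg r)
      (hsim : Simulates D' D e τ.env) : Simulates D' D e τ'.env := by
    intro a
    rw [← hsim a]
    congr 1
    have hh : EqOff (simRegs c) { τ with mem := τ'.mem } τ' := ⟨rfl, h⟩
    exact hh.env_update hc a
  have upd (σ τ : State w) (h : ∀ r, τ.reg (classReg c r) = σ.reg r) (d : ℕ) (v : BitVec w) :
      (∀ r, (τ.setReg (classReg c d) v).reg (classReg c r) = (σ.setReg d v).reg r) ∧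
      ∀ r ∉ simRegs c, (τ.setReg (classReg c d) v).reg r = τ.reg r := by
    constructor
    · intro r
      by_cases hr : r = d
      · simp [hr]
      · rw [State.setReg_reg_ne _ _ hr, State.setReg_reg_ne _ _ (by rwa [Ne, classReg_inj]), h]
    · intro r hr
      refine State.setReg_reg_ne _ _ ?_
      rintro rfl
      exact hr (Or.inr ⟨d, rfl⟩)
  have pos : 1 ≤ (e.cost + 2) * 1 := by omega
  induction h generalizing τ with
  | skip σ => exact ⟨τ, 1, .skip _, pos, hreg, hmem, fun _ _ => rfl⟩
  | const σ dst b =>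
    exact ⟨_, 1, .const _ _ _, pos, (upd σ τ hreg _ _).1, hmem, (upd σ τ hreg _ _).2⟩
  | move σ dst src =>
    refine ⟨_, 1, .move _ _ _, pos, ?_, hmem, (upd σ τ hreg _ _).2⟩
    rw [hreg src]
    exact (upd σ τ hreg _ _).1
  | op σ o dst x y =>
    refine ⟨_, 1, .op _ _ _ _ _, pos, ?_, hmem, (upd σ τ hreg _ _).2⟩
    rw [hreg x, hreg y]
    exact (upd σ τ hreg _ _).1
  | probe σ dst addr =>
    obtain ⟨τ₂, k, h₂, hk, v₂, f₂⟩ := exec_assign D' (classReg c dst) e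
      (τ.setReg (varReg 5) (τ.reg (classReg c addr)))
    have henv : (τ.setReg (varReg 5) (τ.reg (classReg c addr))).env =
        Function.update τ.env 5 (σ.reg addr) := by
      funext i
      by_cases hi : i = 5
      · subst hi
        rw [Function.update_self, ← hreg]
        exact State.setReg_reg_self _ _ _
      · rw [Function.update_of_ne hi]
        exact State.setReg_reg_ne _ _ (fun h => hi (Fin.ext (varReg_injective h)))
    refine ⟨τ₂, 1 + k, .seq (.move _ _ _) h₂, by omega, ?_, f₂.1.trans hmem, ?_⟩
    · intro r
      by_cases hr : r = dst
      · rw [hr, v₂, State.setReg_reg_self, henv, hsim]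
      · rw [State.setReg_reg_ne _ _ hr, f₂.2, State.setReg_reg_ne _ _ (classReg_ne_varReg hc), hreg]
        rintro (h | ⟨j, -, h⟩)
        · exact hr (classReg_inj.1 h)
        · exact classReg_ne_varReg hc h
    · intro r hr
      rw [f₂.2, State.setReg_reg_ne]
      · rintro rfl
        exact hr (Or.inl (Or.inl rfl))
      · rintro (h | h)
        · exact hr (Or.inr ⟨dst, h.symm⟩)
        · exact hr (Or.inl (Or.inr h))
  | load σ dst addr =>
    refine ⟨_, 1, .load _ _ _, pos, ?_, hmem, (upd σ τ hreg _ _).2⟩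
    rw [hreg addr, hmem]
    exact (upd σ τ hreg _ _).1
  | store σ addr src =>
    refine ⟨_, 1, .store _ _ _, pos, hreg, ?_, fun _ _ => rfl⟩
    simp only [State.setMem, hreg, hmem]
  | seq _ _ ih₁ ih₂ =>
    obtain ⟨τ₁, k₁, h₁, c₁, r₁, m₁, f₁⟩ := ih₁ τ hreg hmem hsim
    obtain ⟨τ₂, k₂, h₂, c₂, r₂, m₂, f₂⟩ := ih₂ τ₁ r₁ m₁ (sim' f₁ hsim)
    exact ⟨τ₂, _, .seq h₁ h₂, by rw [mul_add]; omega, r₂, m₂,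
      fun r hr => (f₂ r hr).trans (f₁ r hr)⟩
  | branch_true hb _ ih =>
    obtain ⟨τ₁, k₁, h₁, c₁, r₁, m₁, f₁⟩ := ih τ hreg hmem hsim
    exact ⟨τ₁, _, .branch_true ((holds _ hreg).2 hb) h₁, by rw [mul_add]; omega, r₁, m₁, f₁⟩
  | branch_false hb _ ih =>
    obtain ⟨τ₁, k₁, h₁, c₁, r₁, m₁, f₁⟩ := ih τ hreg hmem hsim
    exact ⟨τ₁, _, .branch_false (by rwa [holds _ hreg]) h₁,
      by rw [mul_add]; omega, r₁, m₁, f₁⟩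
  | loop_true hb _ _ ih₁ ih₂ =>
    obtain ⟨τ₁, k₁, h₁, c₁, r₁, m₁, f₁⟩ := ih₁ τ hreg hmem hsim
    obtain ⟨τ₂, k₂, h₂, c₂, r₂, m₂, f₂⟩ := ih₂ τ₁ r₁ m₁ (sim' f₁ hsim)
    exact ⟨τ₂, _, .loop_true ((holds _ hreg).2 hb) h₁ h₂, by rw [mul_add, mul_add]; omega, r₂, m₂,
      fun r hr => (f₂ r hr).trans (f₁ r hr)⟩
  | loop_false hb =>
    exact ⟨τ, 1, .loop_false (by rwa [holds _ hreg]), pos, hreg, hmem, fun _ _ => rfl⟩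

end WordRAM

/-! ### Time-bounded runs and subroutine calls. -/

namespace WordRAM

/-- Started in the state `σ`, the program `p` halts in time at most `T` in a state with the
property `Q`. -/
def Runs {w : ℕ} (D : List Bool) (p : Prog) (σ : State w) (T : ℝ) (Q : State w → Prop) : Prop :=
  ∃ σ' k, Exec D p σ σ' k ∧ (k : ℝ) ≤ T ∧ Q σ'

theorem Runs.mono {w : ℕ} {D : List Bool} {p : Prog} {σ : State w} {T T' : ℝ}
    {Q Q' : State w → Prop} (h : Runs D p σ T Q) (hT : T ≤ T') (hQ : ∀ σ', Q σ' → Q' σ') :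
    Runs D p σ T' Q' := by
  obtain ⟨σ', k, h, hk, hq⟩ := h
  exact ⟨σ', k, h, hk.trans hT, hQ _ hq⟩

theorem Runs.seq {w : ℕ} {D : List Bool} {p q : Prog} {σ : State w} {T₁ T₂ : ℝ}
    {Q₁ Q₂ : State w → Prop} (h₁ : Runs D p σ T₁ Q₁) (h₂ : ∀ σ', Q₁ σ' → Runs D q σ' T₂ Q₂) :
    Runs D (.seq p q) σ (T₁ + T₂) Q₂ := by
  obtain ⟨σ₁, k₁, h₁, hk₁, hq₁⟩ := h₁
  obtain ⟨σ₂, k₂, h₂, hk₂, hq₂⟩ := h₂ _ hq₁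
  exact ⟨σ₂, _, .seq h₁ h₂, by push_cast; linarith, hq₂⟩

theorem runs_assign {w : ℕ} (D : List Bool) (r : ℕ) (e : Expr) (σ : State w) :
    Runs D (assign r e) σ (e.cost + 1) fun σ' =>
      σ'.reg r = e.eval D σ.env ∧ EqOff (insert r (tempRegs 8)) σ σ' := by
  obtain ⟨σ', k, h, hk, h'⟩ := exec_assign D r e σ
  exact ⟨σ', k, h, by exact_mod_cast hk, h'⟩

/-- Branching on `a < b`. -/
def ifLt (a b : Expr) (p q : Prog) : Prog :=
  .seq (a.compile 8) (.seq (b.compile 9) (.branch (.lt (varReg 8) (varReg 9)) p q))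

theorem Runs.ifLt {w : ℕ} {D : List Bool} {a b : Expr} {p q : Prog} {σ : State w} {T : ℝ}
    {Q : State w → Prop}
    (hp : (a.eval D σ.env).toNat < (b.eval D σ.env).toNat →
      ∀ σ', EqOff (tempRegs 8) σ σ' → Runs D p σ' T Q)
    (hq : ¬ (a.eval D σ.env).toNat < (b.eval D σ.env).toNat →
      ∀ σ', EqOff (tempRegs 8) σ σ' → Runs D q σ' T Q) :
    Runs D (ifLt a b p q) σ (a.cost + b.cost + 1 + T) Q := by
  obtain ⟨σ₁, k₁, h₁, c₁, v₁, f₁⟩ := a.exec_compile D 8 le_rfl σ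
  obtain ⟨σ₂, k₂, h₂, c₂, v₂, f₂⟩ := b.exec_compile D 9 (by norm_num) σ₁
  have hv : σ₂.reg (varReg 8) = a.eval D σ.env := by
    rw [f₂.2 _ (by rw [varReg_mem_tempRegs]; omega), v₁]
  rw [f₁.env_eq le_rfl] at v₂
  have f := f₁.trans (f₂.mono (tempRegs_anti (by norm_num : 8 ≤ 9))) subset_rfl
  have c₁' : (k₁ : ℝ) ≤ a.cost := by exact_mod_cast c₁
  have c₂' : (k₂ : ℝ) ≤ b.cost := by exact_mod_cast c₂
  by_cases hc : (a.eval D σ.env).toNat < (b.eval D σ.env).toNat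
  · obtain ⟨σ₃, k₃, h₃, c₃, hQ⟩ := hp hc σ₂ f
    exact ⟨σ₃, _, .seq h₁ (.seq h₂ (.branch_true (by rwa [Cond.holds, hv, v₂]) h₃)),
      by push_cast; linarith, hQ⟩
  · obtain ⟨σ₃, k₃, h₃, c₃, hQ⟩ := hq hc σ₂ f
    exact ⟨σ₃, _, .seq h₁ (.seq h₂ (.branch_false (by rwa [Cond.holds, hv, v₂]) h₃)),
      by push_cast; linarith, hQ⟩

/-- The variables `1, …, 4` hold the parameters. -/
structure HasParams {w : ℕ} (n m : ℕ) (env : Fin 8 → BitVec w) : Prop where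
  card : env 1 = BitVec.ofNat w n
  univ : env 2 = BitVec.ofNat w m
  word : env 3 = BitVec.ofNat w w
  size : env 4 = BitVec.ofNat w m.size

/-- The registers of the class `c` have their initial values, apart from those for parameters. -/
def ClassClear {w : ℕ} (c : ℕ) (σ : State w) : Prop := ∀ r, σ.reg (classReg c (r + 5)) = 0

/-- Run `p` on the query `q` with the registers of the class `c`, replacing the accesses to the
data by the expression `e`, and put the answer into the variable `out`. -/
def call (c : ℕ) (e : Expr) (p : Prog) (q : Expr) (out : Fin 8) : Prog :=
  .seq (assign (classReg c 0) q) (.seq (assign (classReg c 1) (.var 1))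
    (.seq (assign (classReg c 2) (.var 2)) (.seq (assign (classReg c 3) (.var 3))
      (.seq (assign (classReg c 4) (.var 4)) (.seq (p.simulate (classReg c) e)
        (.move (varReg out) (classReg c 0)))))))

theorem EqOff.env_eq_of_class {w : ℕ} {c r : ℕ} (hc : c = 1 ∨ c = 2) {σ τ : State w}
    (h : EqOff (insert (classReg c r) (tempRegs 8)) σ τ) : τ.env = σ.env := by
  funext i
  refine h.2 _ ?_
  rintro (h | h)
  · exact classReg_ne_varReg hc h.symm
  · rw [varReg_mem_tempRegs] at h
    omega

/-- The first five registers of the class are loaded as in `State.init`; the remaining ones must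
still be zero, so a class serves for one call, and two successive calls need two classes. The
working memory may be dirty by then, which `Answers` permits. -/
theorem runs_call {w : ℕ} {D D' : List Bool} {c : ℕ} (hc : c = 1 ∨ c = 2) {e : Expr} {p : Prog}
    {q : Expr} {out : Fin 8} {n m Q : ℕ} {t : ℝ} {ans : ℕ → ℕ → Prop} {τ : State w}
    (hp : HasParams n m τ.env) (hclear : ClassClear c τ)
    (hq : q.eval D' τ.env = BitVec.ofNat w Q) (hsim : Simulates D' D e τ.env)
    (h : Answers w n m D p Q t ans) :
    Runs D' (call c e p q out) τ ((q.cost + e.cost + 12) * t) fun τ' =>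
      (∃ b, ans (τ'.env out).toNat b) ∧ (∀ i, i ≠ 5 → i ≠ out → τ'.env i = τ.env i) ∧
      ∀ c', (c' = 1 ∨ c' = 2) → c' ≠ c → ClassClear c' τ → ClassClear c' τ' := by
  have key (r : ℕ) {σ σ' : State w} (f : EqOff (insert (classReg c r) (tempRegs 8)) σ σ') (i : ℕ)
      (hi : i ≠ r) : σ'.reg (classReg c i) = σ.reg (classReg c i) := by
    refine f.2 _ ?_
    rintro (h | ⟨j, -, h⟩)
    · exact hi (classReg_inj.1 h)
    · exact classReg_ne_varReg hc h
  have sub (r : ℕ) : insert (classReg c r) (tempRegs 8) ⊆ simRegs c := by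
    rintro x (rfl | hx)
    · exact Or.inr ⟨r, rfl⟩
    · exact Or.inl (Or.inr hx)
  obtain ⟨σ₀, k₀, h₀, c₀, v₀, f₀⟩ := exec_assign D' (classReg c 0) q τ
  obtain ⟨σ₁, k₁, h₁, c₁, v₁, f₁⟩ := exec_assign D' (classReg c 1) (.var 1) σ₀
  obtain ⟨σ₂, k₂, h₂, c₂, v₂, f₂⟩ := exec_assign D' (classReg c 2) (.var 2) σ₁
  obtain ⟨σ₃, k₃, h₃, c₃, v₃, f₃⟩ := exec_assign D' (classReg c 3) (.var 3) σ₂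
  obtain ⟨σ₄, k₄, h₄, c₄, v₄, f₄⟩ := exec_assign D' (classReg c 4) (.var 4) σ₃
  have e₀ := f₀.env_eq_of_class hc
  have e₁ := (f₁.env_eq_of_class hc).trans e₀
  have e₂ := (f₂.env_eq_of_class hc).trans e₁
  have e₃ := (f₃.env_eq_of_class hc).trans e₂
  have e₄ := (f₄.env_eq_of_class hc).trans e₃
  rw [e₀, Expr.eval, hp.card] at v₁
  rw [e₁, Expr.eval, hp.univ] at v₂
  rw [e₂, Expr.eval, hp.word] at v₃
  rw [e₃, Expr.eval, hp.size] at v₄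
  rw [hq] at v₀
  have hall : EqOff (simRegs c) τ σ₄ :=
    (((((f₀.mono (sub 0)).trans (f₁.mono (sub 1)) subset_rfl).trans (f₂.mono (sub 2))
      subset_rfl).trans (f₃.mono (sub 3)) subset_rfl).trans (f₄.mono (sub 4)) subset_rfl)
  obtain ⟨σ', k, hex, hk, ha⟩ := h σ₄.mem
  have hreg : ∀ r, σ₄.reg (classReg c r) = (State.init w n m Q σ₄.mem).reg r := by
    intro r
    match r with
    | 0 =>
      rw [key 4 f₄ _ (by omega), key 3 f₃ _ (by omega), key 2 f₂ _ (by omega),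
        key 1 f₁ _ (by omega), v₀]
      rfl
    | 1 =>
      rw [key 4 f₄ _ (by omega), key 3 f₃ _ (by omega), key 2 f₂ _ (by omega), v₁]
      rfl
    | 2 =>
      rw [key 4 f₄ _ (by omega), key 3 f₃ _ (by omega), v₂]
      rfl
    | 3 =>
      rw [key 4 f₄ _ (by omega), v₃]
      rfl
    | 4 => exact v₄
    | r + 5 =>
      rw [key 4 f₄ _ (by omega), key 3 f₃ _ (by omega), key 2 f₂ _ (by omega),
        key 1 f₁ _ (by omega), key 0 f₀ _ (by omega), hclear]
      rfl
  obtain ⟨τ', k', hex', hk', hreg', -, hkeep⟩ := hex.simulate (D' := D') (e := e) hc σ₄ hreg rfl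
    (by rwa [e₄])
  have hk1 : (1 : ℝ) ≤ k := by exact_mod_cast hex.one_le
  have hfin : ∀ r ∉ simRegs c, r ≠ varReg out →
      (τ'.setReg (varReg out) (τ'.reg (classReg c 0))).reg r = τ.reg r := by
    intro r hr hr'
    rw [State.setReg_reg_ne _ _ hr', hkeep r hr, hall.2 r hr]
  refine ⟨_, _, .seq h₀ (.seq h₁ (.seq h₂ (.seq h₃ (.seq h₄ (.seq hex' (.move _ _ _)))))), ?_,
    ⟨(σ'.reg 1).toNat, ?_⟩, ?_, ?_⟩
  -- Loading the query takes at most `q.cost + 1` steps, the four parameters two each, the final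
  -- move one; with `1 ≤ k ≤ t` everything is absorbed in a multiple of `t`.
  · have hc' : k₀ + (k₁ + (k₂ + (k₃ + (k₄ + (k' + 1))))) ≤
        (e.cost + 2) * k + q.cost + 10 := by
      simp only [Expr.cost] at c₁ c₂ c₃ c₄
      omega
    have hc'' : ((k₀ + (k₁ + (k₂ + (k₃ + (k₄ + (k' + 1))))) : ℕ) : ℝ) ≤
        (e.cost + 2) * k + q.cost + 10 := by exact_mod_cast hc'
    refine hc''.trans ?_
    have hq0 : (0 : ℝ) ≤ q.cost := by positivity
    have he0 : (0 : ℝ) ≤ e.cost := by positivity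
    nlinarith
  · rw [State.env, State.setReg_reg_self, hreg' 0]
    exact ha
  · intro i h5 hi
    exact hfin _ (varReg_notMem_simRegs hc i.2 fun h => h5 (Fin.ext h))
      fun h => hi (Fin.ext (varReg_injective h))
  · intro c' hc' hne hcl r
    rw [hfin, hcl]
    · rintro ((h | ⟨j, -, h⟩) | ⟨j, h⟩)
      · exact classReg_ne_varReg hc' h
      · exact classReg_ne_varReg hc' h
      · unfold classReg at h
        omega
    · exact classReg_ne_varReg hc'

/-- A state in which a query starts, up to registers that are of no importance. -/
structure Ready {w : ℕ} (n m q : ℕ) (σ : State w) : Prop extends HasParams n m σ.env where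
  query : σ.env 0 = BitVec.ofNat w q
  clear_one : ClassClear 1 σ
  clear_two : ClassClear 2 σ

theorem ready_init (w n m q : ℕ) (mem : BitVec w → BitVec w) :
    Ready n m q (State.init w n m q mem) where
  card := rfl
  univ := rfl
  word := rfl
  size := rfl
  query := rfl
  clear_one _ := rfl
  clear_two _ := rfl

theorem Ready.of_eqOff {w n m q : ℕ} {σ τ : State w} (h : Ready n m q σ)
    (f : EqOff (tempRegs 8) σ τ) : Ready n m q τ := by
  have cl (c : ℕ) (hc : c = 1 ∨ c = 2) (h : ClassClear c σ) : ClassClear c τ := by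
    intro r
    rw [f.2, h]
    rintro ⟨j, -, h⟩
    exact classReg_ne_varReg hc h
  constructor
  · rw [f.env_eq le_rfl]
    exact h.toHasParams
  · rw [f.env_eq le_rfl]
    exact h.query
  · exact cl 1 (Or.inl rfl) h.clear_one
  · exact cl 2 (Or.inr rfl) h.clear_two

theorem answers_of_runs {w n m q : ℕ} {D : List Bool} {p : Prog} {t : ℝ} {ans : ℕ → ℕ → Prop}
    (h : ∀ σ : State w, Ready n m q σ →
      Runs D p σ t fun σ' => ans (σ'.reg 0).toNat (σ'.reg 1).toNat) :
    Answers w n m D p q t ans := fun mem => h _ (ready_init w n m q mem)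

end WordRAM

/-! ### Values of expressions -/

namespace WordRAM

namespace Expr

instance : Add Expr := ⟨.op .add⟩
instance : Sub Expr := ⟨.op .sub⟩
instance : Mul Expr := ⟨.op .mul⟩
instance : Div Expr := ⟨.op .div⟩
instance : Mod Expr := ⟨.op .mod⟩
instance : AndOp Expr := ⟨.op .and⟩
instance : OrOp Expr := ⟨.op .or⟩
instance : ShiftLeft Expr := ⟨.op .shl⟩
instance : ShiftRight Expr := ⟨.op .shr⟩

end Expr

section Rules

variable {w : ℕ} (D : List Bool) (env : Fin 8 → BitVec w)

/-- The expression `e` has the value `v`. -/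
def Ev (e : Expr) (v : ℕ) : Prop := (e.eval D env).toNat = v

variable {D env}

theorem Ev.lt {e : Expr} {v : ℕ} (h : Ev D env e v) : v < 2 ^ w := by
  rw [← h]
  exact BitVec.isLt _

theorem Ev.lit {c : ℕ} (h : c < 2 ^ w) : Ev D env (.lit c) c := by
  rw [Ev, Expr.eval, BitVec.toNat_ofNat, Nat.mod_eq_of_lt h]

theorem Ev.var {i : Fin 8} {v : ℕ} (h : (env i).toNat = v) : Ev D env (.var i) v := h

theorem Ev.var_ofNat {i : Fin 8} {v : ℕ} (h : env i = BitVec.ofNat w v) (hv : v < 2 ^ w) :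
    Ev D env (.var i) v := by
  rw [Ev, Expr.eval, h, BitVec.toNat_ofNat, Nat.mod_eq_of_lt hv]

theorem Ev.eval_eq {e : Expr} {v : ℕ} (h : Ev D env e v) : e.eval D env = BitVec.ofNat w v := by
  rw [← h, BitVec.ofNat_toNat, BitVec.setWidth_eq]

theorem Ev.add_mod {a b : Expr} {x y : ℕ} (ha : Ev D env a x) (hb : Ev D env b y) :
    Ev D env (a + b) ((x + y) % 2 ^ w) := by
  change (a.eval D env + b.eval D env).toNat = _
  rw [BitVec.toNat_add, ha, hb]

theorem Ev.add {a b : Expr} {x y : ℕ} (ha : Ev D env a x) (hb : Ev D env b y)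
    (h : x + y < 2 ^ w) : Ev D env (a + b) (x + y) := by
  have := ha.add_mod hb
  rwa [Nat.mod_eq_of_lt h] at this

theorem Ev.mul_mod {a b : Expr} {x y : ℕ} (ha : Ev D env a x) (hb : Ev D env b y) :
    Ev D env (a * b) (x * y % 2 ^ w) := by
  change (a.eval D env * b.eval D env).toNat = _
  rw [BitVec.toNat_mul, ha, hb]

theorem Ev.mul {a b : Expr} {x y : ℕ} (ha : Ev D env a x) (hb : Ev D env b y)
    (h : x * y < 2 ^ w) : Ev D env (a * b) (x * y) := by
  have := ha.mul_mod hb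
  rwa [Nat.mod_eq_of_lt h] at this

theorem Ev.sub_mod {a b : Expr} {x y : ℕ} (ha : Ev D env a x) (hb : Ev D env b y) :
    Ev D env (a - b) ((2 ^ w - y + x) % 2 ^ w) := by
  change (a.eval D env - b.eval D env).toNat = _
  rw [BitVec.toNat_sub, ha, hb]

theorem Ev.sub {a b : Expr} {x y : ℕ} (ha : Ev D env a x) (hb : Ev D env b y)
    (h : y ≤ x) : Ev D env (a - b) (x - y) := by
  have := ha.sub_mod hb
  have hx := ha.lt
  rwa [show 2 ^ w - y + x = x - y + 2 ^ w by omega, Nat.add_mod_right,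
    Nat.mod_eq_of_lt (by omega)] at this

theorem Ev.div {a b : Expr} {x y : ℕ} (ha : Ev D env a x) (hb : Ev D env b y) :
    Ev D env (a / b) (x / y) := by
  change (a.eval D env / b.eval D env).toNat = _
  rw [BitVec.toNat_udiv, ha, hb]

theorem Ev.mod {a b : Expr} {x y : ℕ} (ha : Ev D env a x) (hb : Ev D env b y) :
    Ev D env (a % b) (x % y) := by
  change (a.eval D env % b.eval D env).toNat = _
  rw [BitVec.toNat_umod, ha, hb]

theorem Ev.shiftLeft {a b : Expr} {x y : ℕ} (ha : Ev D env a x) (hb : Ev D env b y)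
    (h : x * 2 ^ y < 2 ^ w) : Ev D env (a <<< b) (x * 2 ^ y) := by
  change (a.eval D env <<< (b.eval D env).toNat).toNat = _
  rw [BitVec.toNat_shiftLeft, ha, hb, Nat.shiftLeft_eq, Nat.mod_eq_of_lt h]

theorem Ev.shiftRight {a b : Expr} {x y : ℕ} (ha : Ev D env a x) (hb : Ev D env b y) :
    Ev D env (a >>> b) (x / 2 ^ y) := by
  change (a.eval D env >>> (b.eval D env).toNat).toNat = _
  rw [BitVec.toNat_ushiftRight, ha, hb, Nat.shiftRight_eq_div_pow]

theorem Ev.ite {a b c d : Expr} {x y v : ℕ} (ha : Ev D env a x) (hb : Ev D env b y)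
    (hc : x < y → Ev D env c v) (hd : ¬ x < y → Ev D env d v) :
    Ev D env (.ite a b c d) v := by
  rw [Ev, Expr.eval, ha, hb]
  split_ifs with h
  exacts [hc h, hd h]

theorem Ev.congr {e : Expr} {v v' : ℕ} (h : Ev D env e v) (hv : v = v') : Ev D env e v' := hv ▸ h

end Rules

theorem two_mul_le_two_pow {w : ℕ} (hw : 1 ≤ w) : 2 * w ≤ 2 ^ w := by
  induction w, hw using Nat.le_induction with
  | base => norm_num
  | succ w hw ih =>
    rw [pow_succ]
    omega

/-- This keeps the product in `Pos.mul` within a word for every `w`; the bound `w * w` would fail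
for small `w`. -/
theorem mul_pred_lt_two_pow (w : ℕ) : w * (w - 1) < 2 ^ w := by
  rcases Nat.lt_or_ge w 5 with h | h
  · interval_cases w <;> norm_num
  · have : w * w < 2 ^ w := by
      induction w, h using Nat.le_induction with
      | base => norm_num
      | succ w hw ih =>
        rw [pow_succ]
        nlinarith
    exact lt_of_le_of_lt (Nat.mul_le_mul_left _ (Nat.sub_le _ _)) this

/-! ### Positions of single bits

The position `p` of a bit is given by the index of a word, `p / w` modulo `2 ^ w`, and the position
`p % w` in this word.  -/

/-- A position, as a pair of expressions. -/
structure PosExpr where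
  word : Expr
  bit : Expr

/-- The pair of expressions represents the position `p`. -/
structure Pos {w : ℕ} (D : List Bool) (env : Fin 8 → BitVec w) (P : PosExpr) (p : ℕ) : Prop where
  word : Ev D env P.word (p / w % 2 ^ w)
  bit : Ev D env P.bit (p % w)

/-- The position `j * l`. -/
def PosExpr.mul (j l : Expr) : PosExpr where
  word := j / .var 3 * l + j % .var 3 * l / .var 3
  bit := j % .var 3 * l % .var 3

instance : Add PosExpr where
  add P Q :=
    { word := .ite (P.bit + Q.bit) (.var 3) (P.word + Q.word) (P.word + Q.word + .lit 1)
      bit := .ite (P.bit + Q.bit) (.var 3) (P.bit + Q.bit) (P.bit + Q.bit - .var 3) }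

instance : Sub PosExpr where
  sub P Q :=
    { word := .ite P.bit Q.bit (P.word - Q.word - .lit 1) (P.word - Q.word)
      bit := .ite P.bit Q.bit (P.bit + .var 3 - Q.bit) (P.bit - Q.bit) }

section Pos

variable {w : ℕ} {D : List Bool} {env : Fin 8 → BitVec w}

theorem ev_word (h3 : env 3 = BitVec.ofNat w w) : Ev D env (.var 3) w :=
  .var_ofNat h3 Nat.lt_two_pow_self

theorem Ev.lit_one (hw : 1 ≤ w) : Ev D env (.lit 1) 1 :=
  .lit (Nat.one_lt_two_pow (by omega))

/-- The product may exceed a word, so `J` is first split as w · (J / w) + J % w. The first part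
contributes only to the word index, and the second product is at most w(w − 1). -/
theorem Pos.mul (h3 : env 3 = BitVec.ofNat w w) (hw : 1 ≤ w) {j l : Expr} {J L : ℕ}
    (hj : Ev D env j J) (hl : Ev D env l L) (hL : L ≤ w) :
    Pos D env (.mul j l) (J * L) := by
  have hb : J % w * L < 2 ^ w := by
    refine lt_of_le_of_lt ?_ (mul_pred_lt_two_pow w)
    rw [mul_comm w]
    exact Nat.mul_le_mul (Nat.le_sub_one_of_lt (Nat.mod_lt _ hw)) hL
  have hdecomp : J * L = w * (J / w * L) + J % w * L := by
    conv_lhs => rw [← Nat.div_add_mod J w]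
    ring
  have hdiv : J * L / w = J / w * L + J % w * L / w := by
    rw [hdecomp, Nat.mul_add_div (by omega)]
  have hle : J * L / w ≤ J := by
    rw [Nat.div_le_iff_le_mul_add_pred (by omega)]
    nlinarith
  have hlt : J * L / w < 2 ^ w := lt_of_le_of_lt hle hj.lt
  have hrem : Ev D env (j % .var 3 * l) (J % w * L) := (hj.mod (ev_word h3)).mul hl hb
  constructor
  · rw [Nat.mod_eq_of_lt hlt, hdiv]
    rw [hdiv] at hlt
    exact ((hj.div (ev_word h3)).mul hl
      (lt_of_le_of_lt (Nat.le_add_right _ _) hlt)).add (hrem.div (ev_word h3)) hlt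
  · rw [show J * L % w = J % w * L % w by rw [Nat.mod_mul_mod]]
    exact hrem.mod (ev_word h3)

theorem Pos.add (h3 : env 3 = BitVec.ofNat w w) (hw : 1 ≤ w) {P Q : PosExpr} {p q : ℕ}
    (hP : Pos D env P p) (hQ : Pos D env Q q) : Pos D env (P + Q) (p + q) := by
  have h2 := two_mul_le_two_pow hw
  have hp := Nat.mod_lt p (show 0 < w by omega)
  have hq := Nat.mod_lt q (show 0 < w by omega)
  have hs : Ev D env (P.bit + Q.bit) (p % w + q % w) := hP.bit.add hQ.bit (by omega)
  have hword : Ev D env (P.word + Q.word) ((p / w + q / w) % 2 ^ w) :=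
    (hP.word.add_mod hQ.word).congr (by rw [← Nat.add_mod])
  constructor
  · refine hs.ite (ev_word h3) (fun h => ?_) fun h => ?_
    · rwa [Nat.add_div (by omega), if_neg (by omega), add_zero]
    · rw [Nat.add_div (by omega), if_pos (by omega)]
      exact (hword.add_mod (.lit_one hw)).congr (by rw [Nat.mod_add_mod])
  · refine hs.ite (ev_word h3) (fun h => ?_) fun h => ?_
    · rwa [Nat.add_mod, Nat.mod_eq_of_lt h]
    · rw [Nat.add_mod, Nat.mod_eq_sub_mod (by omega), Nat.mod_eq_of_lt (by omega)]
      exact hs.sub (ev_word h3) (by omega)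

/-- Subtraction of positions is modulo the number `w * 2 ^ w` of bits that can be addressed. -/
theorem Pos.sub_add (h3 : env 3 = BitVec.ofNat w w) (hw : 1 ≤ w) {P Q : PosExpr} {p q r : ℕ}
    (hP : Pos D env P p) (hQ : Pos D env Q q) (hr : r + q = p + w * 2 ^ w) :
    Pos D env (P - Q) r := by
  have h2 := two_mul_le_two_pow hw
  have hp := Nat.mod_lt p (show 0 < w by omega)
  have hq := Nat.mod_lt q (show 0 < w by omega)
  have hr' := Nat.mod_lt r (show 0 < w by omega)
  have e1 := Nat.div_add_mod p w
  have e2 := Nat.div_add_mod q w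
  have e3 := Nat.div_add_mod r w
  have hpw := hP.word.lt
  have key : w * (r / w + q / w) + (r % w + q % w) = w * (p / w + 2 ^ w) + p % w := by
    rw [mul_add, mul_add]
    omega
  have hmod (x y : ℕ) (h : x + y = p / w + 2 ^ w) :
      (2 ^ w - y % 2 ^ w + p / w % 2 ^ w) % 2 ^ w = x % 2 ^ w := by
    have hy := Nat.mod_lt y (show 0 < 2 ^ w by positivity)
    have : (2 ^ w - y % 2 ^ w + p / w % 2 ^ w + y) ≡ x + y [MOD 2 ^ w] :=
      calc 2 ^ w - y % 2 ^ w + p / w % 2 ^ w + y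
          ≡ 2 ^ w - y % 2 ^ w + p / w + y % 2 ^ w [MOD 2 ^ w] :=
            ((Nat.ModEq.refl _).add (Nat.mod_modEq _ _)).add (Nat.mod_modEq _ _).symm
        _ = x + y := by omega
    exact Nat.ModEq.add_right_cancel' _ this
  constructor
  · refine hP.bit.ite hQ.bit (fun h => ?_) fun h => ?_
    -- A borrow occurs: the bit parts of `r` and `q` sum to more than that of `p`, by less than 2w,
    -- so the word parts fall short by exactly one.
    · have hc : r / w + q / w + 1 = p / w + 2 ^ w := by
        have h1 : w * (r / w + q / w) < w * (p / w + 2 ^ w) := by omega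
        have h1 := Nat.lt_of_mul_lt_mul_left h1
        have h2 : w * (p / w + 2 ^ w) < w * (r / w + q / w + 2) := by
          rw [mul_add w _ 2]
          omega
        have h2 := Nat.lt_of_mul_lt_mul_left h2
        omega
      have hs := (hP.word.sub_mod hQ.word).congr (hmod (r / w + 1) (q / w) (by omega))
      have hs' := hs.sub_mod (.lit_one hw)
      have hone := Nat.one_lt_two_pow (show w ≠ 0 by omega)
      refine hs'.congr ?_
      refine Nat.ModEq.add_right_cancel' 1 ?_
      calc 2 ^ w - 1 + (r / w + 1) % 2 ^ w + 1 = (r / w + 1) % 2 ^ w + 2 ^ w := by omega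
        _ ≡ r / w + 1 + 0 [MOD 2 ^ w] :=
          (Nat.mod_modEq _ _).add (by simp [Nat.ModEq])
    · have hc : r / w + q / w = p / w + 2 ^ w := by
        have h1 : w * (r / w + q / w) < w * (p / w + 2 ^ w + 1) := by
          rw [mul_add w _ 1]
          omega
        have h1 := Nat.lt_of_mul_lt_mul_left h1
        have h2 : w * (p / w + 2 ^ w) < w * (r / w + q / w + 1) := by
          rw [mul_add w _ 1]
          omega
        have h2 := Nat.lt_of_mul_lt_mul_left h2
        omega
      exact (hP.word.sub_mod hQ.word).congr (hmod (r / w) (q / w) hc)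
  · have hmodw : (r % w + q % w) % w = p % w := by
      have := congrArg (· % w) key
      simpa only [Nat.mul_add_mod, Nat.mod_mod] using this
    refine hP.bit.ite hQ.bit (fun h => ?_) fun h => ?_
    · refine ((hP.bit.add (ev_word h3) (by omega)).sub hQ.bit (by omega)).congr ?_
      rcases Nat.lt_or_ge (r % w + q % w) w with h' | h'
      · rw [Nat.mod_eq_of_lt h'] at hmodw
        omega
      · rw [Nat.mod_eq_sub_mod h', Nat.mod_eq_of_lt (by omega)] at hmodw
        omega
    · refine (hP.bit.sub hQ.bit (by omega)).congr ?_
      rcases Nat.lt_or_ge (r % w + q % w) w with h' | h'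
      · rw [Nat.mod_eq_of_lt h'] at hmodw
        omega
      · rw [Nat.mod_eq_sub_mod h', Nat.mod_eq_of_lt (by omega)] at hmodw
        omega

theorem Pos.sub (h3 : env 3 = BitVec.ofNat w w) (hw : 1 ≤ w) {P Q : PosExpr} {p q : ℕ}
    (hP : Pos D env P p) (hQ : Pos D env Q q) (h : q ≤ p) : Pos D env (P - Q) (p - q) := by
  have := Pos.sub_add h3 hw hP hQ (r := p - q + w * 2 ^ w) (by omega)
  constructor
  · refine this.word.congr ?_
    rw [Nat.add_mul_div_left _ _ (by omega), Nat.add_mod_right]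
  · refine this.bit.congr ?_
    rw [Nat.add_mul_mod_self_left]

end Pos

end WordRAM

/-! ### Reading the data -/

/-- The `len` bits of `A` from position `p` on are the binary representation of `v`. -/
def HasField (A : ℕ → Bool) (p len v : ℕ) : Prop :=
  v < 2 ^ len ∧ ∀ i < len, A (p + i) = v.testBit i

theorem HasField.lt {A : ℕ → Bool} {p len v : ℕ} (h : HasField A p len v) : v < 2 ^ len := h.1

theorem HasField.congr {A B : ℕ → Bool} {p q len v : ℕ} (h : HasField A p len v)
    (hAB : ∀ i < len, B (q + i) = A (p + i)) : HasField B q len v :=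
  ⟨h.1, fun i hi => (hAB i hi).trans (h.2 i hi)⟩

namespace WordRAM

theorem getLsbD_dataWord {w : ℕ} (D : List Bool) (a : BitVec w) {i : ℕ} (hi : i < w) :
    (dataWord D a).getLsbD i = D.getD (a.toNat * w + i) false := by
  rw [dataWord, BitVec.getLsbD_ofFnLE, dif_pos hi]

/-- The word that starts at a given position. -/
def readWord (P : PosExpr) : Expr :=
  Expr.probe P.word >>> P.bit ||| Expr.probe (P.word + .lit 1) <<< (Expr.var 3 - P.bit)

/-- The `len` bits that start at a given position. -/
def read (P : PosExpr) (len : Expr) : Expr :=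
  readWord P &&& (Expr.lit 1 <<< len - Expr.lit 1)

/-- The entry with index `j` of an array that starts at the position `P` and has entries of `len`
bits. -/
def readArray (P : PosExpr) (len j : Expr) : Expr := read (P + .mul j len) len

section

variable {w : ℕ} {D : List Bool} {env : Fin 8 → BitVec w}

/-- An unaligned read joins the upper part of one word with the lower part of the next. For an
aligned position the second shift is by `w` and gives zero. Word indices wrap around, hence
positions are taken modulo `w * 2 ^ w`. -/
theorem getLsbD_readWord (h3 : env 3 = BitVec.ofNat w w) (hw : 1 ≤ w) {P : PosExpr} {p : ℕ}
    (hP : Pos D env P p) {i : ℕ} (hi : i < w) :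
    ((readWord P).eval D env).getLsbD i = D.getD ((p + i) % (w * 2 ^ w)) false := by
  change ((dataWord D (P.word.eval D env) >>> (P.bit.eval D env).toNat) |||
    (dataWord D ((P.word + .lit 1).eval D env)) <<<
      ((Expr.var 3 - P.bit).eval D env).toNat).getLsbD i = _
  have hpw := Nat.mod_lt p (show 0 < w by omega)
  rw [hP.bit, (ev_word h3).sub hP.bit hpw.le, BitVec.getLsbD_or, BitVec.getLsbD_ushiftRight,
    BitVec.getLsbD_shiftLeft, Nat.mod_mul]
  have hdm := Nat.div_add_mod p w
  rcases Nat.lt_or_ge (p % w + i) w with h | h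
  · rw [getLsbD_dataWord _ _ h, hP.word, decide_eq_true (show i < w - p % w by omega)]
    have h1 : (p + i) / w = p / w := by
      rw [Nat.add_div (by omega), Nat.mod_eq_of_lt hi, if_neg (by omega), Nat.div_eq_of_lt hi]
      rfl
    have h2 : (p + i) % w = p % w + i := by
      rw [Nat.add_mod, Nat.mod_eq_of_lt hi, Nat.mod_eq_of_lt h]
    rw [h1, h2]
    simp only [Bool.not_true, Bool.and_false, Bool.false_and, Bool.or_false]
    congr 1
    ring
  · rw [BitVec.getLsbD_of_ge _ _ h, decide_eq_true hi,
      decide_eq_false (show ¬ i < w - p % w by omega), getLsbD_dataWord _ _ (by omega),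
      hP.word.add_mod (.lit_one hw)]
    have h1 : (p + i) / w = p / w + 1 := by
      rw [Nat.add_div (by omega), Nat.mod_eq_of_lt hi, if_pos (by omega), Nat.div_eq_of_lt hi]
    have h2 : (p + i) % w = i - (w - p % w) := by
      rw [Nat.add_mod, Nat.mod_eq_of_lt hi, Nat.mod_eq_sub_mod (by omega),
        Nat.mod_eq_of_lt (by omega)]
      omega
    rw [h1, h2, Nat.mod_add_mod]
    simp only [Bool.not_false, Bool.and_true, Bool.true_and, Bool.false_or]
    congr 1
    ring

/-- If `L ≥ w`, the shift gives 0 and subtracting 1 produces the all-ones word, which is still the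
right mask. -/
theorem eval_mask (hw : 1 ≤ w) {e : Expr} {L : ℕ} (he : Ev D env e L) :
    ((Expr.lit 1 <<< e - Expr.lit 1).eval D env).toNat = 2 ^ min L w - 1 := by
  change ((BitVec.ofNat w 1 <<< (e.eval D env).toNat) - BitVec.ofNat w 1).toNat = _
  have h1 := Nat.one_lt_two_pow (show w ≠ 0 by omega)
  rw [he, BitVec.toNat_sub, BitVec.toNat_shiftLeft, BitVec.toNat_ofNat, Nat.mod_eq_of_lt h1,
    Nat.shiftLeft_eq, one_mul]
  rcases Nat.lt_or_ge L w with h | h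
  · have hlt := Nat.pow_lt_pow_right (show 1 < 2 by norm_num) h
    have := Nat.one_le_two_pow (n := L)
    rw [Nat.mod_eq_of_lt hlt, min_eq_left h.le,
      show 2 ^ w - 1 + 2 ^ L = 2 ^ L - 1 + 2 ^ w by omega, Nat.add_mod_right,
      Nat.mod_eq_of_lt (by omega)]
  · rw [min_eq_right h, Nat.mod_eq_zero_of_dvd (pow_dvd_pow 2 h), add_zero,
      Nat.mod_eq_of_lt (by omega)]

theorem getLsbD_and_mask (hw : 1 ≤ w) {a e : Expr} {L : ℕ} (he : Ev D env e L) {i : ℕ}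
    (hi : i < w) : ((a &&& (Expr.lit 1 <<< e - Expr.lit 1)).eval D env).getLsbD i =
      ((a.eval D env).getLsbD i && decide (i < L)) := by
  change (a.eval D env &&& (Expr.lit 1 <<< e - Expr.lit 1).eval D env).getLsbD i = _
  rw [BitVec.getLsbD_and]
  congr 1
  rw [← BitVec.testBit_toNat, eval_mask hw he, Nat.testBit_two_pow_sub_one]
  simp [hi]

theorem Ev.of_getLsbD {e : Expr} {v : ℕ} (hv : v < 2 ^ w)
    (h : ∀ i < w, (e.eval D env).getLsbD i = v.testBit i) : Ev D env e v := by
  refine Nat.eq_of_testBit_eq fun i => ?_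
  rw [BitVec.testBit_toNat]
  rcases Nat.lt_or_ge i w with hi | hi
  · exact h i hi
  · rw [BitVec.getLsbD_of_ge _ _ hi, Nat.testBit_lt_two_pow
      (lt_of_lt_of_le hv (Nat.pow_le_pow_right (by norm_num) hi))]

theorem Ev.read (h3 : env 3 = BitVec.ofNat w w) (hw : 1 ≤ w) {P : PosExpr} {len : Expr}
    {p L v : ℕ} (hP : Pos D env P p) (hlen : Ev D env len L) (hL : L ≤ w)
    (hf : HasField (D.getD · false) p L v) (hp : p + L ≤ w * 2 ^ w) :
    Ev D env (read P len) v := by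
  refine .of_getLsbD (lt_of_lt_of_le hf.1 (Nat.pow_le_pow_right (by norm_num) hL)) fun i hi => ?_
  rw [WordRAM.read, getLsbD_and_mask hw hlen hi, getLsbD_readWord h3 hw hP hi]
  rcases Nat.lt_or_ge i L with h | h
  · rw [Nat.mod_eq_of_lt (by omega), decide_eq_true h, Bool.and_true]
    exact hf.2 i h
  · rw [decide_eq_false (by omega), Bool.and_false, Nat.testBit_lt_two_pow
      (lt_of_lt_of_le hf.1 (Nat.pow_le_pow_right (by norm_num) h))]

theorem Ev.readArray (h3 : env 3 = BitVec.ofNat w w) (hw : 1 ≤ w) {P : PosExpr} {len j : Expr}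
    {p L J v : ℕ} (hP : Pos D env P p) (hlen : Ev D env len L) (hj : Ev D env j J) (hL : L ≤ w)
    (hf : HasField (D.getD · false) (p + J * L) L v) (hp : p + J * L + L ≤ w * 2 ^ w) :
    Ev D env (readArray P len j) v :=
  .read h3 hw (.add h3 hw hP (.mul h3 hw hj hlen hL)) hlen hL hf hp

end

end WordRAM

/-! ### Existence of bit strings with prescribed fields -/

/-- Pairwise disjoint pieces of a bit string can be prescribed. -/
theorem exists_pieces {ι : Type*} (pos len : ι → ℕ) (val : ι → ℕ → Bool)
    (hdisj : ∀ a b, a ≠ b → 0 < len a → 0 < len b →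
      pos a + len a ≤ pos b ∨ pos b + len b ≤ pos a) :
    ∃ A : ℕ → Bool, ∀ a, ∀ i < len a, A (pos a + i) = val a i := by
  classical
  refine ⟨fun p => if h : ∃ a, pos a ≤ p ∧ p < pos a + len a then
    val h.choose (p - pos h.choose) else false, fun a i hi => ?_⟩
  have h : ∃ b, pos b ≤ pos a + i ∧ pos a + i < pos b + len b := ⟨a, by omega, by omega⟩
  have hc := h.choose_spec
  have : h.choose = a := by
    by_contra hne
    have := hdisj _ _ hne (by omega) (by omega)
    omega
  dsimp only
  rw [dif_pos h, this, Nat.add_sub_cancel_left]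

/-- Consecutive blocks, each an array of `cnt s` numbers of `wd s` bits. -/
theorem exists_blocks (o cnt wd : ℕ → ℕ) (val : ℕ → ℕ → ℕ)
    (ho : ∀ s, o s + cnt s * wd s ≤ o (s + 1))
    (hval : ∀ s, ∀ i < cnt s, val s i < 2 ^ wd s) :
    ∃ A : ℕ → Bool, ∀ s, ∀ i < cnt s, HasField A (o s + i * wd s) (wd s) (val s i) := by
  have hmono : Monotone o := monotone_nat_of_le_succ fun s =>
    (Nat.le_add_right _ _).trans (ho s)
  obtain ⟨A, hA⟩ := exists_pieces (ι := {a : ℕ × ℕ // a.2 < cnt a.1})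
    (fun a => o a.1.1 + a.1.2 * wd a.1.1) (fun a => wd a.1.1)
    (fun a i => (val a.1.1 a.1.2).testBit i) (by
      have key (s i t j : ℕ) (hi : i < cnt s) (h : s < t) :
          o s + i * wd s + wd s ≤ o t + j * wd t := by
        have h1 : (i + 1) * wd s ≤ cnt s * wd s := Nat.mul_le_mul_right _ hi
        have h2 := ho s
        have h3 := hmono (show s + 1 ≤ t from h)
        rw [add_mul] at h1
        omega
      rintro ⟨⟨s, i⟩, hi⟩ ⟨⟨t, j⟩, hj⟩ hne - -
      dsimp only at hi hj ⊢
      rcases lt_trichotomy s t with h | rfl | h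
      · exact Or.inl (key _ _ _ _ hi h)
      · rcases lt_trichotomy i j with h | rfl | h
        · left
          have : (i + 1) * wd s ≤ j * wd s := Nat.mul_le_mul_right _ h
          rw [add_mul] at this
          omega
        · exact absurd rfl hne
        · right
          have : (j + 1) * wd s ≤ i * wd s := Nat.mul_le_mul_right _ h
          rw [add_mul] at this
          omega
      · exact Or.inr (key _ _ _ _ hj h))
  exact ⟨A, fun s i hi => ⟨hval s i hi, fun b hb => hA ⟨(s, i), hi⟩ b hb⟩⟩

/-- An array of numbers of `wd` bits. -/
theorem exists_array (wd : ℕ) (val : ℕ → ℕ) (hval : ∀ s, val s < 2 ^ wd) :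
    ∃ A : ℕ → Bool, ∀ s, HasField A (s * wd) wd (val s) := by
  obtain ⟨A, hA⟩ := exists_blocks (fun s => s * wd) (fun _ => 1) (fun _ => wd) (fun s _ => val s)
    (fun s => by rw [one_mul, add_mul, one_mul]) (fun s _ _ => hval s)
  exact ⟨A, fun s => by simpa using hA s 0 one_pos⟩

/-! ### Monotone sequences in linear space -/

/-- The parameters of the structure for monotone sequences: there are `n + 1` numbers of `L` bits,
in groups of `L * Q`, which are divided into subgroups of `Q`. -/
structure SeqParams (n L Q : ℕ) : Prop where
  lt_two_pow : n < 2 ^ L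
  two_pow_le : 2 ^ L ≤ 2 * n
  lt_two_pow' : L < 2 ^ Q
  two_le : 2 ≤ Q
  table_le : 2 ^ (5 * Q * Q) * Q * (4 * Q) ≤ n
  sq_le : 5 * Q * Q ≤ L
  cube_le : L * Q * L ≤ n

/-- A field that ends at the position `N` or before. -/
def FieldLe (A : ℕ → Bool) (N p len v : ℕ) : Prop := HasField A p len v ∧ p + len ≤ N

/-- The number with the binary digits `1` exactly at the positions `i + d i`, `i < Q`. -/
noncomputable def unaryCode (len Q : ℕ) (d : ℕ → ℕ) : ℕ :=
  Nat.ofBits fun b : Fin len => decide (∃ i < Q, (b : ℕ) = i + d i)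

open Classical in
/-- The `i`-th number of the sequence with the given code. -/
noncomputable def unaryDecode (c i : ℕ) : ℕ := Nat.nth (fun b => c.testBit b = true) i - i

theorem testBit_unaryCode {len Q : ℕ} {d : ℕ → ℕ} (hd : ∀ i < Q, i + d i < len) (b : ℕ) :
    (unaryCode len Q d).testBit b = decide (∃ i < Q, b = i + d i) := by
  unfold unaryCode
  rcases Nat.lt_or_ge b len with h | h
  · rw [Nat.testBit_ofBits_lt _ _ h]
  · rw [Nat.testBit_ofBits_ge _ _ h, eq_comm, decide_eq_false_iff_not]
    rintro ⟨i, hi, rfl⟩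
    exact absurd (hd i hi) (by omega)

/-- As `d` is monotone, the positions i + d i increase strictly, so the one with index `i` stands at
i + d i, and subtracting `i` leaves d i. -/
theorem unaryDecode_unaryCode {len Q : ℕ} {d : ℕ → ℕ} (hd : ∀ i < Q, i + d i < len)
    (hmono : Monotone d) {i : ℕ} (hi : i < Q) : unaryDecode (unaryCode len Q d) i = d i := by
  classical
  have hiff (b : ℕ) : (unaryCode len Q d).testBit b = true ↔ ∃ i < Q, b = i + d i := by
    rw [testBit_unaryCode hd, decide_eq_true_iff]
  have hinj : Function.Injective fun i => i + d i :=
    StrictMono.injective fun a b h => by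
      have := hmono h.le
      change a + d a < b + d b
      omega
  have hcount : Nat.count (fun b => (unaryCode len Q d).testBit b = true) (i + d i) = i := by
    rw [Nat.count_eq_card_filter_range]
    have : (Finset.range (i + d i)).filter
        (fun b => (unaryCode len Q d).testBit b = true) =
        (Finset.range i).image fun i => i + d i := by
      ext b
      simp only [Finset.mem_filter, Finset.mem_range, Finset.mem_image, hiff]
      constructor
      · rintro ⟨hb, k, -, rfl⟩
        refine ⟨k, ?_, rfl⟩
        by_contra hk
        have := hmono (show i ≤ k by omega)
        omega
      · rintro ⟨k, hk, rfl⟩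
        have := hmono hk.le
        exact ⟨by omega, k, by omega, rfl⟩
    rw [this, Finset.card_image_of_injective _ hinj, Finset.card_range]
  have hnth := Nat.nth_count (p := fun b => (unaryCode len Q d).testBit b = true)
    ((hiff (i + d i)).2 ⟨i, hi, rfl⟩)
  rw [hcount] at hnth
  rw [unaryDecode]
  have : Nat.nth (fun b => (unaryCode len Q d).testBit b = true) i = i + d i := by
    convert hnth
  rw [this, Nat.add_sub_cancel_left]

/-- The bit string `B` contains a table for decoding the codes of subgroups. -/
def HasTable (B : ℕ → Bool) (base n Q : ℕ) : Prop :=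
  ∀ c < 2 ^ (5 * Q * Q), ∀ i < Q, unaryDecode c i < 2 ^ (4 * Q) →
    FieldLe B (base + n) (base + (c * Q + i) * (4 * Q)) (4 * Q) (unaryDecode c i)

/-- The bit string `B` contains, from the position `base` on, the structure for the monotone
sequence `f`. -/
structure HasSeq (B : ℕ → Bool) (base n L Q : ℕ) (f : ℕ → ℕ) : Prop where
  group : ∀ g ≤ n / (L * Q) + 1, FieldLe B (base + 22 * n) (base + g * L) L (f (g * (L * Q)))
  first : ∀ s ≤ n / Q, f ((s / L + 1) * (L * Q)) - f (s / L * (L * Q)) < L * Q * L →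
    FieldLe B (base + 22 * n) (base + 2 * n + s * (4 * Q)) (4 * Q)
      (f (s * Q) - f (s / L * (L * Q)))
  last : ∀ s ≤ n / Q, f ((s / L + 1) * (L * Q)) - f (s / L * (L * Q)) < L * Q * L →
    FieldLe B (base + 22 * n) (base + 8 * n + s * (4 * Q)) (4 * Q)
      (f ((s + 1) * Q) - f (s / L * (L * Q)))
  big : ∀ g ≤ n / (L * Q), L * Q * L ≤ f ((g + 1) * (L * Q)) - f (g * (L * Q)) → ∀ i < L * Q,
    FieldLe B (base + 22 * n) (base + 14 * n + g * (L * Q) + f (g * (L * Q)) + i * L) L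
      (f (g * (L * Q) + i))
  mid : ∀ s ≤ n / Q, f ((s / L + 1) * (L * Q)) - f (s / L * (L * Q)) < L * Q * L →
    4 * Q * Q ≤ f ((s + 1) * Q) - f (s * Q) → ∀ i < Q,
    FieldLe B (base + 22 * n) (base + 18 * n + s * Q + f (s * Q) + i * (4 * Q)) (4 * Q)
      (f (s * Q + i) - f (s * Q))
  small : ∀ s ≤ n / Q, f ((s + 1) * Q) - f (s * Q) < 4 * Q * Q →
    FieldLe B (base + 22 * n) (base + 18 * n + s * Q + f (s * Q))
      (Q + (f ((s + 1) * Q) - f (s * Q)))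
      (unaryCode (Q + (f ((s + 1) * Q) - f (s * Q))) Q fun i => f (s * Q + i) - f (s * Q))

theorem SeqParams.pos {n L Q : ℕ} (h : SeqParams n L Q) : 0 < L :=
  lt_of_lt_of_le (by have := h.two_le; positivity) h.sq_le

theorem SeqParams.group_le {n L Q : ℕ} (h : SeqParams n L Q) : L * Q ≤ n :=
  (Nat.le_mul_of_pos_right _ h.pos).trans h.cube_le

theorem SeqParams.four_mul_le {n L Q : ℕ} (h : SeqParams n L Q) : 4 * Q ≤ L := by
  have h1 := h.sq_le
  have h2 := h.two_le
  nlinarith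

/-- Values relative to the start of a group that rises by less than L · Q · L therefore fit into 4Q
bits. -/
theorem SeqParams.cube_lt {n L Q : ℕ} (h : SeqParams n L Q) : L * Q * L < 2 ^ (4 * Q) := by
  have hL := h.lt_two_pow'
  have hQ : Q < 2 ^ Q := Nat.lt_two_pow_self
  calc L * Q * L < 2 ^ Q * 2 ^ Q * 2 ^ Q := by
        have := h.pos
        gcongr
    _ = 2 ^ (3 * Q) := by ring
    _ ≤ 2 ^ (4 * Q) := Nat.pow_le_pow_right (by norm_num) (by omega)

/-- One table serves all subgroups of all sequences: it has an entry of 4Q bits for each code of at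
most 5Q² bits and each of the Q indices. Codes that decode to larger numbers are stored reduced and
never read. -/
theorem exists_hasTable {n L Q : ℕ} (h : SeqParams n L Q) :
    ∃ A : ℕ → Bool, ∀ (B : ℕ → Bool) (base : ℕ), (∀ i < n, B (base + i) = A i) →
      HasTable B base n Q := by
  have hQ := h.two_le
  obtain ⟨A, hA⟩ := exists_array (4 * Q)
    (fun s => unaryDecode (s / Q) (s % Q) % 2 ^ (4 * Q)) fun s => Nat.mod_lt _ (by positivity)
  refine ⟨A, fun B base hB c hc i hi hv => ?_⟩
  have h1 := hA (c * Q + i)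
  rw [show (c * Q + i) / Q = c by
      rw [mul_comm, Nat.mul_add_div (by omega), Nat.div_eq_of_lt hi, add_zero],
    show (c * Q + i) % Q = i by rw [mul_comm, Nat.mul_add_mod, Nat.mod_eq_of_lt hi],
    Nat.mod_eq_of_lt hv] at h1
  have h2 : (c * Q + i) * (4 * Q) + 4 * Q ≤ n := by
    refine le_trans ?_ h.table_le
    have h3 : c * Q + i + 1 ≤ 2 ^ (5 * Q * Q) * Q := by
      have : (c + 1) * Q ≤ 2 ^ (5 * Q * Q) * Q := Nat.mul_le_mul_right _ hc
      rw [add_mul] at this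
      omega
    have := Nat.mul_le_mul_right (4 * Q) h3
    rw [add_mul, one_mul] at this
    exact this
  refine ⟨h1.congr fun b hb => ?_, by omega⟩
  rw [add_assoc, hB _ (by omega)]

/-- If the function is monotone, the parts of a bit string that belong to blocks of `G` elements
are disjoint. -/
theorem block_end_le {f : ℕ → ℕ} (hf : Monotone f) (G s : ℕ) {k : ℕ}
    (hk : k ≤ G + (f ((s + 1) * G) - f (s * G))) :
    s * G + f (s * G) + k ≤ (s + 1) * G + f ((s + 1) * G) := by
  have := hf (Nat.mul_le_mul_right G (show s ≤ s + 1 by omega))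
  rw [add_mul] at this hk ⊢
  omega

/-- Rises pay for space, since all rises together are below 2^L ≤ 2n. A group of L · Q values that
rises by at least L · Q · L stores its values explicitly. Any other group stores the values at its
subgroup boundaries relative to its start. A subgroup that rises by at least 4Q² stores explicit
offsets of 4Q bits, any other one a unary code of Q plus its rise bits, less than 5Q² in total. No
pointers are needed: the block of a group or subgroup starting at index `a` begins at offset a +
f(a) of its section, and the next block begins late enough because its length is at most the number
of indices plus the rise. -/
theorem exists_hasSeq {n L Q : ℕ} (h : SeqParams n L Q) {f : ℕ → ℕ} (hf : Monotone f)
    (hlt : ∀ j, f j < 2 ^ L) :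
    ∃ A : ℕ → Bool, ∀ (B : ℕ → Bool) (base : ℕ), (∀ i < 22 * n, B (base + i) = A i) →
      HasSeq B base n L Q f := by
  classical
  have hQ := h.two_le
  have hL := h.pos
  have hG : 0 < L * Q := by positivity
  have hGn := h.group_le
  have h4Q := h.four_mul_le
  have hLn : L ≤ n := (Nat.le_mul_of_pos_right _ (by omega)).trans hGn
  have hcube := h.cube_lt
  have hrise (s : ℕ) : f (s * Q) ≤ f ((s + 1) * Q) := hf (Nat.mul_le_mul_right Q (Nat.le_succ s))
  have hpos (s : ℕ) : s / L * (L * Q) ≤ s * Q := by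
    rw [← mul_assoc]
    exact Nat.mul_le_mul_right _ (Nat.div_mul_le_self s L)
  have hnext (s : ℕ) : (s + 1) * Q ≤ (s / L + 1) * (L * Q) := by
    rw [← mul_assoc]
    refine Nat.mul_le_mul_right _ ?_
    have := Nat.lt_div_mul_add (a := s) hL
    rw [add_mul]
    omega
  obtain ⟨A₁, h₁⟩ := exists_array L (fun g => f (g * (L * Q))) fun g => hlt _
  -- The reduction modulo 2^(4Q) only affects groups with large rise, whose entries are not used.
  obtain ⟨A₂, h₂⟩ := exists_array (4 * Q)
    (fun s => (f (s * Q) - f (s / L * (L * Q))) % 2 ^ (4 * Q)) fun s =>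
      Nat.mod_lt _ (by positivity)
  -- The end of a subgroup needs its own array: if it is also the end of the group, the next entry
  -- of the first array is relative to a different group.
  obtain ⟨A₃, h₃⟩ := exists_array (4 * Q)
    (fun s => (f ((s + 1) * Q) - f (s / L * (L * Q))) % 2 ^ (4 * Q)) fun s =>
      Nat.mod_lt _ (by positivity)
  -- Groups with small rise receive an empty block here.
  obtain ⟨A₄, h₄⟩ := exists_blocks (fun g => g * (L * Q) + f (g * (L * Q)))
    (fun g => if L * Q * L ≤ f ((g + 1) * (L * Q)) - f (g * (L * Q)) then L * Q else 0)
    (fun _ => L) (fun g i => f (g * (L * Q) + i))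
    (fun g => block_end_le hf _ _ (by split_ifs with hc <;> omega)) (fun g i _ => hlt _)
  -- Each block is either an array of Q offsets of 4Q bits or a single number, the unary code.
  obtain ⟨A₅, h₅⟩ := exists_blocks (fun s => s * Q + f (s * Q))
    (fun s => if 4 * Q * Q ≤ f ((s + 1) * Q) - f (s * Q) then Q else 1)
    (fun s => if 4 * Q * Q ≤ f ((s + 1) * Q) - f (s * Q) then 4 * Q else
      Q + (f ((s + 1) * Q) - f (s * Q)))
    (fun s i => if 4 * Q * Q ≤ f ((s + 1) * Q) - f (s * Q) then
        (f (s * Q + i) - f (s * Q)) % 2 ^ (4 * Q)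
      else unaryCode (Q + (f ((s + 1) * Q) - f (s * Q))) Q fun i => f (s * Q + i) - f (s * Q))
    (fun s => block_end_le hf _ _ (by
      split_ifs with hc
      · rw [mul_comm Q (4 * Q)]
        omega
      · omega))
    (fun s i _ => by
      split_ifs with hc
      · exact Nat.mod_lt _ (by positivity)
      · exact Nat.ofBits_lt_two_pow _)
  -- Section lengths: group starts need at most 2n bits, each array of relative boundaries at most
  -- 4n + 4Q ≤ 6n, and each section of blocks ends by n + 2n plus slack, within 4n.
  obtain ⟨A, hA⟩ := exists_pieces (ι := Fin 5) ![0, 2 * n, 8 * n, 14 * n, 18 * n]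
    ![2 * n, 6 * n, 6 * n, 4 * n, 4 * n] ![A₁, A₂, A₃, A₄, A₅] (by
      intro a b hab _ _
      fin_cases a <;> fin_cases b <;> simp at hab ⊢ <;> omega)
  have hA₁ : ∀ i < 2 * n, A (0 + i) = A₁ i := hA 0
  have hA₂ : ∀ i < 6 * n, A (2 * n + i) = A₂ i := hA 1
  have hA₃ : ∀ i < 6 * n, A (8 * n + i) = A₃ i := hA 2
  have hA₄ : ∀ i < 4 * n, A (14 * n + i) = A₄ i := hA 3
  have hA₅ : ∀ i < 4 * n, A (18 * n + i) = A₅ i := hA 4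
  have hmul : ∀ s ≤ n / Q, s * Q ≤ n := fun s hs => (Nat.le_div_iff_mul_le (by omega)).1 hs
  have hfn (j : ℕ) : f j < 2 * n := lt_of_lt_of_le (hlt j) h.two_pow_le
  refine ⟨A, fun B base hB => ⟨?_, ?_, ?_, ?_, ?_, ?_⟩⟩
  · intro g hg
    have h1 : g * L + L ≤ 2 * n := by
      have e1 : (g + 1) * L ≤ (n / (L * Q) + 2) * L := Nat.mul_le_mul_right _ (by omega)
      have e2 : n / (L * Q) * L ≤ n / (L * Q) * (L * Q) :=
        Nat.mul_le_mul_left _ (Nat.le_mul_of_pos_right _ (by omega))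
      have e3 := Nat.div_mul_le_self n (L * Q)
      have e4 : 2 * L ≤ L * Q := by
        rw [mul_comm]
        exact Nat.mul_le_mul_left _ hQ
      rw [add_mul, one_mul, add_mul] at e1
      omega
    refine ⟨(h₁ g).congr fun i hi => ?_, by omega⟩
    rw [add_assoc, hB _ (by omega), ← hA₁ _ (by omega), zero_add]
  · intro s hs hsmall
    have h1 := hmul s hs
    have h2 : s * (4 * Q) = 4 * (s * Q) := by ring
    have h3 := h₂ s
    have h4 := hf (hnext s)
    have h5 := hrise s
    rw [Nat.mod_eq_of_lt (by omega)] at h3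
    refine ⟨h3.congr fun i hi => ?_, by omega⟩
    rw [← hA₂ _ (by omega), ← hB _ (by omega)]
    congr 1
    omega
  · intro s hs hsmall
    have h1 := hmul s hs
    have h2 : s * (4 * Q) = 4 * (s * Q) := by ring
    have h3 := h₃ s
    have h4 := hf (hnext s)
    rw [Nat.mod_eq_of_lt (by omega)] at h3
    refine ⟨h3.congr fun i hi => ?_, by omega⟩
    rw [← hA₃ _ (by omega), ← hB _ (by omega)]
    congr 1
    omega
  · intro g hg hbig i hi
    have h1 : g * (L * Q) ≤ n := (Nat.le_div_iff_mul_le hG).1 hg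
    have h2 := h₄ g i (by rwa [if_pos hbig])
    have h3 : (i + 1) * L ≤ L * Q * L := Nat.mul_le_mul_right _ hi
    have h4 := hfn ((g + 1) * (L * Q))
    rw [add_mul] at h3
    refine ⟨h2.congr fun b hb => ?_, by omega⟩
    rw [← hA₄ _ (by omega), ← hB _ (by omega)]
    congr 1
    omega
  · intro s hs hsmall hmid i hi
    have h1 := hmul s hs
    have h2 := h₅ s i (by rwa [if_pos hmid])
    rw [if_pos hmid, if_pos hmid] at h2
    have h3 : (i + 1) * (4 * Q) ≤ Q * (4 * Q) := Nat.mul_le_mul_right _ hi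
    have h3' : Q * (4 * Q) = 4 * Q * Q := by ring
    have h4 := hfn ((s + 1) * Q)
    have h5 : f (s * Q + i) ≤ f ((s + 1) * Q) := hf (by rw [add_mul]; omega)
    have h6 := hf (hnext s)
    have h7 := hf (hpos s)
    rw [add_mul] at h3
    rw [Nat.mod_eq_of_lt (by omega)] at h2
    refine ⟨h2.congr fun b hb => ?_, by omega⟩
    rw [← hA₅ _ (by omega), ← hB _ (by omega)]
    congr 1
    omega
  · intro s hs hsmall
    have h1 := hmul s hs
    have h2 := h₅ s 0 (by rw [if_neg (by omega)]; exact one_pos)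
    rw [if_neg (by omega), if_neg (by omega), zero_mul] at h2
    have h4 := hfn ((s + 1) * Q)
    have h5 := hrise s
    refine ⟨h2.congr fun b hb => ?_, by omega⟩
    rw [← hA₅ _ (by omega), ← hB _ (by omega)]
    congr 1
    omega

/-! ### Access to monotone sequences in constant time -/

namespace WordRAM

/-- The position `n * c`. -/
def secPos (c : ℕ) : PosExpr := .mul (.var 1) (.lit c)

/-- The `i`-th scalar, a number of `min n m.size` bits at the position `n * i`. -/
def scalar (i : ℕ) : Expr := read (secPos i) (.ite (.var 1) (.var 4) (.var 1) (.var 4))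

namespace SeqExpr

/-- The number of bits of `n`. -/
def bitLen : Expr := scalar 0

/-- The number of elements of a subgroup. -/
def sub : Expr := scalar 1

def group (j : Expr) : Expr := j / (bitLen * sub)

def groupVal (c : ℕ) (g : Expr) : Expr := readArray (secPos c) bitLen g

def bigVal (c : ℕ) (j : Expr) : Expr :=
  read (secPos (c + 14) + .mul (group j * (bitLen * sub)) (.lit 1) +
    .mul (groupVal c (group j)) (.lit 1) + .mul (j % (bitLen * sub)) bitLen) bitLen

/-- The number of bits of numbers relative to a group. -/
def relLen : Expr := .lit 4 * sub

def firstVal (c : ℕ) (j : Expr) : Expr :=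
  groupVal c (group j) + readArray (secPos (c + 2)) relLen (j / sub)

def lastVal (c : ℕ) (j : Expr) : Expr :=
  groupVal c (group j) + readArray (secPos (c + 8)) relLen (j / sub)

def subPos (c : ℕ) (j : Expr) : PosExpr :=
  secPos (c + 18) + .mul (j / sub * sub) (.lit 1) + .mul (firstVal c j) (.lit 1)

def midVal (c : ℕ) (j : Expr) : Expr :=
  firstVal c j + read (subPos c j + .mul (j % sub) relLen) relLen

def smallVal (c : ℕ) (j : Expr) : Expr :=
  firstVal c j + readArray (secPos 4) relLen
    (read (subPos c j) (sub + (lastVal c j - firstVal c j)) * sub + j % sub)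

end SeqExpr

open SeqExpr in
/-- The `j`-th element of the monotone sequence that is stored from the position `n * c` on. -/
def seqVal (c : ℕ) (j : Expr) : Expr :=
  .ite (groupVal c (group j + .lit 1) - groupVal c (group j)) (bitLen * sub * bitLen)
    (.ite (lastVal c j - firstVal c j) (relLen * sub) (smallVal c j) (midVal c j))
    (bigVal c j)

/-- The circumstances under which the expressions of this section have the intended values; `k` is
the number of bits of `m`. -/
structure IndexContext {w : ℕ} (D : List Bool) (env : Fin 8 → BitVec w) (n k L Q : ℕ) : Prop where
  word : env 3 = BitVec.ofNat w w
  card : env 1 = BitVec.ofNat w n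
  size : env 4 = BitVec.ofNat w k
  card_lt : n < 2 ^ w
  size_le : k ≤ w
  len_le : L ≤ k
  len_le' : 200 ≤ L
  params : SeqParams n L Q
  space : n * 93 + n * (k - L) ≤ w * 2 ^ w
  bitLen : HasField (D.getD · false) (n * 0) (min n k) L
  sub : HasField (D.getD · false) (n * 1) (min n k) Q
  table : HasTable (D.getD · false) (n * 4) n Q

section

variable {w : ℕ} {D : List Bool} {env : Fin 8 → BitVec w} {n k L Q : ℕ}

namespace IndexContext

theorem one_le_word (h : IndexContext D env n k L Q) : 1 ≤ w := by
  have := h.size_le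
  have := h.len_le
  have := h.len_le'
  omega

theorem ev_card (h : IndexContext D env n k L Q) : Ev D env (.var 1) n :=
  .var_ofNat h.card h.card_lt

theorem ev_size (h : IndexContext D env n k L Q) : Ev D env (.var 4) k :=
  .var_ofNat h.size (lt_of_le_of_lt h.size_le Nat.lt_two_pow_self)

theorem ev_lit (h : IndexContext D env n k L Q) {c : ℕ} (hc : c ≤ 200) : Ev D env (.lit c) c :=
  .lit (lt_of_le_of_lt (by have := h.size_le; have := h.len_le; have := h.len_le'; omega)
    Nat.lt_two_pow_self)

theorem pos_sec (h : IndexContext D env n k L Q) {c : ℕ} (hc : c ≤ 200) :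
    Pos D env (secPos c) (n * c) :=
  .mul h.word h.one_le_word h.ev_card (h.ev_lit hc)
    (by have := h.size_le; have := h.len_le; have := h.len_le'; omega)

theorem ev_scalar (h : IndexContext D env n k L Q) {c v : ℕ} (hc : c ≤ 92)
    (hf : HasField (D.getD · false) (n * c) (min n k) v) : Ev D env (scalar c) v := by
  refine .read h.word h.one_le_word (h.pos_sec (by omega)) (L := min n k) ?_
    ((min_le_right _ _).trans h.size_le) hf ?_
  · refine h.ev_card.ite h.ev_size (fun hlt => ?_) fun hlt => ?_
    · rw [min_eq_left hlt.le]
      exact h.ev_card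
    · rw [min_eq_right (by omega)]
      exact h.ev_size
  · have h1 := h.space
    have h2 : n * (c + 1) ≤ n * 93 := Nat.mul_le_mul_left _ (by omega)
    rw [mul_add] at h2
    have := min_le_left n k
    omega

theorem ev_bitLen (h : IndexContext D env n k L Q) : Ev D env SeqExpr.bitLen L :=
  h.ev_scalar (by norm_num) h.bitLen

theorem ev_sub (h : IndexContext D env n k L Q) : Ev D env SeqExpr.sub Q :=
  h.ev_scalar (by norm_num) h.sub

theorem ev_group (h : IndexContext D env n k L Q) {j : Expr} {J : ℕ} (hj : Ev D env j J) :
    Ev D env (SeqExpr.group j) (J / (L * Q)) :=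
  hj.div (h.ev_bitLen.mul h.ev_sub (lt_of_le_of_lt h.params.group_le h.card_lt))

theorem two_pow_len_le (h : IndexContext D env n k L Q) : 2 ^ L ≤ 2 ^ w :=
  Nat.pow_le_pow_right (by norm_num)
    (by have := h.size_le; have := h.len_le; have := h.len_le'; omega)

theorem len_le_word (h : IndexContext D env n k L Q) : L ≤ w := by
  have := h.size_le; have := h.len_le; omega

theorem ev_relLen (h : IndexContext D env n k L Q) : Ev D env SeqExpr.relLen (4 * Q) := by
  refine (h.ev_lit (by norm_num)).mul h.ev_sub (lt_of_le_of_lt ?_ h.card_lt)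
  exact h.params.four_mul_le.trans ((Nat.le_mul_of_pos_right _
    (by have := h.params.two_le; omega)).trans h.params.group_le)

theorem relLen_le (h : IndexContext D env n k L Q) : 4 * Q ≤ w :=
  h.params.four_mul_le.trans h.len_le_word

-- The three branches of the expression match the cases of the stored structure. What has to be
-- checked is that the fields exist in the branch taken and that no intermediate number overflows a
-- word.
set_option maxHeartbeats 2000000 in
theorem ev_seqVal (h : IndexContext D env n k L Q) {c : ℕ} (hc : c ≤ 71) {f : ℕ → ℕ}
    (hf : Monotone f) (hlt : ∀ i, f i < 2 ^ L) (hs : HasSeq (D.getD · false) (n * c) n L Q f)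
    {j : Expr} {J : ℕ} (hj : Ev D env j J) (hJ : J ≤ n) : Ev D env (seqVal c j) (f J) := by
  have hw := h.one_le_word
  have h3 := h.word
  have hQ := h.params.two_le
  have hL := h.params.pos
  have hG : 0 < L * Q := by positivity
  have hGn := h.params.group_le
  have hbound : n * c + 22 * n ≤ w * 2 ^ w := by
    have h1 := h.space
    have h2 : n * c ≤ n * 71 := Nat.mul_le_mul_left _ hc
    omega
  have hlt' (i : ℕ) : f i < 2 ^ w := lt_of_lt_of_le (hlt i) h.two_pow_len_le
  have hg : J / (L * Q) ≤ n / (L * Q) := Nat.div_le_div_right hJ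
  have hsn : J / Q ≤ n / Q := Nat.div_le_div_right hJ
  have hgs : J / Q / L = J / (L * Q) := by rw [Nat.div_div_eq_div_mul, mul_comm]
  have hcard := h.card_lt
  have hnn : n / (L * Q) + 1 < 2 ^ w := by
    have h1 : 2 ≤ L * Q := by nlinarith
    have h2 : n / (L * Q) ≤ n / 2 := Nat.div_le_div_left h1 (by norm_num)
    omega
  have egroup := h.ev_group hj
  have eG := h.ev_bitLen.mul h.ev_sub (lt_of_le_of_lt h.params.group_le h.card_lt)
  have egv {g : Expr} {γ : ℕ} (hge : Ev D env g γ) (hγ : γ ≤ n / (L * Q) + 1) :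
      Ev D env (SeqExpr.groupVal c g) (f (γ * (L * Q))) :=
    .readArray h3 hw (h.pos_sec (by omega)) h.ev_bitLen hge h.len_le_word
      (hs.group γ hγ).1 ((hs.group γ hγ).2.trans hbound)
  have ev0 := egv egroup (by omega)
  have ev1 := egv (egroup.add (h.ev_lit (c := 1) (by norm_num)) (by omega)) (by omega)
  have hf01 : f (J / (L * Q) * (L * Q)) ≤ f ((J / (L * Q) + 1) * (L * Q)) :=
    hf (Nat.mul_le_mul_right _ (by omega))
  have hgJ : J / (L * Q) * (L * Q) ≤ J := Nat.div_mul_le_self _ _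
  have hsJ : J / Q * Q ≤ J := Nat.div_mul_le_self _ _
  have ecube : Ev D env (SeqExpr.bitLen * SeqExpr.sub * SeqExpr.bitLen) (L * Q * L) :=
    eG.mul h.ev_bitLen (lt_of_le_of_lt h.params.cube_le h.card_lt)
  refine (ev1.sub ev0 hf01).ite ecube (fun hsmall => ?_) fun hbig => ?_
  · have hsm : f ((J / Q / L + 1) * (L * Q)) - f (J / Q / L * (L * Q)) < L * Q * L := by
      rwa [hgs]
    have esub := hj.div h.ev_sub
    have hm1 : f (J / (L * Q) * (L * Q)) ≤ f (J / Q * Q) := by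
      refine hf ?_
      rw [← hgs, ← mul_assoc]
      exact Nat.mul_le_mul_right _ (Nat.div_mul_le_self _ L)
    have hm2 : f (J / Q * Q) ≤ f ((J / Q + 1) * Q) := hf (Nat.mul_le_mul_right _ (by omega))
    have efirst : Ev D env (SeqExpr.firstVal c j) (f (J / Q * Q)) := by
      have h1 := hs.first _ hsn hsm
      rw [hgs] at h1
      have h2 : Ev D env (readArray (secPos (c + 2)) SeqExpr.relLen (j / SeqExpr.sub))
          (f (J / Q * Q) - f (J / (L * Q) * (L * Q))) :=
        .readArray h3 hw (h.pos_sec (by omega)) h.ev_relLen esub h.relLen_le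
          (by rw [mul_add, mul_comm n 2]; exact h1.1)
          (by rw [mul_add, mul_comm n 2]; exact h1.2.trans hbound)
      have h3 := hlt' (J / Q * Q)
      exact (ev0.add h2 (by omega)).congr (by omega)
    have elast : Ev D env (SeqExpr.lastVal c j) (f ((J / Q + 1) * Q)) := by
      have h1 := hs.last _ hsn hsm
      rw [hgs] at h1
      have h2 : Ev D env (readArray (secPos (c + 8)) SeqExpr.relLen (j / SeqExpr.sub))
          (f ((J / Q + 1) * Q) - f (J / (L * Q) * (L * Q))) :=
        .readArray h3 hw (h.pos_sec (by omega)) h.ev_relLen esub h.relLen_le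
          (by rw [mul_add, mul_comm n 8]; exact h1.1)
          (by rw [mul_add, mul_comm n 8]; exact h1.2.trans hbound)
      have h3 := hlt' ((J / Q + 1) * Q)
      exact (ev0.add h2 (by omega)).congr (by omega)
    have epos : Pos D env (SeqExpr.subPos c j) (n * c + 18 * n + J / Q * Q + f (J / Q * Q)) := by
      have e1 : Ev D env (j / SeqExpr.sub * SeqExpr.sub) (J / Q * Q) :=
        esub.mul h.ev_sub (lt_of_le_of_lt hsJ hj.lt)
      have e2 := Pos.add h3 hw (.add h3 hw (h.pos_sec (c := c + 18) (by omega))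
        (.mul h3 hw e1 (.lit_one hw) hw))
        (.mul h3 hw efirst (.lit_one hw) hw)
      rwa [mul_one, mul_one, mul_add, mul_comm n 18] at e2
    have hsq : 5 * Q * Q ≤ L := h.params.sq_le
    have e4Q : Ev D env (SeqExpr.relLen * SeqExpr.sub) (4 * Q * Q) := by
      refine h.ev_relLen.mul h.ev_sub ?_
      have h5 : 5 * Q * Q = 4 * Q * Q + Q * Q := by ring
      have h6 := h.params.lt_two_pow
      have h7 : L ≤ n := (Nat.le_mul_of_pos_right _ (by omega)).trans hGn
      omega
    have hmodlt : J % Q < Q := Nat.mod_lt _ (by omega)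
    have hdm : J / Q * Q + J % Q = J := Nat.div_add_mod' J Q
    have hfJ : f (J / Q * Q) ≤ f J := hf hsJ
    have hfJ' : f J ≤ f ((J / Q + 1) * Q) := hf (by rw [add_mul]; omega)
    have hJlt := hlt' J
    have hlast := hlt' ((J / Q + 1) * Q)
    refine (elast.sub efirst hm2).ite e4Q (fun hlow => ?_) fun hmid => ?_
    · have h1 := hs.small _ hsn hlow
      have hQQ : 5 * Q * Q = 4 * Q * Q + Q * Q := by ring
      have hQQ' : Q ≤ Q * Q := Nat.le_mul_of_pos_left _ (by omega)
      have hlw := h.len_le_word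
      have hwlt : w < 2 ^ w := Nat.lt_two_pow_self
      have elen : Ev D env (SeqExpr.sub + (SeqExpr.lastVal c j - SeqExpr.firstVal c j))
          (Q + (f ((J / Q + 1) * Q) - f (J / Q * Q))) :=
        h.ev_sub.add (elast.sub efirst hm2) (by omega)
      have ecode := Ev.read h3 hw epos elen (by omega) h1.1 (h1.2.trans hbound)
      set len := Q + (f ((J / Q + 1) * Q) - f (J / Q * Q)) with hlen
      set d : ℕ → ℕ := fun i => f (J / Q * Q + i) - f (J / Q * Q) with hd
      have hdle : ∀ i < Q, i + d i < len := by
        intro i hi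
        have : f (J / Q * Q + i) ≤ f ((J / Q + 1) * Q) := hf (by rw [add_mul]; omega)
        simp only [hd]
        omega
      have hdmono : Monotone d := fun a b hab => Nat.sub_le_sub_right (hf (by omega)) _
      have hdec := unaryDecode_unaryCode hdle hdmono hmodlt
      -- Here the length of the code is less than Q + 4Q² ≤ 5Q², so the code is a row of the table.
      have hcode : unaryCode len Q d < 2 ^ (5 * Q * Q) :=
        lt_of_lt_of_le h1.1.lt (Nat.pow_le_pow_right (by norm_num) (by omega))
      have hdJ : d (J % Q) = f J - f (J / Q * Q) := by simp only [hd, hdm]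
      -- The decoded offset is at most the rise of the whole group, which is small in this branch,
      -- so the table entry was not truncated.
      have htab := h.table _ hcode _ hmodlt (by
        rw [hdec, hdJ]
        have := h.params.cube_lt
        have := hf (show (J / Q + 1) * Q ≤ (J / Q / L + 1) * (L * Q) by
          rw [← mul_assoc]
          refine Nat.mul_le_mul_right _ ?_
          have := Nat.lt_div_mul_add (a := J / Q) hL
          rw [add_mul]
          omega)
        rw [hgs] at this
        omega)
      rw [hdec, hdJ] at htab
      have hidx : unaryCode len Q d * Q + J % Q < 2 ^ w := by
        refine lt_of_lt_of_le ?_ (h.params.table_le.trans h.card_lt.le)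
        have h5 : (unaryCode len Q d + 1) * Q ≤ 2 ^ (5 * Q * Q) * Q := Nat.mul_le_mul_right _ hcode
        have h6 : 2 ^ (5 * Q * Q) * Q ≤ 2 ^ (5 * Q * Q) * Q * (4 * Q) :=
          Nat.le_mul_of_pos_right _ (by omega)
        rw [add_mul] at h5
        omega
      have emul : Ev D env (read (SeqExpr.subPos c j)
          (SeqExpr.sub + (SeqExpr.lastVal c j - SeqExpr.firstVal c j)) * SeqExpr.sub)
          (unaryCode len Q d * Q) := ecode.mul h.ev_sub (by omega)
      have eval := Ev.readArray h3 hw (h.pos_sec (c := 4) (by norm_num)) h.ev_relLen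
        (emul.add (hj.mod h.ev_sub) hidx) h.relLen_le htab.1
        (by have := htab.2; have := h.space; omega)
      exact (efirst.add eval (by omega)).congr (by omega)
    · have h1 := hs.mid _ hsn hsm (by omega) _ hmodlt
      rw [hdm] at h1
      have e1 := Ev.read h3 hw (.add h3 hw epos (.mul h3 hw (hj.mod h.ev_sub) h.ev_relLen
        h.relLen_le)) h.ev_relLen h.relLen_le h1.1 (h1.2.trans hbound)
      exact (efirst.add e1 (by omega)).congr (by omega)
  · have h1 := hs.big _ hg (by omega) (J % (L * Q)) (Nat.mod_lt _ hG)
    rw [Nat.div_add_mod'] at h1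
    have e1 : Ev D env (SeqExpr.group j * (SeqExpr.bitLen * SeqExpr.sub)) (J / (L * Q) * (L * Q)) :=
      egroup.mul eG (lt_of_le_of_lt hgJ hj.lt)
    have e2 := Pos.add h3 hw (.add h3 hw (.add h3 hw (h.pos_sec (c := c + 14) (by omega))
      (.mul h3 hw e1 (.lit_one hw) hw))
      (.mul h3 hw ev0 (.lit_one hw) hw))
      (.mul h3 hw (hj.mod eG) h.ev_bitLen h.len_le_word)
    rw [mul_one, mul_one, mul_add, mul_comm n 14] at e2
    exact .read h3 hw e2 h.ev_bitLen h.len_le_word h1.1 (h1.2.trans hbound)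

end IndexContext

end

end WordRAM

/-! ### Elements of finite sets by index -/

namespace Finset

/-- The element of `S` with index `j`, counted from zero. -/
noncomputable def elt (S : Finset ℕ) (j : ℕ) : ℕ := Nat.nth (· ∈ S) j

/-- The number of elements of `S` below `v`. -/
def countBelow (S : Finset ℕ) (v : ℕ) : ℕ := (S.filter (· < v)).card

variable {S : Finset ℕ}

theorem countBelow_eq_count (S : Finset ℕ) (v : ℕ) : S.countBelow v = Nat.count (· ∈ S) v := by
  rw [Nat.count_eq_card_filter_range, countBelow]
  congr 1
  ext a
  simp [and_comm]

theorem elt_mem {j : ℕ} (hj : j < S.card) : S.elt j ∈ S :=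
  Nat.nth_mem (p := (· ∈ S)) j fun hf => by simpa using hj

theorem countBelow_elt {j : ℕ} (hj : j < S.card) : S.countBelow (S.elt j) = j := by
  rw [countBelow_eq_count]
  exact Nat.count_nth (p := (· ∈ S)) fun hf => by simpa using hj

theorem elt_countBelow {v : ℕ} (hv : v ∈ S) : S.elt (S.countBelow v) = v := by
  rw [countBelow_eq_count]
  exact Nat.nth_count (p := (· ∈ S)) hv

theorem countBelow_mono (S : Finset ℕ) : Monotone S.countBelow := fun a b hab =>
  card_le_card fun x hx => by
    simp only [mem_filter] at hx ⊢
    exact ⟨hx.1, by omega⟩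

theorem countBelow_le (S : Finset ℕ) (v : ℕ) : S.countBelow v ≤ S.card := card_filter_le _ _

theorem countBelow_lt {v u : ℕ} (hv : v ∈ S) (h : v < u) : S.countBelow v < S.countBelow u :=
  card_lt_card ⟨fun x hx => by
    simp only [mem_filter] at hx ⊢
    exact ⟨hx.1, by omega⟩, fun hsub => by
      have := hsub (mem_filter.2 ⟨hv, h⟩)
      simp at this⟩

theorem countBelow_lt_iff {v u : ℕ} (hv : v ∈ S) : S.countBelow v < S.countBelow u ↔ v < u := by
  refine ⟨fun h => ?_, countBelow_lt hv⟩
  by_contra hn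
  have := S.countBelow_mono (show u ≤ v by omega)
  omega

theorem countBelow_lt_card {v : ℕ} (hv : v ∈ S) : S.countBelow v < S.card :=
  lt_of_lt_of_le (countBelow_lt hv (Nat.lt_succ_self v)) (S.countBelow_le _)

theorem countBelow_succ_le (S : Finset ℕ) (v : ℕ) : S.countBelow (v + 1) ≤ S.countBelow v + 1 := by
  rw [countBelow_eq_count, countBelow_eq_count, Nat.count_succ]
  split_ifs <;> omega

theorem elt_lt_elt {i j : ℕ} (hij : i < j) (hj : j < S.card) : S.elt i < S.elt j := by
  rw [← countBelow_lt_iff (elt_mem (hij.trans hj)), countBelow_elt (hij.trans hj),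
    countBelow_elt hj]
  exact hij

theorem elt_add_le_elt {i j : ℕ} (hij : i ≤ j) (hj : j < S.card) :
    S.elt i + (j - i) ≤ S.elt j := by
  induction j, hij using Nat.le_induction with
  | base => simp
  | succ j h ih =>
    have := ih (by omega)
    have := elt_lt_elt (Nat.lt_succ_self j) hj
    rw [Nat.succ_eq_add_one] at this
    omega

theorem lt_countBelow_iff {j v : ℕ} (hj : j < S.card) : j < S.countBelow v ↔ S.elt j < v := by
  conv_lhs => rw [← countBelow_elt hj]
  exact countBelow_lt_iff (elt_mem hj)

theorem countBelow_eq {v j : ℕ} (hj : j ≤ S.card) (h1 : ∀ i < j, S.elt i < v)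
    (h2 : j < S.card → v ≤ S.elt j) : S.countBelow v = j := by
  refine le_antisymm ?_ ?_
  · by_contra hlt
    have hc := S.countBelow_le v
    have := (lt_countBelow_iff (by omega)).1 (show j < S.countBelow v by omega)
    have := h2 (by omega)
    omega
  · by_contra hlt
    have := h1 (S.countBelow v) (by omega)
    rw [← lt_countBelow_iff (by omega)] at this
    omega

theorem elt_succ_le {m j : ℕ} (hS : S ⊆ Icc 1 m) (hj : j < S.card) : j + 1 ≤ S.elt j := by
  have h0 := elt_mem (S := S) (j := 0) (by omega)
  have := (mem_Icc.1 (hS h0)).1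
  have := elt_add_le_elt (Nat.zero_le j) hj
  omega

theorem elt_le {m j : ℕ} (hS : S ⊆ Icc 1 m) (hj : j < S.card) :
    S.elt j + (S.card - 1 - j) ≤ m := by
  have h0 := elt_mem (S := S) (j := S.card - 1) (by omega)
  have := (mem_Icc.1 (hS h0)).2
  have := elt_add_le_elt (S := S) (show j ≤ S.card - 1 by omega) (by omega)
  omega

theorem elt_le' {m j : ℕ} (hS : S ⊆ Icc 1 m) (hj : j < S.card) : S.elt j ≤ m :=
  (mem_Icc.1 (hS (elt_mem hj))).2

/-- If `v` is an increasing function with values in `S`, this is the number of `k < N` for which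
`v k` is one of the first `r` elements of `S`. -/
def countFirst (S : Finset ℕ) (v : ℕ → ℕ) (N r : ℕ) : ℕ :=
  ((range N).filter fun k => S.countBelow (v k) < r).card

section CountFirst

variable {v : ℕ → ℕ} {N : ℕ}

theorem countFirst_mono (S : Finset ℕ) (v : ℕ → ℕ) (N : ℕ) : Monotone (S.countFirst v N) :=
  fun a b hab => card_le_card fun x hx => by
    simp only [mem_filter] at hx ⊢
    exact ⟨hx.1, by omega⟩

theorem countFirst_le (S : Finset ℕ) (v : ℕ → ℕ) (N r : ℕ) : S.countFirst v N r ≤ N :=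
  (card_filter_le _ _).trans (card_range N).le

/-- Each additional `k` sends `v k` to one of the `d` further indices, and `k` is determined by that
index. Thus an error in a rank in `S` does not grow in passing to the subsequence. -/
theorem countFirst_add_le (hv : ∀ i < N, ∀ j < N, v i = v j → i = j)
    (hS : ∀ k < N, v k ∈ S) (r d : ℕ) : S.countFirst v N (r + d) ≤ S.countFirst v N r + d := by
  have h : ((range N).filter fun k => S.countBelow (v k) < r + d) ⊆
      ((range N).filter fun k => S.countBelow (v k) < r) ∪
      ((range N).filter fun k => S.countBelow (v k) ∈ Ico r (r + d)) := by
    intro k hk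
    simp only [mem_union, mem_filter, mem_Ico] at hk ⊢
    by_cases h : S.countBelow (v k) < r
    · exact Or.inl ⟨hk.1, h⟩
    · exact Or.inr ⟨hk.1, by omega, hk.2⟩
  refine (card_le_card h).trans ((card_union_le _ _).trans (Nat.add_le_add_left ?_ _))
  calc _ ≤ (Ico r (r + d)).card := by
        refine card_le_card_of_injOn (fun k => S.countBelow (v k)) (fun k hk => ?_) ?_
        · exact (mem_filter.1 hk).2
        · intro a ha b hb hab
          have ha' := mem_range.1 (mem_filter.1 ha).1
          have hb' := mem_range.1 (mem_filter.1 hb).1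
          refine hv _ ha' _ hb' ?_
          dsimp only at hab
          rw [← elt_countBelow (hS a ha'), hab, elt_countBelow (hS b hb')]
    _ = d := by simp

/-- This translates a rank in the combined set into a rank in the subsequence `v`, without knowing
the bound `u` itself. -/
theorem countFirst_countBelow (hS : ∀ k < N, v k ∈ S) (u : ℕ) :
    S.countFirst v N (S.countBelow u) = ((range N).filter fun k => v k < u).card := by
  unfold countFirst
  congr 1
  refine filter_congr fun k hk => countBelow_lt_iff (hS k (mem_range.1 hk))

/-- The count up to and including the index `r` recovers which term of the subsequence stands there;
decoding elements of the auxiliary set rests on this. -/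
theorem countFirst_of_elt_eq (hv : ∀ i j, i < j → j < N → v i < v j) (hS : ∀ k < N, v k ∈ S)
    {r k : ℕ} (hr : r < S.card) (hk : k < N) (h : v k = S.elt r) :
    S.countFirst v N (r + 1) = k + 1 := by
  have : ((range N).filter fun i => S.countBelow (v i) < r + 1) = range (k + 1) := by
    ext i
    simp only [mem_filter, mem_range]
    constructor
    · rintro ⟨hi, hlt⟩
      by_contra hn
      have h1 := (countBelow_lt_iff (S := S) (hS k hk)).2 (hv k i (by omega) hi)
      rw [h, countBelow_elt hr] at h1
      omega
    · intro hi
      refine ⟨by omega, ?_⟩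
      rcases Nat.lt_or_ge i k with hlt | hge
      · have h1 := (countBelow_lt_iff (S := S) (hS i (by omega))).2 (hv i k hlt hk)
        rw [h, countBelow_elt hr] at h1
        omega
      · obtain rfl : i = k := by omega
        rw [h, countBelow_elt hr]
        omega
  rw [countFirst, this, card_range]

end CountFirst

/-- Every second element of a set, with the last bit removed and shifted by `c`. -/
noncomputable def halved (S : Finset ℕ) (c k : ℕ) : ℕ := c + S.elt (2 * k + 1) / 2

/-- Taking only every second element makes consecutive ones differ by at least two, so they stay
distinct when the last bit is dropped. -/
theorem halved_lt (c : ℕ) {i j : ℕ} (hij : i < j) (hj : j < S.card / 2) :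
    S.halved c i < S.halved c j := by
  have := elt_add_le_elt (S := S) (show 2 * i + 1 ≤ 2 * j + 1 by omega) (by omega)
  unfold halved
  omega

theorem halved_inj (c : ℕ) : ∀ i < S.card / 2, ∀ j < S.card / 2,
    S.halved c i = S.halved c j → i = j := by
  intro i hi j hj h
  rcases lt_trichotomy i j with hlt | rfl | hlt
  · have := halved_lt (S := S) c hlt hj
    omega
  · rfl
  · have := halved_lt (S := S) c hlt hi
    omega

/-- The number of elements below some bound can be found from the halved elements, up to a small
error. -/
theorem countBelow_approx (S : Finset ℕ) (c i : ℕ) :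
    2 * ((range (S.card / 2)).filter fun k => S.halved c k < c + i / 2).card ≤
      S.countBelow (i + 1) ∧
    S.countBelow (i + 1) ≤
      2 * ((range (S.card / 2)).filter fun k => S.halved c k < c + i / 2).card + 3 := by
  set d := ((range (S.card / 2)).filter fun k => S.halved c k < c + i / 2).card with hd
  have hdle : d ≤ S.card / 2 := (card_filter_le _ _).trans (card_range _).le
  have hiff : ∀ k < S.card / 2, (S.halved c k < c + i / 2 ↔ k < d) := by
    have hdown : ∀ k < S.card / 2, S.halved c k < c + i / 2 → ∀ l ≤ k,
        S.halved c l < c + i / 2 := by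
      intro k hk h l hl
      rcases Nat.lt_or_ge l k with hlt | hge
      · exact (halved_lt c hlt hk).trans h
      · rwa [show l = k by omega]
    intro k hk
    constructor
    · intro h
      have : range (k + 1) ⊆ (range (S.card / 2)).filter fun k => S.halved c k < c + i / 2 := by
        intro l hl
        rw [mem_range] at hl
        exact mem_filter.2 ⟨mem_range.2 (by omega), hdown k hk h l (by omega)⟩
      have := card_le_card this
      rw [card_range] at this
      omega
    · intro hkd
      by_contra hn
      have : (range (S.card / 2)).filter (fun k => S.halved c k < c + i / 2) ⊆ range k := by
        intro l hl
        rw [mem_filter, mem_range] at hl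
        rw [mem_range]
        by_contra hlk
        exact hn (hdown l hl.1 hl.2 k (by omega))
      have := card_le_card this
      rw [card_range] at this
      omega
  constructor
  · by_contra hlt
    have hd0 : 0 < d := by omega
    have h1 := (hiff (d - 1) (by omega)).2 (by omega)
    unfold halved at h1
    rw [show 2 * (d - 1) + 1 = 2 * d - 1 by omega] at h1
    have := (lt_countBelow_iff (S := S) (j := 2 * d - 1) (v := i + 1) (by omega)).2 (by omega)
    omega
  · by_contra hlt
    have hc := S.countBelow_le (i + 1)
    -- Going back two indices from an element that is at most `i` gives one that is at most i − 2,
    -- whose half is strictly below i / 2; then one more halved element would have been counted.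
    have h1 := (lt_countBelow_iff (S := S) (j := 2 * d + 3) (v := i + 1) (by omega)).1 (by omega)
    have h2 := elt_add_le_elt (S := S) (show 2 * d + 1 ≤ 2 * d + 3 by omega) (by omega)
    have h3 := (hiff d (by omega)).1 (by unfold halved; omega)
    omega

/-- Any subset of `{1, …, m}` becomes a set of a given larger size if a suitable initial segment is
added. -/
theorem exists_union_Icc_card {V : Finset ℕ} {n m : ℕ} (hV : V ⊆ Icc 1 m) (hVn : V.card ≤ n)
    (hnm : n ≤ m) : ∃ p ≤ n, (Icc 1 p ∪ V).card = n ∧ Icc 1 p ∪ V ⊆ Icc 1 m := by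
  classical
  have hex : ∃ p, n ≤ (Icc 1 p ∪ V).card :=
    ⟨n, by
      have := card_le_card (subset_union_left (s₁ := Icc 1 n) (s₂ := V))
      simpa using this⟩
  have hp := Nat.find_spec hex
  set p := Nat.find hex with hpdef
  have hpn : p ≤ n := Nat.find_min' hex (by
    have := card_le_card (subset_union_left (s₁ := Icc 1 n) (s₂ := V))
    simpa using this)
  refine ⟨p, hpn, le_antisymm ?_ hp, union_subset (Icc_subset_Icc le_rfl (hpn.trans hnm)) hV⟩
  rcases Nat.eq_zero_or_pos p with h0 | h0
  · rw [h0]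
    simpa using hVn
  · have hlt := Nat.find_min hex (show p - 1 < p by omega)
    -- Lengthening the segment by one adds at most one element, so the least sufficient `p` gives
    -- the size exactly.
    have hsub : Icc 1 p ∪ V ⊆ insert p (Icc 1 (p - 1) ∪ V) := by
      intro x hx
      simp only [mem_union, mem_Icc, mem_insert] at hx ⊢
      rcases hx with hx | hx
      · omega
      · exact Or.inr (Or.inr hx)
    have h1 := (card_le_card hsub).trans (card_insert_le _ _)
    omega

end Finset

/-! ### Rank and select in terms of indices and counts. -/

open Finset in
theorem rank_true_eq {m : ℕ} {X : Finset ℕ} (hX : X ⊆ Icc 1 m) (i : ℕ) :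
    rank X true i = X.countBelow (i + 1) := by
  unfold rank countBelow
  congr 1
  ext j
  simp only [mem_filter, mem_Icc, decide_eq_true_eq]
  constructor
  · rintro ⟨h, hj⟩
    exact ⟨hj, by omega⟩
  · rintro ⟨hj, h⟩
    exact ⟨⟨(mem_Icc.1 (hX hj)).1, by omega⟩, hj⟩

open Finset in
theorem rank_false_add {X : Finset ℕ} (i : ℕ) : rank X false i + rank X true i = i := by
  unfold rank
  have h := card_filter_add_card_filter_not (s := Icc 1 i) (p := fun j => decide (j ∈ X) = false)
  rw [Nat.card_Icc, Nat.add_sub_cancel] at h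
  simpa using h

/-! ### Zeros before elements, and the auxiliary set. -/

namespace Finset

theorem rank_true_top {m : ℕ} {X : Finset ℕ} (hX : X ⊆ Icc 1 m) : rank X true m = X.card := by
  rw [rank_true_eq hX, countBelow, filter_true_of_mem]
  intro x hx
  have := (mem_Icc.1 (hX hx)).2
  omega

theorem isSelect_true {m i : ℕ} {X : Finset ℕ} (hX : X ⊆ Icc 1 m) (hi : 1 ≤ i)
    (hi' : i ≤ X.card) : IsSelect m X true i (X.elt (i - 1)) := by
  have hmem := elt_mem (S := X) (j := i - 1) (by omega)
  refine ⟨hX hmem, by simpa using hmem, ?_⟩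
  rw [rank_true_eq hX]
  refine countBelow_eq hi' (fun j hj => ?_) fun hj => ?_
  · have := elt_add_le_elt (S := X) (show j ≤ i - 1 by omega) (by omega)
    omega
  · have := elt_lt_elt (S := X) (show i - 1 < i by omega) hj
    omega

/-- The number of zeros in the characteristic bit string before the element with index `j`. -/
noncomputable def zerosBefore (X : Finset ℕ) (j : ℕ) : ℕ := X.elt j - (j + 1)

/-- The set of the numbers of zeros before the elements. -/
noncomputable def zeroCounts (X : Finset ℕ) : Finset ℕ := (range X.card).image X.zerosBefore

/-- The number of elements for which the number of zeros before them is one of the first `l` of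
these numbers. -/
noncomputable def runEnd (X : Finset ℕ) (l : ℕ) : ℕ :=
  X.zeroCounts.countFirst X.zerosBefore X.card l

variable {X : Finset ℕ} {m : ℕ}

theorem zerosBefore_mem {j : ℕ} (hj : j < X.card) : X.zerosBefore j ∈ X.zeroCounts :=
  mem_image_of_mem _ (mem_range.2 hj)

theorem card_zeroCounts_le (X : Finset ℕ) : X.zeroCounts.card ≤ X.card :=
  card_image_le.trans (card_range _).le

theorem zerosBefore_mono {i j : ℕ} (hij : i ≤ j) (hj : j < X.card) :
    X.zerosBefore i ≤ X.zerosBefore j := by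
  have := elt_add_le_elt hij hj
  unfold zerosBefore
  omega

theorem zerosBefore_le (hX : X ⊆ Icc 1 m) {j : ℕ} (hj : j < X.card) :
    X.zerosBefore j ≤ m - X.card := by
  have := elt_le hX hj
  unfold zerosBefore
  omega

theorem runEnd_mono (X : Finset ℕ) : Monotone X.runEnd := countFirst_mono _ _ _

theorem runEnd_le (X : Finset ℕ) (l : ℕ) : X.runEnd l ≤ X.card := countFirst_le _ _ _ _

theorem runEnd_countBelow (X : Finset ℕ) (i : ℕ) : X.runEnd (X.zeroCounts.countBelow i) =
    ((range X.card).filter fun j => X.zerosBefore j < i).card :=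
  countFirst_countBelow (fun _ hj => zerosBefore_mem hj) i

/-- The index of the first element with at least `i` zeros before it. -/
theorem lt_card_filter_zerosBefore_iff {i j : ℕ} (hj : j < X.card) :
    j < ((range X.card).filter fun j => X.zerosBefore j < i).card ↔ X.zerosBefore j < i := by
  constructor
  · intro h
    by_contra hn
    have : (range X.card).filter (fun j => X.zerosBefore j < i) ⊆ range j := by
      intro l hl
      rw [mem_filter, mem_range] at hl
      rw [mem_range]
      by_contra hlj
      have := zerosBefore_mono (show j ≤ l by omega) hl.1
      omega
    have := card_le_card this
    rw [card_range] at this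
    omega
  · intro h
    have : range (j + 1) ⊆ (range X.card).filter fun j => X.zerosBefore j < i := by
      intro l hl
      rw [mem_range] at hl
      have := zerosBefore_mono (show l ≤ j by omega) hj
      exact mem_filter.2 ⟨mem_range.2 (by omega), by omega⟩
    have := card_le_card this
    rw [card_range] at this
    omega

/-- A zero count with index `l` is attained by an element that the first `l` zero counts do not
account for. A query program can thus recognise valid indices by comparison with `n`, and the number
of distinct zero counts need not be stored. -/
theorem runEnd_lt_iff {l : ℕ} : X.runEnd l < X.card ↔ l < X.zeroCounts.card := by
  constructor
  · intro h
    by_contra hn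
    refine h.ne ?_
    unfold runEnd countFirst
    rw [filter_true_of_mem, card_range]
    intro k hk
    have := countBelow_lt_card (zerosBefore_mem (mem_range.1 hk))
    omega
  · intro h
    have hmem := elt_mem h
    obtain ⟨j, hj, hje⟩ := mem_image.1 hmem
    unfold runEnd countFirst
    refine lt_of_lt_of_le (card_lt_card ?_) (card_range X.card).le
    refine filter_ssubset.2 ⟨j, hj, ?_⟩
    rw [hje, countBelow_elt h]
    omega

/-- Elements with equal zero counts are consecutive, and `runEnd l` is the first index of the run
belonging to the zero count with index `l`. Hence the zero counts are computed from elements of `X`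
and are not stored. -/
theorem elt_zeroCounts {l : ℕ} (hl : l < X.zeroCounts.card) :
    X.zeroCounts.elt l = X.zerosBefore (X.runEnd l) := by
  have hlt := runEnd_lt_iff.2 hl
  have hre : X.runEnd l =
      ((range X.card).filter fun j => X.zerosBefore j < X.zeroCounts.elt l).card := by
    rw [← runEnd_countBelow, countBelow_elt hl]
  obtain ⟨j, hj, hje : X.zerosBefore j = X.zeroCounts.elt l⟩ := mem_image.1 (elt_mem hl)
  rw [mem_range] at hj
  have h1 : ¬ X.zerosBefore (X.runEnd l) < X.zeroCounts.elt l := by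
    rw [← lt_card_filter_zerosBefore_iff hlt, ← hre]
    omega
  have h2 : ¬ j < X.runEnd l := by
    rw [hre, lt_card_filter_zerosBefore_iff hj, hje]
    omega
  have := zerosBefore_mono (show X.runEnd l ≤ j by omega) hj
  omega

/-- The elements with fewer than `i` zeros before them are exactly those to the left of the zero
sought, so its position is `i` plus their number `J`: the last of them lies below i + J, and the
next element above it. -/
theorem isSelect_false (hX : X ⊆ Icc 1 m) {i : ℕ} (hi : 1 ≤ i) (hi' : i ≤ rank X false m) :
    IsSelect m X false i
      (i + ((range X.card).filter fun j => X.zerosBefore j < i).card) := by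
  have htop := rank_false_add (X := X) m
  rw [rank_true_top hX] at htop
  set J := ((range X.card).filter fun j => X.zerosBefore j < i).card with hJ
  have hJle : J ≤ X.card := (card_filter_le _ _).trans (card_range _).le
  have hiff {j : ℕ} (hj : j < X.card) : j < J ↔ X.zerosBefore j < i :=
    lt_card_filter_zerosBefore_iff hj
  have hlow : ∀ j < J, X.elt j < i + J := by
    intro j hj
    have h1 := (hiff (j := J - 1) (by omega)).1 (by omega)
    have h2 := elt_add_le_elt (S := X) (show j ≤ J - 1 by omega) (by omega)
    unfold zerosBefore at h1
    omega
  have hhigh : J < X.card → i + J + 1 ≤ X.elt J := by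
    intro hj
    have h1 := (hiff hj).not.1 (by omega)
    have h2 := elt_succ_le hX hj
    unfold zerosBefore at h1
    omega
  have hcount : X.countBelow (i + J) = J :=
    countBelow_eq hJle hlow fun h => by have := hhigh h; omega
  have hcount' : X.countBelow (i + J + 1) = J :=
    countBelow_eq hJle (fun j hj => by have := hlow j hj; omega) hhigh
  refine ⟨mem_Icc.2 ⟨by omega, by omega⟩, ?_, ?_⟩
  · rw [decide_eq_false_iff_not]
    intro hmem
    have := countBelow_lt hmem (Nat.lt_succ_self _)
    rw [Nat.succ_eq_add_one] at this
    omega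
  · have := rank_false_add (X := X) (i + J)
    rw [rank_true_eq hX, hcount'] at this
    omega

/-- `Z` is a set of `n` elements of `{1, …, m}` from which both the elements of `X` and the
numbers of zeros before them can be found approximately. -/
structure IsAux (m : ℕ) (X : Finset ℕ) (p : ℕ) (Z : Finset ℕ) : Prop where
  le : p ≤ X.card
  card : Z.card = X.card
  sub : Z ⊆ Icc 1 m
  eq : Z = Icc 1 p ∪ ((range (X.card / 2)).image (X.halved 1) ∪
    (range (X.zeroCounts.card / 2)).image (X.zeroCounts.halved (m / 2 + 2)))

/-- Halved elements lie between 1 and m/2 + 1. Zero counts are at most m − n, so their shifted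
halves lie between m/2 + 2 and `m`, where n ≥ 4 gives room for the summand 2. Each of the two parts
has at most n/2 members. -/
theorem exists_isAux (hX : X ⊆ Icc 1 m) (h4 : 4 ≤ X.card) : ∃ p Z, IsAux m X p Z := by
  have hXm : X.card ≤ m := by simpa using card_le_card hX
  have hK := X.card_zeroCounts_le
  suffices h : (range (X.card / 2)).image (X.halved 1) ∪
      (range (X.zeroCounts.card / 2)).image (X.zeroCounts.halved (m / 2 + 2)) ⊆ Icc 1 m ∧
      ((range (X.card / 2)).image (X.halved 1) ∪
        (range (X.zeroCounts.card / 2)).image (X.zeroCounts.halved (m / 2 + 2))).card ≤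
        X.card by
    obtain ⟨p, hp, hc, hs⟩ := exists_union_Icc_card h.1 h.2 hXm
    exact ⟨p, _, hp, hc, hs, rfl⟩
  constructor
  · refine union_subset (fun v hv => ?_) fun v hv => ?_
    · obtain ⟨k, hk, rfl⟩ := mem_image.1 hv
      rw [mem_range] at hk
      have := elt_le' hX (j := 2 * k + 1) (by omega)
      rw [mem_Icc, halved]
      omega
    · obtain ⟨k, hk, rfl⟩ := mem_image.1 hv
      rw [mem_range] at hk
      obtain ⟨j, hj, hje⟩ := mem_image.1 (elt_mem (S := X.zeroCounts) (j := 2 * k + 1) (by omega))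
      have := zerosBefore_le hX (mem_range.1 hj)
      rw [mem_Icc, halved]
      omega
  · refine (card_union_le _ _).trans ((Nat.add_le_add card_image_le card_image_le).trans ?_)
    rw [card_range, card_range]
    omega

namespace IsAux

variable {p : ℕ} {Z : Finset ℕ}

theorem mem_first (h : IsAux m X p Z) {k : ℕ} (hk : k < X.card / 2) : X.halved 1 k ∈ Z := by
  rw [h.eq]
  exact mem_union_right _ (mem_union_left _ (mem_image_of_mem _ (mem_range.2 hk)))

theorem mem_second (h : IsAux m X p Z) {k : ℕ} (hk : k < X.zeroCounts.card / 2) :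
    X.zeroCounts.halved (m / 2 + 2) k ∈ Z := by
  rw [h.eq]
  exact mem_union_right _ (mem_union_right _ (mem_image_of_mem _ (mem_range.2 hk)))

theorem elt_of_lt (h : IsAux m X p Z) {r : ℕ} (hr : r < p) : Z.elt r = r + 1 := by
  have hmem : r + 1 ∈ Z := by
    rw [h.eq]
    exact mem_union_left _ (mem_Icc.2 ⟨by omega, hr⟩)
  have hc : Z.countBelow (r + 1) = r := by
    have : Z.filter (· < r + 1) = Icc 1 r := by
      ext x
      rw [mem_filter, mem_Icc]
      constructor
      · rintro ⟨hx, hlt⟩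
        exact ⟨(mem_Icc.1 (h.sub hx)).1, by omega⟩
      · rintro ⟨h1, h2⟩
        refine ⟨?_, by omega⟩
        rw [h.eq]
        exact mem_union_left _ (mem_Icc.2 ⟨h1, by omega⟩)
    rw [countBelow, this, Nat.card_Icc]
    omega
  rw [← elt_countBelow hmem, hc]

/-- Beyond the initial segment, every member from the zero counts exceeds every member from `X`. So
the element is of the second kind precisely if the count for that kind is positive, and the
respective count minus one is its index in its own subsequence. -/
theorem elt_of_le (h : IsAux m X p Z) (hX : X ⊆ Icc 1 m) {r : ℕ} (hr : p ≤ r) (hrn : r < X.card) :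
    (0 < Z.countFirst (X.zeroCounts.halved (m / 2 + 2)) (X.zeroCounts.card / 2) (r + 1) →
      Z.elt r = X.zeroCounts.halved (m / 2 + 2)
        (Z.countFirst (X.zeroCounts.halved (m / 2 + 2)) (X.zeroCounts.card / 2) (r + 1) - 1)) ∧
    (Z.countFirst (X.zeroCounts.halved (m / 2 + 2)) (X.zeroCounts.card / 2) (r + 1) = 0 →
      0 < Z.countFirst (X.halved 1) (X.card / 2) (r + 1) ∧
      Z.elt r = X.halved 1 (Z.countFirst (X.halved 1) (X.card / 2) (r + 1) - 1)) := by
  have hrZ : r < Z.card := by rwa [h.card]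
  have hmem := elt_mem hrZ
  have hp : p < Z.elt r := by
    by_contra hle
    have h1 := (mem_Icc.1 (h.sub hmem)).1
    have h2 := h.elt_of_lt (r := Z.elt r - 1) (by omega)
    rw [Nat.sub_add_cancel h1] at h2
    have h3 := countBelow_elt (S := Z) (j := Z.elt r - 1) (by rw [h.card]; have := h.le; omega)
    rw [h2, countBelow_elt hrZ] at h3
    omega
  have hcases := hmem
  rw [h.eq, mem_union, mem_union, ← h.eq, mem_image, mem_image] at hcases
  rcases hcases with hI | ⟨k, hk, hke⟩ | ⟨k, hk, hke⟩
  · have := (mem_Icc.1 hI).2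
    omega
  · rw [mem_range] at hk
    have h1 := countFirst_of_elt_eq (fun i j hij hj => halved_lt 1 hij hj)
      (fun k hk => h.mem_first hk) hrZ hk hke
    have h2 : Z.countFirst (X.zeroCounts.halved (m / 2 + 2)) (X.zeroCounts.card / 2) (r + 1) =
        0 := by
      rw [countFirst, card_eq_zero, filter_eq_empty_iff]
      intro l hl hlt
      rw [mem_range] at hl
      have h3 : Z.countBelow (X.zeroCounts.halved (m / 2 + 2) l) ≤ Z.countBelow (Z.elt r) := by
        rw [countBelow_elt hrZ]
        omega
      rw [← hke] at h3
      have h4 := (countBelow_lt_iff (S := Z) (h.mem_first hk)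
        (u := X.zeroCounts.halved (m / 2 + 2) l)).2 (by
          have := elt_le' hX (j := 2 * k + 1) (by omega)
          unfold halved
          omega)
      omega
    rw [h2, h1]
    simp [hke]
  · rw [mem_range] at hk
    have h1 := countFirst_of_elt_eq (fun i j hij hj => halved_lt _ hij hj)
      (fun k hk => h.mem_second hk) hrZ hk hke
    rw [h1]
    simp [hke]

end IsAux

end Finset

/-! ### The index: a compact representation of a set together with an auxiliary set -/

open Finset

/-- The upper halves of the elements of `X`, continued beyond the last element. -/
noncomputable def highPart (m : ℕ) (X : Finset ℕ) (j : ℕ) : ℕ :=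
  X.elt (min j (X.card - 1)) / 2 ^ (m.size - X.card.size)

/-- The number of those elements of `Z` that come from elements of `X`, among the first `r`. -/
noncomputable def fstCount (X Z : Finset ℕ) (r : ℕ) : ℕ :=
  Z.countFirst (X.halved 1) (X.card / 2) r

/-- The number of those elements of `Z` that come from numbers of zeros, among the first `r`. -/
noncomputable def sndCount (m : ℕ) (X Z : Finset ℕ) (r : ℕ) : ℕ :=
  Z.countFirst (X.zeroCounts.halved (m / 2 + 2)) (X.zeroCounts.card / 2) r

/-- The number of bits of the index. -/
def indexLen (m n : ℕ) : ℕ := n * 93 + n * (m.size - n.size)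

/-- The bit string `B` begins with the index for `X` and `Z`. -/
structure HasIndex (B : ℕ → Bool) (m : ℕ) (X : Finset ℕ) (p : ℕ) (Z : Finset ℕ) (flag : ℕ) :
    Prop where
  bitLen : HasField B (X.card * 0) (min X.card m.size) X.card.size
  sub : HasField B (X.card * 1) (min X.card m.size) X.card.size.size
  pre : HasField B (X.card * 2) (min X.card m.size) p
  flag : HasField B (X.card * 3) (min X.card m.size) flag
  table : HasTable B (X.card * 4) X.card X.card.size.size
  high : HasSeq B (X.card * 5) X.card X.card.size X.card.size.size (highPart m X)
  run : HasSeq B (X.card * 27) X.card X.card.size X.card.size.size X.runEnd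
  fst : HasSeq B (X.card * 49) X.card X.card.size X.card.size.size (fstCount X Z)
  snd : HasSeq B (X.card * 71) X.card X.card.size X.card.size.size (sndCount m X Z)
  low : ∀ j < X.card, HasField B (X.card * 93 + j * (m.size - X.card.size))
    (m.size - X.card.size) (X.elt j % 2 ^ (m.size - X.card.size))

section

variable {m : ℕ} {X : Finset ℕ}

theorem highPart_mono (m : ℕ) (h1 : 1 ≤ X.card) : Monotone (highPart m X) := by
  intro a b hab
  refine Nat.div_le_div_right ?_
  have := elt_add_le_elt (S := X) (show min a (X.card - 1) ≤ min b (X.card - 1) by omega) (by omega)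
  omega

theorem card_le_of_subset (hX : X ⊆ Icc 1 m) : X.card ≤ m := by simpa using card_le_card hX

/-- Elements have at most size m bits, and all but size n of them are dropped. The high parts thus
satisfy the bound required for monotone sequences. -/
theorem highPart_lt (hX : X ⊆ Icc 1 m) (h1 : 1 ≤ X.card) (j : ℕ) :
    highPart m X j < 2 ^ X.card.size := by
  have hs := Nat.size_le_size (card_le_of_subset hX)
  rw [highPart, Nat.div_lt_iff_lt_mul (by positivity), ← pow_add,
    show X.card.size + (m.size - X.card.size) = m.size by omega]
  exact lt_of_le_of_lt (elt_le' hX (by omega)) (Nat.lt_size_self m)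

theorem fstCount_le (X Z : Finset ℕ) (r : ℕ) : 2 * fstCount X Z r ≤ X.card := by
  have : fstCount X Z r ≤ X.card / 2 := countFirst_le _ _ _ _
  omega

theorem sndCount_le (m : ℕ) (X Z : Finset ℕ) (r : ℕ) :
    2 * sndCount m X Z r ≤ X.zeroCounts.card := by
  have : sndCount m X Z r ≤ X.zeroCounts.card / 2 := countFirst_le _ _ _ _
  omega

theorem fstCount_mono (X Z : Finset ℕ) : Monotone (fstCount X Z) := countFirst_mono _ _ _

theorem sndCount_mono (m : ℕ) (X Z : Finset ℕ) : Monotone (sndCount m X Z) := countFirst_mono _ _ _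

theorem fstCount_lt (X Z : Finset ℕ) (r : ℕ) : fstCount X Z r < 2 ^ X.card.size := by
  have := fstCount_le X Z r
  have := Nat.lt_size_self X.card
  omega

theorem sndCount_lt (m : ℕ) (X Z : Finset ℕ) (r : ℕ) : sndCount m X Z r < 2 ^ X.card.size := by
  have := sndCount_le m X Z r
  have := X.card_zeroCounts_le
  have := Nat.lt_size_self X.card
  omega

theorem runEnd_lt (X : Finset ℕ) (l : ℕ) : X.runEnd l < 2 ^ X.card.size :=
  lt_of_le_of_lt (X.runEnd_le l) (Nat.lt_size_self X.card)

/-- Every section starts at a multiple of `n`, so a program finds it from `n` alone. The first four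
sections hold scalars of at most `n`; the width `min n m.size` fits into the section as well as into
a word. -/
theorem exists_hasIndex (hX : X ⊆ Icc 1 m)
    (hpar : SeqParams X.card X.card.size X.card.size.size) {p flag : ℕ} {Z : Finset ℕ}
    (hp : p ≤ X.card) (hflag : flag ≤ 1) :
    ∃ A : List Bool, A.length = indexLen m X.card ∧ ∀ B : ℕ → Bool,
      (∀ i < A.length, B i = A.getD i false) → HasIndex B m X p Z flag := by
  have hnm := card_le_of_subset hX
  have hsize := Nat.size_le_size hnm
  have h1 : 1 ≤ X.card := by
    have := hpar.group_le
    have := hpar.pos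
    have := hpar.two_le
    nlinarith
  have hlt : ∀ v ≤ X.card, v < 2 ^ min X.card m.size := by
    intro v hv
    rcases le_total X.card m.size with h | h
    · rw [min_eq_left h]
      exact lt_of_le_of_lt hv Nat.lt_two_pow_self
    · rw [min_eq_right h]
      exact lt_of_le_of_lt (hv.trans hnm) (Nat.lt_size_self m)
  have hsz (v : ℕ) : v.size ≤ v := Nat.size_le.2 Nat.lt_two_pow_self
  obtain ⟨A₁, h₁⟩ := exists_hasTable hpar
  obtain ⟨A₂, h₂⟩ := exists_hasSeq hpar (highPart_mono m h1) (highPart_lt hX h1)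
  obtain ⟨A₃, h₃⟩ := exists_hasSeq hpar X.runEnd_mono (runEnd_lt X)
  obtain ⟨A₄, h₄⟩ := exists_hasSeq hpar (fstCount_mono X Z) (fstCount_lt X Z)
  obtain ⟨A₅, h₅⟩ := exists_hasSeq hpar (sndCount_mono m X Z) (sndCount_lt m X Z)
  obtain ⟨A₆, h₆⟩ := exists_array (m.size - X.card.size)
    (fun j => X.elt j % 2 ^ (m.size - X.card.size)) fun j => Nat.mod_lt _ (by positivity)
  obtain ⟨A, hA⟩ := exists_pieces (ι := Fin 10)
    ![X.card * 0, X.card * 1, X.card * 2, X.card * 3, X.card * 4, X.card * 5, X.card * 27,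
      X.card * 49, X.card * 71, X.card * 93]
    ![min X.card m.size, min X.card m.size, min X.card m.size, min X.card m.size, X.card,
      22 * X.card, 22 * X.card, 22 * X.card, 22 * X.card, X.card * (m.size - X.card.size)]
    ![X.card.size.testBit, X.card.size.size.testBit, p.testBit, flag.testBit, A₁, A₂, A₃, A₄, A₅,
      A₆] (by
      intro a b hab _ _
      fin_cases a <;> fin_cases b <;> simp at hab ⊢ <;> omega)
  refine ⟨List.ofFn fun i : Fin (indexLen m X.card) => A i, List.length_ofFn, fun B hB => ?_⟩
  rw [List.length_ofFn] at hB
  have hBA : ∀ i < X.card * 93 + X.card * (m.size - X.card.size), B i = A i := by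
    intro i hi
    rw [hB i hi, List.getD_eq_getElem _ _ (by rwa [List.length_ofFn]), List.getElem_ofFn]
  have hmin : min X.card m.size ≤ X.card := min_le_left _ _
  constructor
  · exact ⟨hlt _ (hsz _), fun i hi => by rw [hBA _ (by omega)]; exact hA 0 i hi⟩
  · exact ⟨hlt _ ((hsz _).trans (hsz _)), fun i hi => by rw [hBA _ (by omega)]; exact hA 1 i hi⟩
  · exact ⟨hlt _ hp, fun i hi => by rw [hBA _ (by omega)]; exact hA 2 i hi⟩
  · exact ⟨hlt _ (by omega), fun i hi => by rw [hBA _ (by omega)]; exact hA 3 i hi⟩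
  · exact h₁ _ _ fun i hi => by rw [hBA _ (by omega)]; exact hA 4 i hi
  · exact h₂ _ _ fun i hi => by rw [hBA _ (by omega)]; exact hA 5 i hi
  · exact h₃ _ _ fun i hi => by rw [hBA _ (by omega)]; exact hA 6 i hi
  · exact h₄ _ _ fun i hi => by rw [hBA _ (by omega)]; exact hA 7 i hi
  · exact h₅ _ _ fun i hi => by rw [hBA _ (by omega)]; exact hA 8 i hi
  · intro j hj
    refine (h₆ j).congr fun i hi => ?_
    have h2 : (j + 1) * (m.size - X.card.size) ≤ X.card * (m.size - X.card.size) :=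
      Nat.mul_le_mul_right _ hj
    rw [add_mul, one_mul] at h2
    rw [add_assoc, hBA _ (by omega)]
    exact hA 9 _ (show _ < X.card * (m.size - X.card.size) by omega)

end

namespace WordRAM

/-! ### Queries to the index -/

/-- The number of low bits of elements that are stored separately. -/
def lowLen : Expr := .var 4 - SeqExpr.bitLen

/-- The element with index `j`. -/
def eltExpr (j : Expr) : Expr := seqVal 5 j <<< lowLen + readArray (secPos 93) lowLen j

/-- The element with index `l` of the set of numbers of zeros before elements. -/
def zeroExpr (l : Expr) : Expr := eltExpr (seqVal 27 l) - (seqVal 27 l + .lit 1)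

/-- The number of `t < T` such that the element with index `b + t` is at most `i`. -/
def countElt (b i : Expr) : ℕ → Expr
  | 0 => .lit 0
  | T + 1 => countElt b i T + .ite (.lit T) (.var 1 - b)
      (.ite i (eltExpr (b + .lit T)) (.lit 0) (.lit 1)) (.lit 0)

/-- The number of `t < T` such that the element with index `b + t` of the set of numbers of zeros
is at most `i`. -/
def countZero (b i : Expr) : ℕ → Expr
  | 0 => .lit 0
  | T + 1 => countZero b i T + .ite (.lit T) (.var 1 - b)
      (.ite (seqVal 27 (b + .lit T)) (.var 1)
        (.ite i (zeroExpr (b + .lit T)) (.lit 0) (.lit 1)) (.lit 0)) (.lit 0)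

/-- The rank of `i`, where the variable `7` holds an index in the auxiliary set. -/
def rankExpr (i : Expr) : Expr :=
  .lit 2 * seqVal 49 (.var 7) + countElt (.lit 2 * seqVal 49 (.var 7)) i 9

/-- The number of elements with at most `i` zeros before them, where the variable `7` holds an
index in the auxiliary set. -/
def zeroRankExpr (i : Expr) : Expr :=
  seqVal 27 (.lit 2 * seqVal 71 (.var 7) + countZero (.lit 2 * seqVal 71 (.var 7)) i 9)

/-- The element of the auxiliary set with index `r`. -/
def auxElt (r : Expr) : Expr :=
  .ite r (scalar 2) (r + .lit 1)
    (.ite (.lit 0) (seqVal 71 (r + .lit 1))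
      (.var 2 / .lit 2 + .lit 2 + zeroExpr (.lit 2 * seqVal 71 (r + .lit 1) - .lit 1) / .lit 2)
      (.lit 1 + eltExpr (.lit 2 * seqVal 49 (r + .lit 1) - .lit 1) / .lit 2))

/-- The circumstances under which the expressions of this section have the intended values. -/
structure SetContext {w : ℕ} (D : List Bool) (env : Fin 8 → BitVec w) (m : ℕ) (X : Finset ℕ)
    (p : ℕ) (Z : Finset ℕ) (flag : ℕ) : Prop where
  params : HasParams X.card m env
  sub : X ⊆ Icc 1 m
  aux : IsAux m X p Z
  index : HasIndex (D.getD · false) m X p Z flag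
  size_le : m.size ≤ w
  large : 200 ≤ X.card.size
  seq : SeqParams X.card X.card.size X.card.size.size
  space : indexLen m X.card ≤ w * 2 ^ w

namespace SetContext

variable {w : ℕ} {D : List Bool} {env : Fin 8 → BitVec w} {m : ℕ} {X : Finset ℕ} {p : ℕ}
  {Z : Finset ℕ} {flag : ℕ}

theorem univ_lt (h : SetContext D env m X p Z flag) : m < 2 ^ w :=
  lt_of_lt_of_le (Nat.lt_size_self m) (Nat.pow_le_pow_right (by norm_num) h.size_le)

theorem toIndexContext (h : SetContext D env m X p Z flag) :
    IndexContext D env X.card m.size X.card.size X.card.size.size where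
  word := h.params.word
  card := h.params.card
  size := h.params.size
  card_lt := lt_of_le_of_lt (card_le_of_subset h.sub) h.univ_lt
  size_le := h.size_le
  len_le := Nat.size_le_size (card_le_of_subset h.sub)
  len_le' := h.large
  params := h.seq
  space := h.space
  bitLen := h.index.bitLen
  sub := h.index.sub
  table := h.index.table

theorem one_le_card (h : SetContext D env m X p Z flag) : 1 ≤ X.card := by
  have := h.large
  by_contra hn
  rw [show X.card = 0 by omega] at this
  simp at this

theorem elt_lt (h : SetContext D env m X p Z flag) {j : ℕ} (hj : j < X.card) :
    X.elt j < 2 ^ w := lt_of_le_of_lt (elt_le' h.sub hj) h.univ_lt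

theorem ev_elt (h : SetContext D env m X p Z flag) {j : Expr} {J : ℕ} (hj : Ev D env j J)
    (hJ : J < X.card) : Ev D env (eltExpr j) (X.elt J) := by
  have hi := h.toIndexContext
  have e1 := hi.ev_seqVal (by norm_num) (highPart_mono m h.one_le_card)
    (highPart_lt h.sub h.one_le_card) h.index.high hj hJ.le
  rw [highPart, show min J (X.card - 1) = J by omega] at e1
  have e2 : Ev D env lowLen (m.size - X.card.size) := hi.ev_size.sub hi.ev_bitLen hi.len_le
  have hsize := h.size_le
  have hsp := h.space
  have hdm := Nat.div_add_mod' (X.elt J) (2 ^ (m.size - X.card.size))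
  have hlt := h.elt_lt hJ
  have e3 := Ev.readArray hi.word hi.one_le_word (hi.pos_sec (c := 93) (by norm_num)) e2 hj
    (by omega) (h.index.low J hJ) (by
      have h2 : (J + 1) * (m.size - X.card.size) ≤ X.card * (m.size - X.card.size) :=
        Nat.mul_le_mul_right _ hJ
      rw [add_mul, one_mul] at h2
      unfold indexLen at hsp
      omega)
  exact ((e1.shiftLeft e2 (by omega)).add e3 (by omega)).congr hdm

theorem ev_runEnd (h : SetContext D env m X p Z flag) {j : Expr} {J : ℕ} (hj : Ev D env j J)
    (hJ : J ≤ X.card) : Ev D env (seqVal 27 j) (X.runEnd J) :=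
  h.toIndexContext.ev_seqVal (by norm_num) X.runEnd_mono (runEnd_lt X) h.index.run hj hJ

theorem ev_fstCount (h : SetContext D env m X p Z flag) {j : Expr} {J : ℕ} (hj : Ev D env j J)
    (hJ : J ≤ X.card) : Ev D env (seqVal 49 j) (fstCount X Z J) :=
  h.toIndexContext.ev_seqVal (by norm_num) (fstCount_mono X Z) (fstCount_lt X Z) h.index.fst hj hJ

theorem ev_sndCount (h : SetContext D env m X p Z flag) {j : Expr} {J : ℕ} (hj : Ev D env j J)
    (hJ : J ≤ X.card) : Ev D env (seqVal 71 j) (sndCount m X Z J) :=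
  h.toIndexContext.ev_seqVal (by norm_num) (sndCount_mono m X Z) (sndCount_lt m X Z) h.index.snd
    hj hJ

theorem ev_zero (h : SetContext D env m X p Z flag) {l : Expr} {l' : ℕ} (hl : Ev D env l l')
    (hl' : l' < X.zeroCounts.card) : Ev D env (zeroExpr l) (X.zeroCounts.elt l') := by
  have hle := X.card_zeroCounts_le
  have hr := runEnd_lt_iff.2 hl'
  have e1 := h.ev_runEnd hl (by omega)
  have hc := h.toIndexContext.card_lt
  rw [elt_zeroCounts hl']
  exact (h.ev_elt e1 hr).sub (e1.add (.lit_one h.toIndexContext.one_le_word) (by omega))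
    (elt_succ_le h.sub hr)

/-- Elements increase, so those at most `ι` among indices from `β` on form a prefix. Indices beyond
the last element contribute nothing. -/
theorem ev_countElt (h : SetContext D env m X p Z flag) {b i : Expr} {β ι : ℕ}
    (hb : Ev D env b β) (hi : Ev D env i ι) (hβ : β ≤ X.countBelow (ι + 1)) {T : ℕ}
    (hT : T ≤ 200) : Ev D env (countElt b i T) (min T (X.countBelow (ι + 1) - β)) := by
  have hic := h.toIndexContext
  have hle := X.countBelow_le (ι + 1)
  have hc := hic.card_lt
  induction T with
  | zero => exact (hic.ev_lit (by norm_num)).congr (by simp)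
  | succ T ih =>
    have hstep : Ev D env (.ite (.lit T) (.var 1 - b)
        (.ite i (eltExpr (b + .lit T)) (.lit 0) (.lit 1)) (.lit 0))
        (if β + T < X.countBelow (ι + 1) then 1 else 0) := by
      refine (hic.ev_lit (by omega)).ite (hic.ev_card.sub hb (by omega)) (fun h1 => ?_) fun h1 => ?_
      · have e1 := h.ev_elt (hb.add (hic.ev_lit (c := T) (by omega)) (by omega))
          (show β + T < X.card by omega)
        have hiff := lt_countBelow_iff (S := X) (j := β + T) (v := ι + 1) (by omega)
        refine hi.ite e1 (fun h2 => ?_) fun h2 => ?_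
        · rw [if_neg (by omega)]
          exact hic.ev_lit (by norm_num)
        · rw [if_pos (by omega)]
          exact hic.ev_lit (by norm_num)
      · rw [if_neg (by omega)]
        exact hic.ev_lit (by norm_num)
    refine ((ih (by omega)).add hstep ?_).congr ?_ <;> split_ifs <;> omega

theorem ev_countZero (h : SetContext D env m X p Z flag) {b i : Expr} {β ι : ℕ}
    (hb : Ev D env b β) (hi : Ev D env i ι) (hβ : β ≤ X.zeroCounts.countBelow (ι + 1)) {T : ℕ}
    (hT : T ≤ 200) :
    Ev D env (countZero b i T) (min T (X.zeroCounts.countBelow (ι + 1) - β)) := by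
  have hic := h.toIndexContext
  have hle := X.zeroCounts.countBelow_le (ι + 1)
  have hle' := X.card_zeroCounts_le
  have hc := hic.card_lt
  induction T with
  | zero => exact (hic.ev_lit (by norm_num)).congr (by simp)
  | succ T ih =>
    have hstep : Ev D env (.ite (.lit T) (.var 1 - b)
        (.ite (seqVal 27 (b + .lit T)) (.var 1)
          (.ite i (zeroExpr (b + .lit T)) (.lit 0) (.lit 1)) (.lit 0)) (.lit 0))
        (if β + T < X.zeroCounts.countBelow (ι + 1) then 1 else 0) := by
      refine (hic.ev_lit (by omega)).ite (hic.ev_card.sub hb (by omega)) (fun h1 => ?_) fun h1 => ?_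
      · have e0 := hb.add (hic.ev_lit (c := T) (by omega)) (by omega)
        refine (h.ev_runEnd e0 (by omega)).ite hic.ev_card (fun h2 => ?_) fun h2 => ?_
        · rw [runEnd_lt_iff] at h2
          have e1 := h.ev_zero e0 h2
          have hiff := lt_countBelow_iff (S := X.zeroCounts) (v := ι + 1) h2
          refine hi.ite e1 (fun h3 => ?_) fun h3 => ?_
          · rw [if_neg (by omega)]
            exact hic.ev_lit (by norm_num)
          · rw [if_pos (by omega)]
            exact hic.ev_lit (by norm_num)
        · rw [runEnd_lt_iff] at h2
          rw [if_neg (by omega)]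
          exact hic.ev_lit (by norm_num)
      · rw [if_neg (by omega)]
        exact hic.ev_lit (by norm_num)
    refine ((ih (by omega)).add hstep ?_).congr ?_ <;> split_ifs <;> omega

/-- A lookup is off by at most 3, hence so is the number of halved elements. Doubling makes this 6,
and halving the set costs another 3, so inspecting 9 elements finds the exact rank. -/
theorem ev_rank (h : SetContext D env m X p Z flag) {i : Expr} {ι r : ℕ} (hi : Ev D env i ι)
    (h7 : (env 7).toNat = r) (hr : r ≤ Z.countBelow (1 + ι / 2))
    (hr' : Z.countBelow (1 + ι / 2) ≤ r + 3) :
    Ev D env (rankExpr i) (X.countBelow (ι + 1)) := by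
  have hic := h.toIndexContext
  have hZ := Z.countBelow_le (1 + ι / 2)
  rw [h.aux.card] at hZ
  have e1 := h.ev_fstCount (.var h7) (by omega)
  have h2 := fstCount_le X Z r
  have hc := hic.card_lt
  have e2 := (hic.ev_lit (c := 2) (by norm_num)).mul e1 (by omega)
  have happ := X.countBelow_approx 1 ι
  have hinj := halved_inj (S := X) 1
  have hF := countFirst_countBelow (S := Z) (fun k hk => h.aux.mem_first hk) (1 + ι / 2)
  rw [← hF] at happ
  change 2 * fstCount X Z _ ≤ _ ∧ _ ≤ 2 * fstCount X Z _ + 3 at happ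
  have h3 := fstCount_mono X Z hr
  have h4 := fstCount_mono X Z hr'
  have h5 : fstCount X Z (r + 3) ≤ fstCount X Z r + 3 :=
    countFirst_add_le hinj (fun k hk => h.aux.mem_first hk) r 3
  have h6 := X.countBelow_le (ι + 1)
  refine (e2.add (h.ev_countElt e2 hi (by omega) (by norm_num)) (by omega)).congr ?_
  omega

theorem ev_zeroRank (h : SetContext D env m X p Z flag) {i : Expr} {ι r : ℕ} (hi : Ev D env i ι)
    (h7 : (env 7).toNat = r) (hr : r ≤ Z.countBelow (m / 2 + 2 + ι / 2))
    (hr' : Z.countBelow (m / 2 + 2 + ι / 2) ≤ r + 3) :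
    Ev D env (zeroRankExpr i)
      ((range X.card).filter fun j => X.zerosBefore j < ι + 1).card := by
  have hic := h.toIndexContext
  have hZ := Z.countBelow_le (m / 2 + 2 + ι / 2)
  rw [h.aux.card] at hZ
  have e1 := h.ev_sndCount (.var h7) (by omega)
  have h2 := sndCount_le m X Z r
  have hle' := X.card_zeroCounts_le
  have hc := hic.card_lt
  have e2 := (hic.ev_lit (c := 2) (by norm_num)).mul e1 (by omega)
  have happ := X.zeroCounts.countBelow_approx (m / 2 + 2) ι
  have hF := countFirst_countBelow (S := Z) (fun k hk => h.aux.mem_second hk) (m / 2 + 2 + ι / 2)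
  rw [← hF] at happ
  change 2 * sndCount m X Z _ ≤ _ ∧ _ ≤ 2 * sndCount m X Z _ + 3 at happ
  have h3 := sndCount_mono m X Z hr
  have h4 := sndCount_mono m X Z hr'
  have h5 : sndCount m X Z (r + 3) ≤ sndCount m X Z r + 3 :=
    countFirst_add_le (halved_inj _) (fun k hk => h.aux.mem_second hk) r 3
  have h6 := X.zeroCounts.countBelow_le (ι + 1)
  have e3 := e2.add (h.ev_countZero e2 hi (by omega) (T := 9) (by norm_num)) (by omega)
  rw [show 2 * sndCount m X Z r + min 9 (X.zeroCounts.countBelow (ι + 1) - 2 * sndCount m X Z r) =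
    X.zeroCounts.countBelow (ι + 1) by omega] at e3
  exact (h.ev_runEnd e3 (by omega)).congr (X.runEnd_countBelow _)

theorem ev_auxElt (h : SetContext D env m X p Z flag) {i : Expr} {r : ℕ} (hi : Ev D env i r)
    (hr : r < X.card) : Ev D env (auxElt i) (Z.elt r) := by
  have hic := h.toIndexContext
  have hw := hic.one_le_word
  have hc := hic.card_lt
  have e1 := hi.add (.lit_one hw) (show r + 1 < 2 ^ w by omega)
  have ep : Ev D env (scalar 2) p := hic.ev_scalar (by norm_num) h.index.pre
  refine hi.ite ep (fun h1 => ?_) fun h1 => ?_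
  · rw [h.aux.elt_of_lt h1]
    exact e1
  · have hz := h.aux.elt_of_le h.sub (by omega) hr
    have es := h.ev_sndCount e1 hr
    have hs := sndCount_le m X Z (r + 1)
    have hK := X.card_zeroCounts_le
    refine (hic.ev_lit (by norm_num)).ite es (fun h2 => ?_) fun h2 => ?_
    · rw [hz.1 h2]
      change Ev D env _ (X.zeroCounts.halved _ (sndCount m X Z (r + 1) - 1))
      have e2 : Ev D env (.lit 2 * seqVal 71 (i + .lit 1) - .lit 1)
          (2 * (sndCount m X Z (r + 1) - 1) + 1) :=
        (((hic.ev_lit (by norm_num)).mul es (by omega)).sub (.lit_one hw) (by omega)).congr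
          (by omega)
      have e3 := h.ev_zero e2 (by omega)
      have e4 : Ev D env (.var 2) m := .var_ofNat h.params.univ h.univ_lt
      have hm := (mem_Icc.1 (h.aux.sub (h.aux.mem_second
        (k := sndCount m X Z (r + 1) - 1) (by omega)))).2
      have hu := h.univ_lt
      unfold halved at hm ⊢
      exact ((e4.div (hic.ev_lit (by norm_num))).add (hic.ev_lit (by norm_num)) (by omega)).add
        (e3.div (hic.ev_lit (by norm_num))) (by omega)
    · have hz2 := hz.2 (by change sndCount m X Z (r + 1) = 0; omega)
      change 0 < fstCount X Z (r + 1) ∧ _ = X.halved 1 (fstCount X Z (r + 1) - 1) at hz2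
      rw [hz2.2]
      have hf := fstCount_le X Z (r + 1)
      have e2 : Ev D env (.lit 2 * seqVal 49 (i + .lit 1) - .lit 1)
          (2 * (fstCount X Z (r + 1) - 1) + 1) :=
        (((hic.ev_lit (by norm_num)).mul (h.ev_fstCount e1 hr) (by omega)).sub (.lit_one hw)
          (by omega)).congr (by omega)
      have e3 := h.ev_elt e2 (by omega)
      have hm := (mem_Icc.1 (h.aux.sub (h.aux.mem_first
        (k := fstCount X Z (r + 1) - 1) (by omega)))).2
      have hu := h.univ_lt
      unfold halved at hm ⊢
      exact (Ev.lit_one hw).add (e3.div (hic.ev_lit (by norm_num))) (by omega)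

end SetContext

end WordRAM

/-- With L = size n and Q = size L, all conditions follow from 2^(L − 1) ≤ n and from 5Q² + Q + 1 ≤
2^(Q − 1) ≤ L, that is, from Q being about log log n. -/
theorem seqParams_of_le {n ν : ℕ} (hν : 1024 ≤ ν) (hn : 2 ^ ν ≤ n) :
    SeqParams n n.size n.size.size := by
  have hlt := Nat.lt_size_self n
  have hL : 1025 ≤ n.size := by
    by_contra h
    exact absurd (Nat.size_le.1 (show n.size ≤ ν by omega)) (by omega)
  have hle : 2 ^ (n.size - 1) ≤ n := Nat.lt_size.1 (by omega)
  set L := n.size with hLdef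
  have hQlt := Nat.lt_size_self L
  have hQ : 11 ≤ L.size := by
    by_contra h
    have := Nat.size_le.1 (show L.size ≤ 10 by omega)
    norm_num at this
    omega
  have hle' : 2 ^ (L.size - 1) ≤ L := Nat.lt_size.1 (by omega)
  set Q := L.size with hQdef
  have key : ∀ q, 11 ≤ q → 5 * q * q + q + 1 ≤ 2 ^ (q - 1) ∧ 4 * q * q ≤ 2 ^ q := by
    intro q hq
    induction q, hq using Nat.le_induction with
    | base => norm_num
    | succ q hq ih =>
      have h1 : 2 ^ (q + 1 - 1) = 2 * 2 ^ (q - 1) := by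
        rw [← pow_succ']
        congr 1
        omega
      rw [h1, pow_succ]
      constructor <;> nlinarith
  obtain ⟨k1, k2⟩ := key Q hQ
  have hp (a : ℕ) (ha : a ≤ L - 1) : 2 ^ a ≤ n := (Nat.pow_le_pow_right (by norm_num) ha).trans hle
  constructor
  · exact hlt
  · calc 2 ^ L = 2 * 2 ^ (L - 1) := by
          rw [← pow_succ']
          congr 1
          omega
      _ ≤ 2 * n := by omega
  · exact hQlt
  · omega
  · calc 2 ^ (5 * Q * Q) * Q * (4 * Q) = 2 ^ (5 * Q * Q) * (4 * Q * Q) := by ring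
      _ ≤ 2 ^ (5 * Q * Q) * 2 ^ Q := Nat.mul_le_mul_left _ k2
      _ = 2 ^ (5 * Q * Q + Q) := by rw [pow_add]
      _ ≤ n := hp _ (by omega)
  · omega
  · have hQQ : Q < 2 ^ Q := Nat.lt_two_pow_self
    calc L * Q * L ≤ 2 ^ Q * 2 ^ Q * 2 ^ Q := by gcongr
      _ = 2 ^ (3 * Q) := by ring
      _ ≤ n := hp _ (by
        have : Q ≤ Q * Q := Nat.le_mul_self Q
        have : 5 * Q * Q = 5 * (Q * Q) := by ring
        omega)

/-! ### The verbatim representation -/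

theorem sort_getD_eq_elt (X : Finset ℕ) {j : ℕ} (hj : j < X.card) :
    (X.sort (· ≤ ·))[j]'(by rwa [length_sort]) = X.elt j := by
  have hlen : j < (X.sort (· ≤ ·)).length := by rwa [length_sort]
  have hmem : (X.sort (· ≤ ·))[j] ∈ X := (mem_sort (· ≤ ·)).1 (List.getElem_mem hlen)
  have hsorted := X.sortedLT_sort.pairwise
  rw [List.pairwise_iff_getElem] at hsorted
  have hcount : X.countBelow (X.sort (· ≤ ·))[j] = j := by
    have hset : X.filter (· < (X.sort (· ≤ ·))[j]) =
        (range j).attach.image fun i => (X.sort (· ≤ ·))[i.1]'(by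
          have := mem_range.1 i.2; omega) := by
      ext x
      simp only [mem_filter, mem_image, mem_attach, true_and, Subtype.exists, mem_range]
      constructor
      · rintro ⟨hx, hlt⟩
        obtain ⟨i, hi, rfl⟩ := List.getElem_of_mem ((mem_sort (· ≤ ·)).2 hx)
        refine ⟨i, ?_, rfl⟩
        by_contra hij
        rcases Nat.lt_or_ge j i with h | h
        · have := hsorted j i hlen hi h
          omega
        · obtain rfl : i = j := by omega
          omega
      · rintro ⟨i, hi, rfl⟩
        exact ⟨(mem_sort (· ≤ ·)).1 (List.getElem_mem _), hsorted i j _ hlen hi⟩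
    rw [countBelow, hset, card_image_of_injective, card_attach, card_range]
    rintro ⟨a, ha⟩ ⟨b, hb⟩ hab
    rw [mem_range] at ha hb
    dsimp only at hab
    rcases lt_trichotomy a b with h | rfl | h
    · have := hsorted a b (by omega) (by omega) h
      omega
    · rfl
    · have := hsorted b a (by omega) (by omega) h
      omega
  rw [← elt_countBelow hmem, hcount]

theorem length_flatMap_ofFn (l : List ℕ) (k : ℕ) :
    (l.flatMap fun x => List.ofFn fun i : Fin k => x.testBit i).length = l.length * k := by
  induction l with
  | nil => simp
  | cons a l ih => simp [List.flatMap_cons, ih, add_mul, add_comm]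

theorem length_verbatim (m : ℕ) (X : Finset ℕ) : (verbatim m X).length = X.card * m.size := by
  rw [verbatim, length_flatMap_ofFn, length_sort]

theorem getD_flatMap_ofFn (l : List ℕ) (k : ℕ) {j i : ℕ} (hj : j < l.length) (hi : i < k) :
    (l.flatMap fun x => List.ofFn fun i : Fin k => x.testBit i).getD (j * k + i) false =
      l[j].testBit i := by
  induction l generalizing j with
  | nil => simp at hj
  | cons a l ih =>
    rw [List.flatMap_cons]
    cases j with
    | zero =>
      rw [List.getD_append _ _ _ _ (by simpa using hi),
        List.getD_eq_getElem _ _ (by simpa using hi)]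
      simp
    | succ j =>
      rw [List.getD_append_right _ _ _ _ (by simp [add_mul]; omega), List.length_ofFn,
        show (j + 1) * k + i - k = j * k + i by rw [add_mul]; omega, ih (by simpa using hj)]
      simp

theorem getD_verbatim {m : ℕ} {X : Finset ℕ} {j i : ℕ} (hj : j < X.card) (hi : i < m.size) :
    (verbatim m X).getD (j * m.size + i) false = (X.elt j).testBit i := by
  rw [verbatim, getD_flatMap_ofFn _ _ (by rwa [length_sort]) hi, sort_getD_eq_elt X hj]

namespace WordRAM

/-- The element with index `j` in the verbatim representation. -/
def plainElt (j : Expr) : Expr := readArray ⟨.lit 0, .lit 0⟩ (.var 4) j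

/-- The number of `j` from `k` on for which the expression `e j` has the value one. -/
def plainCount (e : ℕ → Expr) (k : ℕ) : ℕ → Expr
  | 0 => .lit 0
  | T + 1 => .ite (.lit k) (.var 1) (e k + plainCount e (k + 1) T) (.lit 0)

def plainRank (T : ℕ) (i : Expr) : Expr :=
  plainCount (fun k => .ite i (plainElt (.lit k)) (.lit 0) (.lit 1)) 0 T

def plainZeroRank (T : ℕ) (i : Expr) : Expr :=
  plainCount (fun k => .ite (plainElt (.lit k) - (.lit k + .lit 1)) i (.lit 1) (.lit 0)) 0 T

section

variable {w : ℕ} {m : ℕ} {X : Finset ℕ} {env : Fin 8 → BitVec w}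

theorem Ev.lit_zero {D : List Bool} : Ev D env (.lit 0) 0 := .lit (by positivity)

theorem card_lt_of_size_le (hX : X ⊆ Icc 1 m) (hw : m.size ≤ w) : X.card < 2 ^ w :=
  lt_of_le_of_lt (card_le_of_subset hX)
    (lt_of_lt_of_le (Nat.lt_size_self m) (Nat.pow_le_pow_right (by norm_num) hw))

theorem ev_plainElt (hp : HasParams X.card m env) (hX : X ⊆ Icc 1 m) (hw : m.size ≤ w)
    (hw1 : 1 ≤ w) {j : Expr} {J : ℕ} (hj : Ev (verbatim m X) env j J) (hJ : J < X.card) :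
    Ev (verbatim m X) env (plainElt j) (X.elt J) := by
  have hpos : Pos (verbatim m X) env ⟨.lit 0, .lit 0⟩ 0 :=
    ⟨Ev.lit_zero.congr (by simp), Ev.lit_zero.congr (by simp)⟩
  have hsz : Ev (verbatim m X) env (.var 4) m.size :=
    .var_ofNat hp.size (lt_of_le_of_lt hw Nat.lt_two_pow_self)
  have hc := card_lt_of_size_le hX hw
  refine .readArray hp.word hw1 hpos hsz hj hw ⟨?_, fun i hi => ?_⟩ ?_
  · exact lt_of_le_of_lt (elt_le' hX hJ) (Nat.lt_size_self m)
  · rw [zero_add]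
    exact getD_verbatim hJ hi
  · calc 0 + J * m.size + m.size = (J + 1) * m.size := by ring
      _ ≤ 2 ^ w * w := Nat.mul_le_mul (by omega) hw
      _ = w * 2 ^ w := mul_comm _ _

/-- The guards are nested, so the evaluation stops at `n` and the literals that occur never exceed
`n`. This matters because the constant number `T` of rounds may exceed the range of a word. -/
theorem ev_plainCount {D : List Bool} {n : ℕ} (hn : n < 2 ^ w) (hcard : env 1 = BitVec.ofNat w n)
    {e : ℕ → Expr} (P : ℕ → Prop) [DecidablePred P]
    (he : ∀ k < n, Ev D env (e k) (if P k then 1 else 0)) {T k : ℕ} (hk : k ≤ n) (hT : n < k + T) :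
    Ev D env (plainCount e k T) ((Ico k n).filter P).card := by
  induction T generalizing k with
  | zero => omega
  | succ T ih =>
    refine (Ev.lit (by omega)).ite (.var_ofNat hcard hn) (fun hlt => ?_) fun hge => ?_
    · have h1 := ih (k := k + 1) (by omega) (by omega)
      have h2 : ((Ico k n).filter P).card =
          (if P k then 1 else 0) + ((Ico (k + 1) n).filter P).card := by
        rw [← insert_Ico_add_one_left_eq_Ico hlt, filter_insert]
        split_ifs with hP
        · rw [card_insert_of_notMem (by simp)]
          omega
        · simp
      have h3 : ((Ico k n).filter P).card ≤ n :=
        (card_filter_le _ _).trans (by simp)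
      exact ((he k hlt).add h1 (by omega)).congr h2.symm
    · rw [Ico_eq_empty_of_le (by omega)]
      exact Ev.lit_zero

theorem card_filter_elt_lt (X : Finset ℕ) (v : ℕ) :
    ((Ico 0 X.card).filter fun j => X.elt j < v).card = X.countBelow v := by
  have : (Ico 0 X.card).filter (fun j => X.elt j < v) = range (X.countBelow v) := by
    ext j
    simp only [mem_filter, mem_Ico, mem_range]
    have hle := X.countBelow_le v
    constructor
    · rintro ⟨⟨-, hj⟩, h⟩
      exact (lt_countBelow_iff hj).2 h
    · intro h
      exact ⟨⟨by omega, by omega⟩, (lt_countBelow_iff (by omega)).1 h⟩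
  rw [this, card_range]

theorem ev_plainRank (hp : HasParams X.card m env) (hX : X ⊆ Icc 1 m) (hw : m.size ≤ w)
    (hw1 : 1 ≤ w) {i : Expr} {ι : ℕ} (hi : Ev (verbatim m X) env i ι) {T : ℕ}
    (hT : X.card < T) : Ev (verbatim m X) env (plainRank T i) (X.countBelow (ι + 1)) := by
  have hc := card_lt_of_size_le hX hw
  rw [← card_filter_elt_lt]
  refine ev_plainCount hc hp.card (fun j => X.elt j < ι + 1) (fun k hk => ?_) (Nat.zero_le _)
    (by omega)
  refine hi.ite (ev_plainElt hp hX hw hw1 (.lit (by omega)) hk) (fun h => ?_) fun h => ?_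
  · rw [if_neg (by omega)]
    exact .lit_zero
  · rw [if_pos (by omega)]
    exact .lit_one hw1

theorem ev_plainZeroRank (hp : HasParams X.card m env) (hX : X ⊆ Icc 1 m) (hw : m.size ≤ w)
    (hw1 : 1 ≤ w) {i : Expr} {ι : ℕ} (hi : Ev (verbatim m X) env i ι) {T : ℕ}
    (hT : X.card < T) : Ev (verbatim m X) env (plainZeroRank T i)
      ((range X.card).filter fun j => X.zerosBefore j < ι).card := by
  have hc := card_lt_of_size_le hX hw
  rw [range_eq_Ico]
  refine ev_plainCount hc hp.card (fun j => X.zerosBefore j < ι) (fun k hk => ?_) (Nat.zero_le _)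
    (by omega)
  have e1 := ev_plainElt hp hX hw hw1 (.lit (c := k) (by omega)) hk
  refine (e1.sub ((Ev.lit (c := k) (by omega)).add (.lit_one hw1) (by omega))
    (elt_succ_le hX hk)).ite hi (fun h => ?_) fun h => ?_
  · rw [if_pos (show X.zerosBefore k < ι from h)]
    exact .lit_one hw1
  · rw [if_neg (show ¬ X.zerosBefore k < ι from h)]
    exact .lit_zero

end

/-- `n / 2 ^ k`. -/
def halveCard : ℕ → Expr
  | 0 => .var 1
  | k + 1 => halveCard k >>> .lit 1

/-- Comparing `n` with the literal 2^ν would be wrong if 2^ν does not fit into a word; `ν` shifts by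
one decide the same question for every word size. -/
theorem ev_halveCard {w n : ℕ} {D : List Bool} {env : Fin 8 → BitVec w} (hw : 1 ≤ w)
    (hn : n < 2 ^ w) (hcard : env 1 = BitVec.ofNat w n) (k : ℕ) :
    Ev D env (halveCard k) (n / 2 ^ k) := by
  induction k with
  | zero => exact (Ev.var_ofNat hcard hn).congr (by simp)
  | succ k ih =>
    exact (ih.shiftRight (.lit_one hw)).congr (by rw [Nat.div_div_eq_div_mul, pow_one, pow_succ])

/-- Continue with `large` if `n ≥ 2 ^ ν` and with `small` otherwise. -/
def splitCard (ν : ℕ) (large small : Prog) : Prog := ifLt (.lit 0) (halveCard ν) large small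

theorem Runs.splitCard {w n m q ν : ℕ} {D : List Bool} {large small : Prog} {σ : State w} {T : ℝ}
    {Q : State w → Prop} (hw : 1 ≤ w) (hn : n < 2 ^ w) (hσ : Ready n m q σ)
    (hl : 2 ^ ν ≤ n → ∀ σ', Ready n m q σ' → Runs D large σ' T Q)
    (hs : n < 2 ^ ν → ∀ σ', Ready n m q σ' → Runs D small σ' T Q) :
    Runs D (splitCard ν large small) σ ((halveCard ν).cost + 2 + T) Q := by
  have h0 : Ev D σ.env (.lit 0) 0 := .lit_zero
  have h1 := ev_halveCard (D := D) hw hn hσ.card ν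
  have hr : Runs D (WordRAM.splitCard ν large small) σ
      ((Expr.lit 0).cost + (halveCard ν).cost + 1 + T) Q := by
    refine Runs.ifLt (fun h σ' f => hl ?_ _ (hσ.of_eqOff f)) fun h σ' f => hs ?_ _ (hσ.of_eqOff f)
    · rw [h0, h1, Nat.div_pos_iff] at h
      exact h.2
    · rw [h0, h1, Nat.div_pos_iff] at h
      by_contra hn
      exact h ⟨by positivity, by omega⟩
  refine hr.mono (le_of_eq ?_) fun _ h => h
  simp only [Expr.cost]
  push_cast
  ring

theorem runs_assign_of_ev {w : ℕ} {D : List Bool} {e : Expr} {σ : State w} {v : ℕ} {T : ℝ}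
    {Q : State w → Prop} (he : Ev D σ.env e v) (hT : (e.cost : ℝ) + 1 ≤ T)
    (hQ : ∀ σ', (σ'.reg 0).toNat = v → Q σ') : Runs D (assign 0 e) σ T Q := by
  refine (runs_assign D 0 e σ).mono hT fun σ' h => hQ _ ?_
  rw [h.1]
  exact he

end WordRAM

/-! ### Dictionaries from approximate ranks in the auxiliary set -/

namespace WordRAM

/-- `p` puts into the variable `7` an approximation from below of the number of elements of `Z`
below the value of `φ`. -/
def IsLookup {w : ℕ} (D : List Bool) (m : ℕ) (X Z : Finset ℕ) (lk : Expr → Prog) (φ : Expr)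
    (T : ℝ) : Prop :=
  ∀ (q y : ℕ) (σ : State w), Ready X.card m q σ → Ev D σ.env φ y → y ∈ Icc 1 m →
    Runs D (lk φ) σ T fun σ' => (σ'.env 7).toNat ≤ Z.countBelow y ∧
      Z.countBelow y ≤ (σ'.env 7).toNat + 3 ∧ HasParams X.card m σ'.env ∧
      σ'.env 0 = BitVec.ofNat w q

/-- The bound in the auxiliary set that corresponds to the query `rank`. -/
def rankBound : Expr := .lit 1 + .var 0 / .lit 2

/-- The bound in the auxiliary set that corresponds to the query `select` for zeros. -/
def zeroBound : Expr := .var 2 / .lit 2 + .lit 2 + (.var 0 - .lit 1) / .lit 2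

def rankProg (ν : ℕ) (lk : Expr → Prog) : Bool → Prog
  | true => splitCard ν (.seq (lk rankBound) (assign 0 (rankExpr (.var 0))))
      (assign 0 (plainRank (2 ^ ν) (.var 0)))
  | false => splitCard ν (.seq (lk rankBound) (assign 0 (.var 0 - rankExpr (.var 0))))
      (assign 0 (.var 0 - plainRank (2 ^ ν) (.var 0)))

def selectProg (ν : ℕ) (lk : Expr → Prog) : Bool → Prog
  | true => splitCard ν (assign 0 (eltExpr (.var 0 - .lit 1)))
      (assign 0 (plainElt (.var 0 - .lit 1)))
  | false => splitCard ν
      (.seq (lk zeroBound) (assign 0 (.var 0 + zeroRankExpr (.var 0 - .lit 1))))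
      (assign 0 (.var 0 + plainZeroRank (2 ^ ν) (.var 0)))

/-- A bound for the time of the queries, apart from lookups. -/
def queryCost (ν : ℕ) : ℕ := (halveCard ν).cost + 2 +
  ((rankExpr (.var 0)).cost + (plainRank (2 ^ ν) (.var 0)).cost +
  (Expr.var 0 - rankExpr (.var 0)).cost + (Expr.var 0 - plainRank (2 ^ ν) (.var 0)).cost +
  (eltExpr (.var 0 - .lit 1)).cost + (plainElt (.var 0 - .lit 1)).cost +
  (Expr.var 0 + zeroRankExpr (.var 0 - .lit 1)).cost +
  (Expr.var 0 + plainZeroRank (2 ^ ν) (.var 0)).cost + 1)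

/-- The data `D` can be used for answering queries about `X` in the time `K` for lookups. -/
structure IsDictData (w : ℕ) (D : List Bool) (m : ℕ) (X : Finset ℕ) (ν : ℕ) (lk : Expr → Prog)
    (K : ℝ) : Prop where
  small : X.card < 2 ^ ν → D = verbatim m X
  large : 2 ^ ν ≤ X.card → ∃ p Z flag,
    (∀ env : Fin 8 → BitVec w, HasParams X.card m env → SetContext D env m X p Z flag) ∧
    IsLookup (w := w) D m X Z lk rankBound K ∧ IsLookup (w := w) D m X Z lk zeroBound K

section

variable {w : ℕ} {D : List Bool} {m : ℕ} {X : Finset ℕ} {ν : ℕ} {lk : Expr → Prog} {K : ℝ}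

theorem runs_rank (hw : m.size ≤ w) (hm : 1 ≤ m) (hX : X ⊆ Icc 1 m) (hK : 0 ≤ K)
    (h : IsDictData w D m X ν lk K) (b : Bool) {i : ℕ} (hi : i ≤ m) :
    Answers w X.card m D (rankProg ν lk b) i (queryCost ν + K) fun r _ => r = rank X b i := by
  have hw1 : 1 ≤ w := le_trans (Nat.size_pos.2 hm) hw
  have hc := card_lt_of_size_le hX hw
  have hu : m < 2 ^ w :=
    lt_of_lt_of_le (Nat.lt_size_self m) (Nat.pow_le_pow_right (by norm_num) hw)
  have h2w := two_mul_le_two_pow hw1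
  have hadd := rank_false_add (X := X) i
  have hrt := rank_true_eq hX i
  refine answers_of_runs fun σ hσ => ?_
  have hlarge (hν : 2 ^ ν ≤ X.card) : ∀ σ' : State w, Ready X.card m i σ' →
      Runs D (lk rankBound) σ' K fun τ => Ev D τ.env (rankExpr (.var 0)) (rank X true i) ∧
        Ev D τ.env (.var 0) i := by
    intro σ' hσ'
    obtain ⟨p, Z, flag, hctx, hlk, -⟩ := h.large hν
    have hc' := hctx σ'.env hσ'.toHasParams
    have hic := hc'.toIndexContext
    have hn3 : 4 ≤ X.card := by
      have := hc'.large
      by_contra hn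
      have := Nat.size_le_size (show X.card ≤ 3 by omega)
      have h3 : Nat.size 3 = 2 := by decide
      omega
    have hnm := card_le_of_subset hX
    have e0 : Ev D σ'.env (.var 0) i := .var_ofNat hσ'.query (by omega)
    have e1 : Ev D σ'.env rankBound (1 + i / 2) :=
      (Ev.lit_one hw1).add (e0.div (hic.ev_lit (by norm_num))) (by omega)
    refine (hlk i _ σ' hσ' e1 (mem_Icc.2 ⟨by omega, by omega⟩)).mono le_rfl fun τ hτ => ?_
    have e0' : Ev D τ.env (.var 0) i := .var_ofNat hτ.2.2.2 (by omega)
    exact ⟨by rw [hrt]; exact (hctx τ.env hτ.2.2.1).ev_rank e0' rfl hτ.1 hτ.2.1, e0'⟩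
  have hsmall (hν : X.card < 2 ^ ν) : ∀ σ' : State w, Ready X.card m i σ' →
      Ev D σ'.env (plainRank (2 ^ ν) (.var 0)) (rank X true i) ∧ Ev D σ'.env (.var 0) i := by
    intro σ' hσ'
    have e0 : Ev D σ'.env (.var 0) i := .var_ofNat hσ'.query (by omega)
    refine ⟨?_, e0⟩
    rw [hrt]
    rw [h.small hν] at e0 ⊢
    exact ev_plainRank hσ'.toHasParams hX hw hw1 e0 hν
  cases b with
  | true =>
    refine (Runs.splitCard (T := K + (((rankExpr (.var 0)).cost : ℝ) + 1 +
      ((plainRank (2 ^ ν) (.var 0)).cost + 1))) hw1 hc hσ (fun hν σ' hσ' => ?_)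
      fun hν σ' hσ' => ?_).mono ?_ fun _ h => h
    · refine ((hlarge hν σ' hσ').seq fun τ hτ =>
        runs_assign_of_ev hτ.1 le_rfl fun _ h => h).mono ?_ fun _ h => h
      have : (0 : ℝ) ≤ (plainRank (2 ^ ν) (.var 0)).cost := by positivity
      linarith
    · refine runs_assign_of_ev (hsmall hν σ' hσ').1 ?_ fun _ h => h
      have : (0 : ℝ) ≤ (rankExpr (.var 0)).cost := by positivity
      linarith
    · unfold queryCost
      push_cast
      have h1 : (1 : ℝ) ≤ (eltExpr (.var 0 - .lit 1)).cost := by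
        exact_mod_cast Nat.le_add_left 1 _
      linarith [show (0 : ℝ) ≤ (Expr.var 0 - rankExpr (.var 0)).cost by positivity,
        show (0 : ℝ) ≤ (Expr.var 0 - plainRank (2 ^ ν) (.var 0)).cost by positivity,
        show (0 : ℝ) ≤ (plainElt (.var 0 - .lit 1)).cost by positivity,
        show (0 : ℝ) ≤ (Expr.var 0 + zeroRankExpr (.var 0 - .lit 1)).cost by positivity,
        show (0 : ℝ) ≤ (Expr.var 0 + plainZeroRank (2 ^ ν) (.var 0)).cost by positivity]
  | false =>
    refine (Runs.splitCard (T := K + (((Expr.var 0 - rankExpr (.var 0)).cost : ℝ) + 1 +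
      ((Expr.var 0 - plainRank (2 ^ ν) (.var 0)).cost + 1))) hw1 hc hσ (fun hν σ' hσ' => ?_)
      fun hν σ' hσ' => ?_).mono ?_ fun _ h => h
    · refine ((hlarge hν σ' hσ').seq fun τ hτ =>
        runs_assign_of_ev (hτ.2.sub hτ.1 (by omega)) le_rfl fun _ h => ?_).mono ?_ fun _ h => h
      · rw [h]
        omega
      · have : (0 : ℝ) ≤ (Expr.var 0 - plainRank (2 ^ ν) (.var 0)).cost := by positivity
        linarith
    · have hs := hsmall hν σ' hσ'
      refine runs_assign_of_ev (hs.2.sub hs.1 (by omega)) ?_ fun _ h => ?_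
      · have : (0 : ℝ) ≤ (Expr.var 0 - rankExpr (.var 0)).cost := by positivity
        linarith
      · rw [h]
        omega
    · unfold queryCost
      push_cast
      have h1 : (1 : ℝ) ≤ (eltExpr (.var 0 - .lit 1)).cost := by
        exact_mod_cast Nat.le_add_left 1 _
      linarith [show (0 : ℝ) ≤ (rankExpr (.var 0)).cost by positivity,
        show (0 : ℝ) ≤ (plainRank (2 ^ ν) (.var 0)).cost by positivity,
        show (0 : ℝ) ≤ (plainElt (.var 0 - .lit 1)).cost by positivity,
        show (0 : ℝ) ≤ (Expr.var 0 + zeroRankExpr (.var 0 - .lit 1)).cost by positivity,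
        show (0 : ℝ) ≤ (Expr.var 0 + plainZeroRank (2 ^ ν) (.var 0)).cost by positivity]

theorem runs_select_true (hw : m.size ≤ w) (hm : 1 ≤ m) (hX : X ⊆ Icc 1 m)
    (h : IsDictData w D m X ν lk K) {i : ℕ} (hi : 1 ≤ i) (hi' : i ≤ rank X true m) :
    Answers w X.card m D (selectProg ν lk true) i (queryCost ν) fun p _ =>
      IsSelect m X true i p := by
  have hw1 : 1 ≤ w := le_trans (Nat.size_pos.2 hm) hw
  have hc := card_lt_of_size_le hX hw
  rw [rank_true_top hX] at hi'
  refine answers_of_runs fun σ hσ => ?_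
  refine (Runs.splitCard (T := ((eltExpr (.var 0 - .lit 1)).cost : ℝ) + 1 +
      (plainElt (.var 0 - .lit 1)).cost) hw1 hc hσ (fun hν σ' hσ' => ?_)
      fun hν σ' hσ' => ?_).mono ?_ fun _ h => h
  · obtain ⟨p, Z, flag, hctx, -, -⟩ := h.large hν
    have e0 : Ev D σ'.env (.var 0) i := .var_ofNat hσ'.query (by omega)
    refine runs_assign_of_ev ((hctx _ hσ'.toHasParams).ev_elt (e0.sub (.lit_one hw1) hi)
      (by omega)) ?_ fun _ h => ?_
    · linarith [show (0 : ℝ) ≤ (plainElt (.var 0 - .lit 1)).cost by positivity]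
    · rw [h]
      exact isSelect_true hX hi hi'
  · have e0 : Ev D σ'.env (.var 0) i := .var_ofNat hσ'.query (by omega)
    rw [h.small hν] at e0 ⊢
    refine runs_assign_of_ev (ev_plainElt hσ'.toHasParams hX hw hw1 (e0.sub (.lit_one hw1) hi)
      (by omega)) ?_ fun _ h => ?_
    · linarith [show (0 : ℝ) ≤ (eltExpr (.var 0 - .lit 1)).cost by positivity]
    · rw [h]
      exact isSelect_true hX hi hi'
  · unfold queryCost
    push_cast
    linarith [show (0 : ℝ) ≤ (rankExpr (.var 0)).cost by positivity,
      show (0 : ℝ) ≤ (plainRank (2 ^ ν) (.var 0)).cost by positivity,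
      show (0 : ℝ) ≤ (Expr.var 0 - rankExpr (.var 0)).cost by positivity,
      show (0 : ℝ) ≤ (Expr.var 0 - plainRank (2 ^ ν) (.var 0)).cost by positivity,
      show (0 : ℝ) ≤ (Expr.var 0 + zeroRankExpr (.var 0 - .lit 1)).cost by positivity,
      show (0 : ℝ) ≤ (Expr.var 0 + plainZeroRank (2 ^ ν) (.var 0)).cost by positivity]

theorem runs_select_false (hw : m.size ≤ w) (hm : 1 ≤ m) (hX : X ⊆ Icc 1 m) (hK : 0 ≤ K)
    (h : IsDictData w D m X ν lk K) {i : ℕ} (hi : 1 ≤ i) (hi' : i ≤ rank X false m) :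
    Answers w X.card m D (selectProg ν lk false) i (queryCost ν + K) fun p _ =>
      IsSelect m X false i p := by
  have hw1 : 1 ≤ w := le_trans (Nat.size_pos.2 hm) hw
  have hc := card_lt_of_size_le hX hw
  have hu : m < 2 ^ w :=
    lt_of_lt_of_le (Nat.lt_size_self m) (Nat.pow_le_pow_right (by norm_num) hw)
  have hsel := isSelect_false hX hi hi'
  have hadd := rank_false_add (X := X) m
  rw [rank_true_top hX] at hadd
  set J := ((range X.card).filter fun j => X.zerosBefore j < i).card with hJ
  have hsum : i + J ≤ m := (mem_Icc.1 hsel.1).2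
  refine answers_of_runs fun σ hσ => ?_
  refine (Runs.splitCard (T := K + (((Expr.var 0 + zeroRankExpr (.var 0 - .lit 1)).cost : ℝ) + 1 +
      (Expr.var 0 + plainZeroRank (2 ^ ν) (.var 0)).cost)) hw1 hc hσ (fun hν σ' hσ' => ?_)
      fun hν σ' hσ' => ?_).mono ?_ fun _ h => h
  · obtain ⟨p, Z, flag, hctx, -, hlk⟩ := h.large hν
    have hc' := hctx σ'.env hσ'.toHasParams
    have hic := hc'.toIndexContext
    have hn3 : 4 ≤ X.card := by
      have := hc'.large
      by_contra hn
      have := Nat.size_le_size (show X.card ≤ 3 by omega)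
      have h3 : Nat.size 3 = 2 := by decide
      omega
    have e0 : Ev D σ'.env (.var 0) i := .var_ofNat hσ'.query (by omega)
    have e2 : Ev D σ'.env (.var 2) m := .var_ofNat hσ'.univ hu
    have hl2 : Ev D σ'.env (.lit 2) 2 := hic.ev_lit (by norm_num)
    have e1 : Ev D σ'.env zeroBound (m / 2 + 2 + (i - 1) / 2) :=
      ((e2.div hl2).add hl2 (by omega)).add ((e0.sub (.lit_one hw1) hi).div hl2) (by omega)
    -- The bound is a legal query: there are m − n zeros, so i ≤ m − n, and n ≥ 4 makes up for the
    -- summand 2.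
    refine ((hlk i _ σ' hσ' e1 (mem_Icc.2 ⟨by omega, by omega⟩)).seq fun τ hτ => ?_).mono
      (T := K + (((Expr.var 0 + zeroRankExpr (.var 0 - .lit 1)).cost : ℝ) + 1)) ?_ fun _ h => h
    · have e0' : Ev D τ.env (.var 0) i := .var_ofNat hτ.2.2.2 (by omega)
      have e3 := (hctx τ.env hτ.2.2.1).ev_zeroRank (e0'.sub (.lit_one hw1) hi) rfl hτ.1 hτ.2.1
      rw [Nat.sub_add_cancel hi, ← hJ] at e3
      refine runs_assign_of_ev (e0'.add e3 (by omega)) le_rfl fun _ h => ?_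
      rw [h]
      exact hsel
    · linarith [show (0 : ℝ) ≤ (Expr.var 0 + plainZeroRank (2 ^ ν) (.var 0)).cost by positivity]
  · have e0 : Ev D σ'.env (.var 0) i := .var_ofNat hσ'.query (by omega)
    rw [h.small hν] at e0 ⊢
    have e3 := ev_plainZeroRank hσ'.toHasParams hX hw hw1 e0 hν
    refine runs_assign_of_ev (e0.add e3 (by omega)) ?_ fun _ h => ?_
    · linarith [show (0 : ℝ) ≤ (Expr.var 0 + zeroRankExpr (.var 0 - .lit 1)).cost by positivity]
    · rw [h]
      exact hsel
  · unfold queryCost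
    push_cast
    linarith [show (0 : ℝ) ≤ (rankExpr (.var 0)).cost by positivity,
      show (0 : ℝ) ≤ (plainRank (2 ^ ν) (.var 0)).cost by positivity,
      show (0 : ℝ) ≤ (Expr.var 0 - rankExpr (.var 0)).cost by positivity,
      show (0 : ℝ) ≤ (Expr.var 0 - plainRank (2 ^ ν) (.var 0)).cost by positivity,
      show (0 : ℝ) ≤ (eltExpr (.var 0 - .lit 1)).cost by positivity,
      show (0 : ℝ) ≤ (plainElt (.var 0 - .lit 1)).cost by positivity]

end

theorem hasFID_of_isDictData {w : ℕ → ℕ} (hw : ∀ m, 1 ≤ m → m.size ≤ w m) {𝒟 : Set (ℕ × ℕ)}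
    {t s : ℕ → ℕ → ℝ} {enc : ℕ → Finset ℕ → List Bool} {ν : ℕ} {lk : Expr → Prog} {K C : ℝ}
    (hK : 0 ≤ K) (hC : queryCost ν + K ≤ C) (ht : ∀ m X, IsInstance 𝒟 m X → 1 ≤ t X.card m)
    (hs : ∀ m X, IsInstance 𝒟 m X → ((enc m X).length : ℝ) ≤ s X.card m)
    (h : ∀ m X, IsInstance 𝒟 m X →
      IsDictData (w m) (enc m X) m X ν lk (K * t X.card m)) :
    HasFID w 𝒟 (fun n m => C * t n m) (fun _ _ => C) s := by
  refine ⟨enc, rankProg ν lk, selectProg ν lk, fun m X hI => ⟨hs m X hI, ?_, ?_, ?_⟩⟩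
  all_goals
    have ht1 := ht m X hI
    have hKt : 0 ≤ K * t X.card m := by positivity
    have hT : (queryCost ν : ℝ) + K * t X.card m ≤ C * t X.card m := by
      have h0 : (0 : ℝ) ≤ queryCost ν := by positivity
      nlinarith
  · intro b i hi
    exact (runs_rank (hw m hI.1) hI.1 hI.2.1 hKt (h m X hI) b (mem_Icc.1 hi).2).mono hT
  · intro i hi
    rw [mem_Icc] at hi
    exact (runs_select_false (hw m hI.1) hI.1 hI.2.1 hKt (h m X hI) hi.1 hi.2).mono hT
  · intro i hi
    rw [mem_Icc] at hi
    exact (runs_select_true (hw m hI.1) hI.1 hI.2.1 (h m X hI) hi.1 hi.2).mono (by linarith)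

end WordRAM

/-! ### Predecessors from a dictionary -/

theorem isPredecessor_of_countBelow_eq_zero {X : Finset ℕ} {y : ℕ} (h : X.countBelow y = 0) :
    IsPredecessor X y 0 0 := by
  refine Or.inr ⟨fun x hx => ?_, rfl, rfl⟩
  by_contra hlt
  have := countBelow_lt hx (not_le.1 hlt)
  omega

theorem IsSelect.isPredecessor {m : ℕ} {X : Finset ℕ} (hX : X ⊆ Icc 1 m) {y p : ℕ}
    (h : IsSelect m X true (X.countBelow y) p) : IsPredecessor X y (X.countBelow y) p := by
  obtain ⟨-, hp, hr⟩ := h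
  have hp : p ∈ X := by simpa using hp
  have hr' := hr
  rw [rank_true_eq hX] at hr
  refine Or.inl ⟨hp, ?_, fun x hx hxy => ?_, hr'.symm⟩
  · by_contra hlt
    have h1 := X.countBelow_mono (not_lt.1 hlt)
    have h2 := countBelow_lt hp (show p < p + 1 by omega)
    omega
  · by_contra hlt
    have h1 := X.countBelow_mono (show p + 1 ≤ x by omega)
    have h2 := countBelow_lt hx hxy
    omega

theorem IsPredecessor.eq_countBelow {m : ℕ} {X : Finset ℕ} (hX : X ⊆ Icc 1 m) {y j v : ℕ}
    (h : IsPredecessor X y j v) : j = X.countBelow y := by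
  rcases h with ⟨hv, hvy, hmax, rfl⟩ | ⟨hall, rfl, -⟩
  · rw [rank_true_eq hX, countBelow, countBelow]
    congr 1
    ext x
    simp only [mem_filter, Nat.lt_succ_iff]
    exact ⟨fun h => ⟨h.1, by omega⟩, fun h => ⟨h.1, hmax x h.1 h.2⟩⟩
  · rw [countBelow, filter_eq_empty_iff.2 fun x hx => by have := hall x hx; omega, card_empty]

namespace WordRAM

theorem simulates_probe {w : ℕ} (D : List Bool) (env : Fin 8 → BitVec w) :
    Simulates D D (.probe (.var 5)) env := fun a => by simp [Expr.eval]

theorem HasParams.congr {w n m : ℕ} {env env' : Fin 8 → BitVec w} (h : HasParams n m env)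
    (he : ∀ i : Fin 8, i ≠ 0 → i < 5 → env' i = env i) : HasParams n m env' :=
  ⟨(he 1 (by decide) (by decide)).trans h.card, (he 2 (by decide) (by decide)).trans h.univ,
    (he 3 (by decide) (by decide)).trans h.word, (he 4 (by decide) (by decide)).trans h.size⟩

theorem ClassClear.of_eqOff {w c : ℕ} (hc : c = 1 ∨ c = 2) {σ τ : State w}
    (h : ClassClear c σ) (f : EqOff (tempRegs 8) σ τ) : ClassClear c τ := by
  intro r
  rw [f.2, h]
  rintro ⟨j, -, h⟩
  exact classReg_ne_varReg hc h

/-- Predecessor queries by means of `rank` and `select` for ones. -/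
def predProg (rk sel : Prog) : Prog :=
  .seq (call 1 (.probe (.var 5)) rk (.var 0 - .lit 1) 6)
    (ifLt (.lit 0) (.var 6)
      (.seq (call 2 (.probe (.var 5)) sel (.var 6) 7)
        (.seq (assign 0 (.var 6)) (assign 1 (.var 7))))
      (.seq (assign 0 (.lit 0)) (assign 1 (.lit 0))))

theorem runs_assign_pair {w : ℕ} (D : List Bool) (a b : Expr) {j v : ℕ} {σ : State w}
    (ha : Ev D σ.env a j) (hb : ∀ env, (∀ i, i ≠ 0 → env i = σ.env i) → Ev D env b v) :
    Runs D (.seq (assign 0 a) (assign 1 b)) σ (a.cost + 1 + (b.cost + 1)) fun σ' =>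
      (σ'.reg 0).toNat = j ∧ (σ'.reg 1).toNat = v := by
  refine (runs_assign D 0 a σ).seq fun σ₁ h₁ => (runs_assign D 1 b σ₁).mono le_rfl fun σ₂ h₂ => ?_
  constructor
  · rw [h₂.2.2 0, h₁.1]
    · exact ha
    · rintro (h | h)
      · exact absurd h (by norm_num)
      · rw [show (0 : ℕ) = varReg 0 from rfl, varReg_mem_tempRegs] at h
        omega
  · rw [h₂.1]
    refine hb _ fun i hi => h₁.2.2 _ ?_
    rintro (h | h)
    · rw [show (0 : ℕ) = varReg 0 from rfl, varReg_inj] at h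
      exact hi (Fin.ext h)
    · rw [varReg_mem_tempRegs] at h
      omega

/-- The number of elements below `y` is the rank of y − 1. It is the index of the predecessor and,
if positive, a legal argument of select; otherwise there is no predecessor. -/
theorem answers_predProg {w m : ℕ} (hw : m.size ≤ w) {D : List Bool} {X : Finset ℕ}
    (hX : X ⊆ Icc 1 m) {rk sel : Prog} {t : ℝ}
    (hrk : ∀ i ∈ Icc 0 m, Answers w X.card m D rk i t fun r _ => r = rank X true i)
    (hsel : ∀ i ∈ Icc 1 (rank X true m),
      Answers w X.card m D sel i t fun p _ => IsSelect m X true i p) {y : ℕ} (hy : y ∈ Icc 1 m) :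
    Answers w X.card m D (predProg rk sel) y (60 * t) (IsPredecessor X y) := by
  rw [mem_Icc] at hy
  have hw1 : 1 ≤ w := le_trans (Nat.size_pos.2 (by omega)) hw
  have hu : m < 2 ^ w :=
    lt_of_lt_of_le (Nat.lt_size_self m) (Nat.pow_le_pow_right (by norm_num) hw)
  have hc := card_lt_of_size_le hX hw
  have ha := hrk (y - 1) (mem_Icc.2 ⟨by omega, by omega⟩)
  have ht := ha.one_le
  rw [rank_true_eq hX, Nat.sub_add_cancel hy.1] at ha
  have hle := X.countBelow_le y
  refine answers_of_runs fun σ hσ => ?_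
  have e0 : Ev D σ.env (.var 0) y := .var_ofNat hσ.query (by omega)
  have r1 := runs_call (c := 1) (Or.inl rfl) (out := 6) hσ.toHasParams hσ.clear_one
    (e0.sub (.lit_one hw1) hy.1).eval_eq (simulates_probe D σ.env) ha
  refine (r1.seq (T₂ := 38 * t) (Q₂ := fun σ' =>
    IsPredecessor X y (σ'.reg 0).toNat (σ'.reg 1).toNat) fun σ₁ h₁ => ?_).mono ?_ fun _ h => h
  · obtain ⟨⟨-, h6⟩, hsame, hclear⟩ := h₁
    have hpar : HasParams X.card m σ₁.env := hσ.toHasParams.congr fun i hi hi' =>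
      hsame i (by omega) (by omega)
    have hcl := hclear 2 (Or.inr rfl) (by norm_num) hσ.clear_two
    have e6 : Ev D σ₁.env (.var 6) (X.countBelow y) := h6
    refine (Runs.ifLt (T := 30 * t) (fun hlt σ₂ f => ?_) fun hge σ₂ f => ?_).mono ?_ fun _ h => h
    · rw [Ev.lit_zero, e6] at hlt
      rw [← f.env_eq le_rfl] at e6 hpar
      have hs := hsel (X.countBelow y) (mem_Icc.2 ⟨hlt, by rwa [rank_true_top hX]⟩)
      have r2 := runs_call (c := 2) (Or.inr rfl) (out := 7) hpar
        (hcl.of_eqOff (Or.inr rfl) f) e6.eval_eq (simulates_probe D σ₂.env) hs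
      refine (r2.seq (T₂ := 4 * t) fun σ₃ h₃ => ?_).mono ?_ fun _ h => h
      · obtain ⟨⟨-, h7⟩, hsame, -⟩ := h₃
        have e6' : Ev D σ₃.env (.var 6) (X.countBelow y) := by
          refine Ev.var ?_
          rw [hsame 6 (by decide) (by decide)]
          exact e6
        refine (runs_assign_pair D (.var 6) (.var 7) (v := (σ₃.env 7).toNat) e6'
          fun env he => ?_).mono ?_ fun σ' h => ?_
        · refine Ev.var ?_
          rw [he 7 (by decide)]
        · simp only [Expr.cost]
          push_cast
          linarith
        · rw [h.1, h.2]
          exact h7.isPredecessor hX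
      · simp only [Expr.cost]
        push_cast
        linarith
    · rw [Ev.lit_zero, e6] at hge
      refine (runs_assign_pair D (.lit 0) (.lit 0) .lit_zero fun _ _ => .lit_zero).mono ?_
        fun σ' h => ?_
      · simp only [Expr.cost]
        push_cast
        linarith
      · rw [h.1, h.2]
        exact isPredecessor_of_countBelow_eq_zero (by omega)
    · simp only [Expr.cost]
      push_cast
      linarith
  · have : (Expr.var 0 - Expr.lit 1).cost = 3 := rfl
    simp only [this, Expr.cost]
    push_cast
    linarith

end WordRAM

theorem HasFID.hasPRED {w : ℕ → ℕ} (hw : ∀ m, 1 ≤ m → m.size ≤ w m) {𝒟 : Set (ℕ × ℕ)}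
    {t s : ℕ → ℕ → ℝ} (h : HasFID w 𝒟 t t s) {C : ℝ} (hC : 60 ≤ C) :
    HasPRED w 𝒟 (fun n m => C * t n m) s := by
  obtain ⟨enc, rk, sel, h⟩ := h
  refine ⟨enc, WordRAM.predProg (rk true) (sel true), fun m X hI => ?_⟩
  obtain ⟨hs, h1, -, h3⟩ := h m X hI
  refine ⟨hs, fun y hy => ?_⟩
  have ht := (h1 true 0 (mem_Icc.2 ⟨le_rfl, by omega⟩)).one_le
  exact (WordRAM.answers_predProg (hw m hI.1) hI.2.1 (h1 true) h3 hy).mono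
    (mul_le_mul_of_nonneg_right hC (by linarith))

/-! ### Bounds for the space -/

/-- This is (m/n)^n ≤ binom(m, n). The induction uses (n+1) · binom(M+1, n+1) = (M+1) · binom(M, n)
and (M+1)/(n+1) ≤ M/n for n ≤ M. -/
theorem pow_self_le_choose_mul (n : ℕ) {m : ℕ} (h : n ≤ m) : m ^ n ≤ m.choose n * n ^ n := by
  induction n generalizing m with
  | zero => simp
  | succ n ih =>
    obtain ⟨M, rfl⟩ : ∃ M, m = M + 1 := ⟨m - 1, by omega⟩
    rw [pow_succ (n + 1), ← mul_assoc, mul_right_comm, ← Nat.add_one_mul_choose_eq, pow_succ,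
      mul_comm, mul_assoc]
    refine Nat.mul_le_mul_left _ ?_
    rcases Nat.eq_zero_or_pos n with rfl | hn
    · simp
    refine Nat.le_of_mul_le_mul_right (c := n ^ n) ?_ (by positivity)
    calc (M + 1) ^ n * n ^ n = ((M + 1) * n) ^ n := by rw [mul_pow]
      _ ≤ (M * (n + 1)) ^ n := Nat.pow_le_pow_left (by nlinarith) n
      _ = M ^ n * (n + 1) ^ n := by rw [mul_pow]
      _ ≤ (M.choose n * n ^ n) * (n + 1) ^ n := Nat.mul_le_mul_right _ (ih (by omega))
      _ = M.choose n * (n + 1) ^ n * n ^ n := by ring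

theorem mul_logb_sub_le_logb_choose {n m : ℕ} (h : n ≤ m) :
    n * Real.logb 2 m - n * Real.logb 2 n ≤ Real.logb 2 (m.choose n) := by
  rcases Nat.eq_zero_or_pos n with rfl | hn
  · simp
  have hc : 0 < m.choose n := Nat.choose_pos h
  have h1 : Real.logb 2 ((m : ℝ) ^ n) ≤ Real.logb 2 ((m.choose n : ℝ) * (n : ℝ) ^ n) :=
    Real.logb_le_logb_of_le (by norm_num) (by have : 0 < m := by omega
                                              positivity)
      (by exact_mod_cast pow_self_le_choose_mul n h)
  rw [Real.logb_pow, Real.logb_mul (by positivity) (by positivity), Real.logb_pow] at h1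
  linarith

theorem size_le_logb_add_one {m : ℕ} (hm : 1 ≤ m) : (m.size : ℝ) ≤ Real.logb 2 m + 1 := by
  have h1 : 2 ^ (m.size - 1) ≤ m := Nat.lt_size.1 (by have := Nat.size_pos.2 hm; omega)
  have h2 : ((m.size - 1 : ℕ) : ℝ) ≤ Real.logb 2 m := by
    rw [Real.le_logb_iff_rpow_le (by norm_num) (by positivity), Real.rpow_natCast]
    exact_mod_cast h1
  have h3 := Nat.size_pos.2 hm
  push_cast [Nat.cast_sub h3] at h2
  linarith

theorem logb_le_size (n : ℕ) : Real.logb 2 n ≤ n.size := by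
  rcases Nat.eq_zero_or_pos n with rfl | hn
  · simp
  rw [Real.logb_le_iff_le_rpow (by norm_num) (by positivity), Real.rpow_natCast]
  exact_mod_cast (Nat.lt_size_self n).le

/-- Rounding log m up to size m costs at most one bit per element, while size n is at least log n;
this turns 93n into 94n. -/
theorem indexLen_le_logb {m n : ℕ} (hm : 1 ≤ m) (h : n ≤ m) :
    (indexLen m n : ℝ) ≤ n * Real.logb 2 m - n * Real.logb 2 n + 94 * n := by
  have h1 := size_le_logb_add_one hm
  have h2 := logb_le_size n
  have h3 := Nat.size_le_size h
  rw [indexLen]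
  push_cast [Nat.cast_sub h3]
  nlinarith [show (0 : ℝ) ≤ n by positivity]

theorem indexLen_le_two_pow {m n : ℕ} (h : n ≤ m) : indexLen m n ≤ 94 * 2 ^ m.size := by
  have h3 := Nat.size_le_size h
  have h1 := (Nat.lt_size_self n).le
  set l := m.size - n.size with hl
  have h2 : l < 2 ^ l := Nat.lt_two_pow_self
  calc indexLen m n = n * (93 + l) := by rw [indexLen, ← hl]; ring
    _ ≤ 2 ^ n.size * (94 * 2 ^ l) := Nat.mul_le_mul h1 (by omega)
    _ = 94 * 2 ^ (n.size + l) := by ring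
    _ = 94 * 2 ^ m.size := by rw [show n.size + l = m.size by omega]

/-! ### Counting bit strings -/

/-- The number with the binary digits `l`, with a leading digit one. -/
def List.code : List Bool → ℕ
  | [] => 1
  | b :: l => 2 * l.code + b.toNat

theorem List.code_pos (l : List Bool) : 1 ≤ l.code := by
  induction l with
  | nil => exact le_rfl
  | cons b l ih =>
    rw [List.code]
    omega

theorem List.code_lt (l : List Bool) : l.code < 2 ^ (l.length + 1) := by
  induction l with
  | nil => norm_num [List.code]
  | cons b l ih =>
    rw [List.code, List.length_cons, pow_succ]
    have := Bool.toNat_le b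
    omega

theorem List.code_injective : Function.Injective List.code := by
  intro l
  induction l with
  | nil =>
    intro l' h
    cases l' with
    | nil => rfl
    | cons b l' =>
      have := l'.code_pos
      simp only [List.code] at h
      omega
  | cons b l ih =>
    intro l' h
    cases l' with
    | nil =>
      have := l.code_pos
      simp only [List.code] at h
      omega
    | cons b' l' =>
      simp only [List.code] at h
      have h1 := Bool.toNat_le b
      have h2 := Bool.toNat_le b'
      have h3 : b.toNat = b'.toNat := by omega
      rw [ih (show l.code = l'.code by omega), show b = b' by cases b <;> cases b' <;> simp_all]

/-- A number belongs to the set if and only if the count increases there. For `m` itself this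
involves the count below m + 1, which is not a legal query but is the common cardinality. -/
theorem Finset.eq_of_countBelow_eq {m : ℕ} {X Y : Finset ℕ} (hX : X ⊆ Icc 1 m) (hY : Y ⊆ Icc 1 m)
    (hc : X.card = Y.card) (h : ∀ y ∈ Icc 1 m, X.countBelow y = Y.countBelow y) : X = Y := by
  have key {X Y : Finset ℕ} (hX : X ⊆ Icc 1 m) (hY : Y ⊆ Icc 1 m) (hc : X.card = Y.card)
      (h : ∀ y ∈ Icc 1 m, X.countBelow y = Y.countBelow y) {x : ℕ} (hx : x ∈ X) : x ∈ Y := by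
    have htop {S : Finset ℕ} (hS : S ⊆ Icc 1 m) : S.countBelow (m + 1) = S.card := by
      rw [countBelow, filter_true_of_mem fun x hx => by have := mem_Icc.1 (hS hx); omega]
    have hall : ∀ y, 1 ≤ y → y ≤ m + 1 → X.countBelow y = Y.countBelow y := by
      intro y h1 h2
      rcases Nat.lt_or_ge m y with h3 | h3
      · rw [show y = m + 1 by omega, htop hX, htop hY, hc]
      · exact h y (mem_Icc.2 ⟨h1, h3⟩)
    have hx' := mem_Icc.1 (hX hx)
    have h1 := countBelow_lt hx (show x < x + 1 by omega)
    rw [hall x (by omega) (by omega), hall (x + 1) (by omega) (by omega)] at h1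
    by_contra hn
    refine absurd h1 (not_lt.2 (le_of_eq ?_))
    rw [countBelow, countBelow]
    congr 1
    ext z
    simp only [mem_filter]
    refine ⟨fun h => ⟨h.1, ?_⟩, fun h => ⟨h.1, by omega⟩⟩
    have : z ≠ x := fun hz => hn (hz ▸ h.1)
    omega
  exact Subset.antisymm (fun x hx => key hX hY hc h hx)
    fun x hx => key hY hX hc.symm (fun y hy => (h y hy).symm) hx

theorem WordRAM.Answers.exists_common {w n m q : ℕ} {D : List Bool} {p : Prog} {t t' : ℝ}
    {ans ans' : ℕ → ℕ → Prop} (h : Answers w n m D p q t ans) (h' : Answers w n m D p q t' ans') :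
    ∃ a b, ans a b ∧ ans' a b := by
  obtain ⟨σ, k, h, -, ha⟩ := h fun _ => 0
  obtain ⟨σ', k', h', -, ha'⟩ := h' fun _ => 0
  obtain rfl := h.deterministic h'
  exact ⟨_, _, ha, ha'⟩

section

variable {w : ℕ → ℕ} {𝒟 : Set (ℕ × ℕ)} {t s : ℕ → ℕ → ℝ} {enc : ℕ → Finset ℕ → List Bool}
  {pred : WordRAM.Prog}

theorem IsPRED.injOn (h : IsPRED w 𝒟 t s enc pred) {m : ℕ} {X Y : Finset ℕ}
    (hX : IsInstance 𝒟 m X) (hY : IsInstance 𝒟 m Y) (hc : X.card = Y.card)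
    (he : enc m X = enc m Y) : X = Y := by
  refine eq_of_countBelow_eq hX.2.1 hY.2.1 hc fun y hy => ?_
  have h1 := (h m X hX).2 y hy
  have h2 := (h m Y hY).2 y hy
  rw [← he, ← hc] at h2
  obtain ⟨j, v, h3, h4⟩ := h1.exists_common h2
  rw [← h3.eq_countBelow hX.2.1, h4.eq_countBelow hY.2.1]

/-- Equal encodings give equal answers by determinism, so the encoding is injective on the subsets
of the same size. There are fewer than 2^(⌊s⌋ + 1) bit strings of length at most `s`, of all lengths
together, which costs the additional bit. -/
theorem IsPRED.logb_choose_le (h : IsPRED w 𝒟 t s enc pred) {m : ℕ} {X : Finset ℕ}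
    (hX : IsInstance 𝒟 m X) : Real.logb 2 (m.choose X.card) ≤ s X.card m + 1 := by
  have hinst : ∀ Y ∈ powersetCard X.card (Icc 1 m), IsInstance 𝒟 m Y ∧ Y.card = X.card := by
    intro Y hY
    rw [mem_powersetCard] at hY
    exact ⟨⟨hX.1, hY.1, by rw [hY.2]; exact hX.2.2⟩, hY.2⟩
  have hs : 0 ≤ s X.card m := le_trans (by positivity) (h m X hX).1
  have hle : (powersetCard X.card (Icc 1 m)).card ≤ (range (2 ^ (⌊s X.card m⌋₊ + 1))).card := by
    refine card_le_card_of_injOn (fun Y => (enc m Y).code) (fun Y hY => ?_) fun Y hY Y' hY' he => ?_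
    · obtain ⟨h1, h2⟩ := hinst Y hY
      have h3 := (h m Y h1).1
      rw [h2] at h3
      exact mem_coe.2 (mem_range.2 (lt_of_lt_of_le (List.code_lt _)
        (Nat.pow_le_pow_right (by norm_num) (Nat.succ_le_succ (Nat.le_floor h3)))))
    · exact h.injOn (hinst Y hY).1 (hinst Y' hY').1 ((hinst Y hY).2.trans (hinst Y' hY').2.symm)
        (List.code_injective he)
  rw [card_powersetCard, Nat.card_Icc, card_range, Nat.add_sub_cancel] at hle
  have hpos : 0 < m.choose X.card := Nat.choose_pos (card_le_of_subset hX.2.1)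
  have h1 : Real.logb 2 (m.choose X.card) ≤ (⌊s X.card m⌋₊ + 1 : ℕ) := by
    rw [Real.logb_le_iff_le_rpow (by norm_num) (by exact_mod_cast hpos), Real.rpow_natCast]
    exact_mod_cast hle
  push_cast at h1
  linarith [Nat.floor_le hs]

theorem IsPRED.one_le (h : IsPRED w 𝒟 t s enc pred) {m : ℕ} {X : Finset ℕ}
    (hX : IsInstance 𝒟 m X) : 1 ≤ t X.card m :=
  ((h m X hX).2 1 (mem_Icc.2 ⟨le_rfl, hX.1⟩)).one_le

end

/-! ### Dictionaries from predecessor structures -/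

namespace WordRAM

/-- The position of the end of the index. -/
def endPos : PosExpr := secPos 93 + .mul (.var 1) lowLen

theorem exists_setContext {w m : ℕ} {X : Finset ℕ} (hX : X ⊆ Icc 1 m) (hw : m.size ≤ w)
    {ν : ℕ} (hν : 1024 ≤ ν) (hn : 2 ^ ν ≤ X.card) {p : ℕ} {Z : Finset ℕ}
    (hZ : IsAux m X p Z) {flag : ℕ} (hflag : flag ≤ 1) :
    ∃ A : List Bool, A.length = indexLen m X.card ∧ ∀ (E : List Bool) (env : Fin 8 → BitVec w),
      HasParams X.card m env → SetContext (A ++ E) env m X p Z flag := by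
  have hpar := seqParams_of_le hν hn
  obtain ⟨A, hA, h⟩ := exists_hasIndex (Z := Z) hX hpar hZ.le hflag
  have hlarge : 200 ≤ X.card.size := by
    by_contra hlt
    have h1 := Nat.size_le.1 (show X.card.size ≤ 200 by omega)
    have h2 : 2 ^ 200 ≤ 2 ^ ν := Nat.pow_le_pow_right (by norm_num) (by omega)
    omega
  have hsz := Nat.size_le_size (card_le_of_subset hX)
  refine ⟨A, hA, fun E env henv => ⟨henv, hX, hZ, h _ fun i hi => ?_, hw, hlarge, hpar, ?_⟩⟩
  · exact List.getD_append _ _ _ _ hi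
  · calc indexLen m X.card ≤ 94 * 2 ^ m.size := indexLen_le_two_pow (card_le_of_subset hX)
      _ ≤ w * 2 ^ w := Nat.mul_le_mul (by omega) (Nat.pow_le_pow_right (by norm_num) hw)

theorem HasParams.update {w n m : ℕ} {env : Fin 8 → BitVec w} (h : HasParams n m env)
    (a : BitVec w) : HasParams n m (Function.update env 5 a) :=
  h.congr fun i _ hi => Function.update_of_ne (by omega) _ _

section

variable {w : ℕ} {D : List Bool} {env : Fin 8 → BitVec w} {m : ℕ} {X : Finset ℕ} {p : ℕ}
  {Z : Finset ℕ} {flag : ℕ}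

theorem SetContext.ev_lowLen (h : SetContext D env m X p Z flag) :
    Ev D env lowLen (m.size - X.card.size) :=
  h.toIndexContext.ev_size.sub h.toIndexContext.ev_bitLen h.toIndexContext.len_le

theorem SetContext.pos_endPos (h : SetContext D env m X p Z flag) :
    Pos D env endPos (indexLen m X.card) := by
  have hi := h.toIndexContext
  have := h.size_le
  exact .add hi.word hi.one_le_word (hi.pos_sec (by norm_num))
    (.mul hi.word hi.one_le_word hi.ev_card h.ev_lowLen (by omega))

theorem SetContext.card_le (h : SetContext D env m X p Z flag) : X.card ≤ m :=
  card_le_of_subset h.sub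

theorem SetContext.two_hundred_le (h : SetContext D env m X p Z flag) : 200 ≤ w := by
  have := h.large
  have := h.size_le
  have := Nat.size_le_size h.card_le
  omega

theorem SetContext.indexLen_le (h : SetContext D env m X p Z flag) :
    indexLen m X.card ≤ 94 * 2 ^ w :=
  (indexLen_le_two_pow h.card_le).trans
    (Nat.mul_le_mul_left _ (Nat.pow_le_pow_right (by norm_num) h.size_le))

end

/-- The word with the index in the variable `5` of data stored behind the index. -/
def restWord : Expr :=
  .ite (.var 5) (.lit 0 - .lit 1 - endPos.word) (readWord (endPos + ⟨.var 5, .lit 0⟩)) (.lit 0)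

/-- An unaligned read touches two successive words, which must not wrap around the address space.
For indices where this could happen, the space hypothesis implies that the stored structure has
already ended, so the word is zero. -/
theorem simulates_restWord {w : ℕ} {A E : List Bool} {env : Fin 8 → BitVec w} {m : ℕ}
    {X : Finset ℕ} {p : ℕ} {Z : Finset ℕ} {flag : ℕ} (hA : A.length = indexLen m X.card)
    (h : ∀ env : Fin 8 → BitVec w, HasParams X.card m env →
      SetContext (A ++ E) env m X p Z flag)
    (henv : HasParams X.card m env) (hE : indexLen m X.card + E.length ≤ w * (2 ^ w - 1)) :
    Simulates (A ++ E) E restWord env := by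
  intro a
  have hc := h _ (henv.update a)
  have hi := hc.toIndexContext
  have hw := hi.one_le_word
  have hw0 : 0 < w := hw
  have hpos := hc.pos_endPos
  have e5 : Ev (A ++ E) (Function.update env 5 a) (.var 5) a.toNat := .var (by simp)
  have hdm := Nat.div_add_mod (indexLen m X.card) w
  have hmod := Nat.mod_lt (indexLen m X.card) hw0
  set o := indexLen m X.card / w with ho
  have hpow : 0 < 2 ^ w := by positivity
  have holt : o < 2 ^ w - 1 + 1 := by
    rw [Nat.sub_add_cancel hpow, ho, Nat.div_lt_iff_lt_mul hw0]
    have := hc.indexLen_le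
    have := hc.two_hundred_le
    nlinarith
  have eo : Ev (A ++ E) (Function.update env 5 a) endPos.word o :=
    hpos.word.congr (Nat.mod_eq_of_lt (by omega))
  have em : Ev (A ++ E) (Function.update env 5 a) (.lit 0 - .lit 1) (2 ^ w - 1) :=
    (Ev.lit_zero.sub_mod (.lit_one hw)).congr (by rw [add_zero, Nat.mod_eq_of_lt (by omega)])
  have elim := em.sub eo (by omega)
  refine BitVec.eq_of_getLsbD_eq fun i hiw => ?_
  rw [getLsbD_dataWord _ _ hiw]
  change (if (Expr.eval _ _ (.var 5)).toNat < (Expr.eval _ _ (.lit 0 - .lit 1 - endPos.word)).toNat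
    then Expr.eval _ _ (readWord (endPos + ⟨.var 5, .lit 0⟩)) else Expr.eval _ _ (.lit 0)).getLsbD i
      = _
  rw [e5, elim]
  split_ifs with hlt
  · have hq : Pos (A ++ E) (Function.update env 5 a) ⟨.var 5, .lit 0⟩ (w * a.toNat) :=
      ⟨e5.congr (by rw [Nat.mul_div_cancel_left _ hw0, Nat.mod_eq_of_lt a.isLt]),
        Ev.lit_zero.congr (by rw [Nat.mul_mod_right])⟩
    have hle : w * (o + a.toNat + 2) ≤ w * 2 ^ w := Nat.mul_le_mul_left _ (by omega)
    rw [getLsbD_readWord hi.word hw (.add hi.word hw hpos hq) hiw, Nat.mod_eq_of_lt,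
      List.getD_append_right _ _ _ _ (by omega)]
    · congr 1
      rw [hA, mul_comm w]
      omega
    · simp only [mul_add] at hle
      omega
  · have hge : w * (2 ^ w - 1) ≤ w * (o + a.toNat) := Nat.mul_le_mul_left _ (by omega)
    rw [mul_add, mul_comm w a.toNat] at hge
    rw [List.getD_eq_default _ _ (by omega)]
    simp [Expr.eval]

/-- Lookups either in a predecessor structure or in a table, which are stored behind the index. -/
def structLookup (pred : Prog) (φ : Expr) : Prog :=
  ifLt (.lit 0) (scalar 3) (assign (varReg 7) (readArray endPos (.var 3) (φ / .lit 4)))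
    (call 1 restWord pred φ 7)

/-- The factor by which lookups take more time than predecessor queries. -/
def structCost (φ : Expr) : ℕ :=
  (scalar 3).cost + 3 + (readArray endPos (.var 3) (φ / .lit 4)).cost + φ.cost + restWord.cost + 12

section

variable {w m : ℕ} {D : List Bool} {X : Finset ℕ} {p : ℕ} {Z : Finset ℕ} {pred : Prog} {t : ℝ}

theorem isLookup_struct {A E : List Bool} (hA : A.length = indexLen m X.card)
    (h : ∀ env : Fin 8 → BitVec w, HasParams X.card m env → SetContext (A ++ E) env m X p Z 0)
    (hE : indexLen m X.card + E.length ≤ w * (2 ^ w - 1)) (hZ : Z ⊆ Icc 1 m)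
    (hpred : ∀ y ∈ Icc 1 m, Answers w X.card m E pred y t (IsPredecessor Z y)) (φ : Expr) :
    IsLookup (w := w) (A ++ E) m X Z (structLookup pred) φ (structCost φ * t) := by
  intro q y σ hσ hφ hy
  have ht := (hpred y hy).one_le
  have hc := h _ hσ.toHasParams
  have e3 := hc.toIndexContext.ev_scalar (c := 3) (by norm_num) hc.index.flag
  refine (Runs.ifLt (T := (φ.cost + restWord.cost + 12) * t) (fun hlt σ' f => ?_)
    fun hge σ' f => ?_).mono ?_ fun _ h => h
  · rw [Ev.lit_zero, e3] at hlt
    omega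
  · have hσ' := hσ.of_eqOff f
    rw [← f.env_eq le_rfl] at hφ
    refine (runs_call (Or.inl rfl) hσ'.toHasParams hσ'.clear_one hφ.eval_eq
      (simulates_restWord hA h hσ'.toHasParams hE) (hpred y hy)).mono le_rfl fun τ hτ => ?_
    obtain ⟨⟨v, hv⟩, hsame, -⟩ := hτ
    have := hv.eq_countBelow hZ
    refine ⟨by omega, by omega, hσ'.toHasParams.congr fun i hi hi' =>
      hsame i (by omega) (by omega), ?_⟩
    rw [hsame 0 (by decide) (by decide)]
    exact hσ'.query
  · have h1 : (0 : ℝ) ≤ (scalar 3).cost := Nat.cast_nonneg _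
    have h2 : (0 : ℝ) ≤ (readArray endPos (.var 3) (φ / .lit 4)).cost := Nat.cast_nonneg _
    unfold structCost
    simp only [show (Expr.lit 0).cost = 1 from rfl]
    push_cast
    nlinarith

/-- The table holds the counts below multiples of four. Between 4⌊y/4⌋ and `y` there are at most
three more elements, which is where the tolerance of 3 in lookups is needed. -/
theorem isLookup_table {A : List Bool} {B : ℕ → Bool} (hA : A.length = indexLen m X.card)
    (hB : ∀ r, HasField B (r * w) w (Z.countBelow (4 * r)))
    (h : ∀ env : Fin 8 → BitVec w, HasParams X.card m env →
      SetContext (A ++ List.ofFn fun i : Fin ((m / 4 + 1) * w) => B i) env m X p Z 1)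
    (hspace : indexLen m X.card + (m / 4 + 1) * w ≤ w * 2 ^ w) (ht : 1 ≤ t) (φ : Expr) :
    IsLookup (w := w) (A ++ List.ofFn fun i : Fin ((m / 4 + 1) * w) => B i) m X Z
      (structLookup pred) φ (structCost φ * t) := by
  intro q y σ hσ hφ hy
  rw [mem_Icc] at hy
  have hc := h _ hσ.toHasParams
  have hi := hc.toIndexContext
  have e3 := hi.ev_scalar (c := 3) (by norm_num) hc.index.flag
  have hq : (y / 4 + 1) * w ≤ (m / 4 + 1) * w :=
    Nat.mul_le_mul_right _ (Nat.succ_le_succ (Nat.div_le_div_right hy.2))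
  rw [add_mul, one_mul] at hq
  have e : Ev (A ++ List.ofFn fun i : Fin ((m / 4 + 1) * w) => B i) σ.env
      (readArray endPos (.var 3) (φ / .lit 4)) (Z.countBelow (4 * (y / 4))) := by
    refine .readArray hi.word hi.one_le_word hc.pos_endPos (ev_word hi.word)
      (hφ.div (hi.ev_lit (by norm_num))) le_rfl ((hB (y / 4)).congr fun i hi => ?_) (by omega)
    rw [List.getD_append_right _ _ _ _ (by omega),
      List.getD_eq_getElem _ _ (by rw [List.length_ofFn]; omega), List.getElem_ofFn]
    dsimp only
    congr 1
    omega
  refine (Runs.ifLt (T := (readArray endPos (.var 3) (φ / .lit 4)).cost + 1) (fun hlt σ' f => ?_)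
    fun hge σ' f => ?_).mono ?_ fun _ h => h
  · have hσ' := hσ.of_eqOff f
    rw [← f.env_eq le_rfl] at e
    refine (runs_assign _ _ _ σ').mono le_rfl fun τ hτ => ?_
    have h7 : (τ.env 7).toNat = Z.countBelow (4 * (y / 4)) := by
      change (τ.reg (varReg 7)).toNat = _
      rw [hτ.1]
      exact e
    have hsame : ∀ i : Fin 8, i < 5 → τ.env i = σ'.env i := by
      intro i hi
      refine hτ.2.2 _ ?_
      rintro (h | h)
      · rw [varReg_inj] at h
        omega
      · rw [varReg_mem_tempRegs] at h
        omega
    have hdm := Nat.div_add_mod y 4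
    have hmod := Nat.mod_lt y (show 0 < 4 by norm_num)
    have k1 := Z.countBelow_succ_le (4 * (y / 4))
    have k2 := Z.countBelow_succ_le (4 * (y / 4) + 1)
    have k3 := Z.countBelow_succ_le (4 * (y / 4) + 1 + 1)
    have k4 := Z.countBelow_mono (show 4 * (y / 4) ≤ y by omega)
    have k5 := Z.countBelow_mono (show y ≤ 4 * (y / 4) + 1 + 1 + 1 by omega)
    refine ⟨by omega, by omega, hσ'.toHasParams.congr fun i _ hi => hsame i hi, ?_⟩
    rw [hsame 0 (by decide)]
    exact hσ'.query
  · rw [Ev.lit_zero, e3] at hge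
    omega
  · have h1 : (0 : ℝ) ≤ (scalar 3).cost := Nat.cast_nonneg _
    have h2 : (0 : ℝ) ≤ (readArray endPos (.var 3) (φ / .lit 4)).cost := Nat.cast_nonneg _
    have h3 : (0 : ℝ) ≤ φ.cost := Nat.cast_nonneg _
    have h4 : (0 : ℝ) ≤ restWord.cost := Nat.cast_nonneg _
    unfold structCost
    simp only [show (Expr.lit 0).cost = 1 from rfl]
    push_cast
    nlinarith

end

end WordRAM

open WordRAM

theorem IsInstance.isAux {𝒟 : Set (ℕ × ℕ)} {m p : ℕ} {X Z : Finset ℕ} (h : IsInstance 𝒟 m X)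
    (hZ : IsAux m X p Z) : IsInstance 𝒟 m Z := ⟨h.1, hZ.sub, by rw [hZ.card]; exact h.2.2⟩

theorem length_verbatim_le {m n ν : ℕ} (hm : 1 ≤ m) (hn : n < 2 ^ ν) :
    ((n * m.size : ℕ) : ℝ) ≤ n * Real.logb 2 m - n * Real.logb 2 n + (ν + 1) * n := by
  have h1 := size_le_logb_add_one hm
  have h2 := logb_le_size n
  have h3 : (n.size : ℝ) ≤ ν := by exact_mod_cast Nat.size_le.2 hn
  push_cast
  nlinarith [show (0 : ℝ) ≤ n by positivity]

theorem exists_dictData {w : ℕ → ℕ} (hw : ∀ m, 1 ≤ m → m.size ≤ w m) {𝒟 : Set (ℕ × ℕ)}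
    {t s : ℕ → ℕ → ℝ} {enc : ℕ → Finset ℕ → List Bool} {pred : Prog}
    (h : IsPRED w 𝒟 t s enc pred) {ν : ℕ} (hν : 1024 ≤ ν) {m : ℕ} {X : Finset ℕ}
    (hX : IsInstance 𝒟 m X) : ∃ D : List Bool,
      (D.length : ℝ) ≤ 2 * s X.card m + (ν + 95) * X.card ∧
      IsDictData (w m) D m X ν (structLookup pred)
        ((structCost rankBound + structCost zeroBound) * t X.card m) := by
  have hcard := card_le_of_subset hX.2.1
  have hm := hX.1
  have hs : 0 ≤ s X.card m := le_trans (by positivity) (h m X hX).1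
  have hchoose := (mul_logb_sub_le_logb_choose hcard).trans (h.logb_choose_le hX)
  have ht := h.one_le hX
  have hνpos : (1024 : ℝ) ≤ ν := by exact_mod_cast hν
  rcases Nat.lt_or_ge X.card (2 ^ ν) with hn | hn
  · refine ⟨verbatim m X, ?_, fun _ => rfl, fun h => absurd hn (by omega)⟩
    rw [length_verbatim]
    have h1 := length_verbatim_le hm hn
    -- The summand 1 from the counting bound is absorbed by a multiple of `n`, except when n = 0,
    -- where nothing is stored.
    rcases Nat.eq_zero_or_pos X.card with h0 | h0
    · rw [h0] at hs ⊢
      simp only [zero_mul, Nat.cast_zero, mul_zero, add_zero]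
      linarith
    · have h0' : (1 : ℝ) ≤ X.card := by exact_mod_cast h0
      nlinarith
  have h4 : 2 ^ 2 ≤ X.card := (Nat.pow_le_pow_right (by norm_num) (by omega)).trans hn
  obtain ⟨p, Z, hZ⟩ := exists_isAux hX.2.1 h4
  have hZI := hX.isAux hZ
  obtain ⟨hlen, hpred⟩ := h m Z hZI
  rw [hZ.card] at hlen hpred
  have hindex := indexLen_le_logb hm hcard
  have hn1 : (1 : ℝ) ≤ X.card := by
    have : 1 ≤ X.card := le_trans Nat.one_le_two_pow hn
    exact_mod_cast this
  have hmono (φ : Expr) (hφ : φ = rankBound ∨ φ = zeroBound) :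
      (structCost φ : ℝ) * t X.card m ≤
        (structCost rankBound + structCost zeroBound) * t X.card m := by
    refine mul_le_mul_of_nonneg_right ?_ (by linarith)
    rcases hφ with rfl | rfl
    · exact le_add_of_nonneg_right (by positivity)
    · exact le_add_of_nonneg_left (by positivity)
  have hlk {D : List Bool} (hl : ∀ φ, IsLookup (w := w m) D m X Z (structLookup pred) φ
      (structCost φ * t X.card m)) (φ : Expr) (hφ : φ = rankBound ∨ φ = zeroBound) :
      IsLookup (w := w m) D m X Z (structLookup pred) φ
        ((structCost rankBound + structCost zeroBound) * t X.card m) :=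
    fun q y σ h1 h2 h3 => (hl φ q y σ h1 h2 h3).mono (hmono φ hφ) fun _ h => h
  -- If the given encoding is too long to be addressed behind the index, it is longer than a plain
  -- table of ranks, which then replaces it.
  rcases Nat.lt_or_ge (w m * (2 ^ w m - 1)) (indexLen m X.card + (enc m Z).length) with hlt | hge
  · obtain ⟨A, hA, hctx⟩ := exists_setContext (w := w m) hX.2.1 (hw m hm) hν hn hZ
      (flag := 1) le_rfl
    have hc0 := hctx [] (fun i : Fin 8 => match i with
      | 1 => BitVec.ofNat (w m) X.card
      | 2 => BitVec.ofNat (w m) m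
      | 3 => BitVec.ofNat (w m) (w m)
      | _ => BitVec.ofNat (w m) m.size) ⟨rfl, rfl, rfl, rfl⟩
    have h200 := hc0.two_hundred_le
    have hi := hc0.indexLen_le
    have hu := hc0.univ_lt
    have h2w := two_mul_le_two_pow (show 1 ≤ w m by omega)
    obtain ⟨B, hB⟩ := exists_array (w m) (fun q => Z.countBelow (4 * q)) fun q => by
      have := Z.countBelow_le (4 * q)
      rw [hZ.card] at this
      omega
    -- The table fills about a quarter of the address space, and the index less than half of it, as
    -- it has at most 94 · 2^w bits and w ≥ 200.
    have htab : indexLen m X.card + (m / 4 + 1) * w m + w m ≤ w m * 2 ^ w m := by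
      have h1 : 4 * (m / 4 + 1) * w m ≤ (2 ^ w m + 4) * w m :=
        Nat.mul_le_mul_right _ (by omega)
      have h2 : 200 * 2 ^ w m ≤ w m * 2 ^ w m := Nat.mul_le_mul_right _ h200
      nlinarith
    have hmul : w m * (2 ^ w m - 1) + w m = w m * 2 ^ w m := by
      rw [← Nat.mul_succ]
      congr 1
      omega
    refine ⟨A ++ List.ofFn fun i : Fin ((m / 4 + 1) * w m) => B i, ?_,
      fun h => absurd hn (by omega),
      fun _ => ⟨p, Z, 1, hctx _, hlk (isLookup_table hA hB (hctx _) (by omega) ht) _ (Or.inl rfl),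
        hlk (isLookup_table hA hB (hctx _) (by omega) ht) _ (Or.inr rfl)⟩⟩
    rw [List.length_append, List.length_ofFn, hA]
    have h5 : (m / 4 + 1) * w m ≤ (enc m Z).length := by omega
    have h6 : (((m / 4 + 1) * w m : ℕ) : ℝ) ≤ (enc m Z).length := by exact_mod_cast h5
    rw [Nat.cast_add]
    nlinarith
  · obtain ⟨A, hA, hctx⟩ := exists_setContext (w := w m) hX.2.1 (hw m hm) hν hn hZ
      (flag := 0) (by norm_num)
    refine ⟨A ++ enc m Z, ?_, fun h => absurd hn (by omega),
      fun _ => ⟨p, Z, 0, hctx _, hlk (isLookup_struct hA (hctx _) hge hZ.sub hpred) _ (Or.inl rfl),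
        hlk (isLookup_struct hA (hctx _) hge hZ.sub hpred) _ (Or.inr rfl)⟩⟩
    rw [List.length_append, hA]
    push_cast
    nlinarith

theorem HasPRED.hasFID {w : ℕ → ℕ} (hw : ∀ m, 1 ≤ m → m.size ≤ w m) {𝒟 : Set (ℕ × ℕ)}
    {t s : ℕ → ℕ → ℝ} (h : HasPRED w 𝒟 t s) {C : ℝ}
    (hC : queryCost 1024 + (structCost rankBound + structCost zeroBound) ≤ C) (hC' : 1119 ≤ C) :
    HasFID w 𝒟 (fun n m => C * t n m) (fun _ _ => C) fun n m => 2 * s n m + C * n := by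
  classical
  obtain ⟨enc, pred, h⟩ := h
  have hd := fun (m : ℕ) (X : Finset ℕ) (hX : IsInstance 𝒟 m X) =>
    exists_dictData hw h (le_refl 1024) hX
  refine hasFID_of_isDictData (enc := fun m X => if hX : IsInstance 𝒟 m X then (hd m X hX).choose
    else []) (lk := structLookup pred) hw (by positivity) hC (fun m X hX => h.one_le hX)
    (fun m X hX => ?_) fun m X hX => ?_
  · rw [dif_pos hX]
    refine (hd m X hX).choose_spec.1.trans ?_
    have : (0 : ℝ) ≤ X.card := by positivity
    push_cast
    nlinarith
  · rw [dif_pos hX]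
    exact (hd m X hX).choose_spec.2

/-! ### Words of the verbatim representation -/

namespace WordRAM

/-- Comparison of positions. -/
def posLt (P Q : PosExpr) : Expr :=
  .ite P.word Q.word (.lit 1)
    (.ite Q.word P.word (.lit 0) (.ite P.bit Q.bit (.lit 1) (.lit 0)))

/-- The remainder of the position `P` modulo the number of bits of an element, apart from the last
reduction. -/
def posRest (P : PosExpr) : Expr := P.word * (.var 3 % .var 4) + P.bit

/-- The quotient of the position `P` and the number of bits of an element. -/
def posDiv (P : PosExpr) : Expr := P.word * (.var 3 / .var 4) + posRest P / .var 4

def posMod (P : PosExpr) : Expr := posRest P % .var 4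

section

variable {w : ℕ} {D : List Bool} {env : Fin 8 → BitVec w} {P Q : PosExpr} {p q : ℕ}

theorem Pos.ev_lt (hw : 1 ≤ w) (hP : Pos D env P p) (hQ : Pos D env Q q) (hp : p < w * 2 ^ w)
    (hq : q < w * 2 ^ w) : Ev D env (posLt P Q) (if p < q then 1 else 0) := by
  have hp' : p / w < 2 ^ w := Nat.div_lt_of_lt_mul hp
  have hq' : q / w < 2 ^ w := Nat.div_lt_of_lt_mul hq
  have ep := hP.word.congr (Nat.mod_eq_of_lt hp')
  have eq := hQ.word.congr (Nat.mod_eq_of_lt hq')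
  have hmp := Nat.mod_lt p (show 0 < w by omega)
  have hmq := Nat.mod_lt q (show 0 < w by omega)
  have dp := Nat.div_add_mod p w
  have dq := Nat.div_add_mod q w
  refine ep.ite eq (fun h => ?_) fun h => eq.ite ep (fun h' => ?_) fun h' =>
    hP.bit.ite hQ.bit (fun h'' => ?_) fun h'' => ?_
  · have : w * (p / w + 1) ≤ w * (q / w) := Nat.mul_le_mul_left _ h
    rw [mul_add, mul_one] at this
    rw [if_pos (by omega)]
    exact .lit_one hw
  · have : w * (q / w + 1) ≤ w * (p / w) := Nat.mul_le_mul_left _ h'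
    rw [mul_add, mul_one] at this
    rw [if_neg (by omega)]
    exact .lit_zero
  · rw [show p / w = q / w by omega] at dp
    rw [if_pos (by omega)]
    exact .lit_one hw
  · rw [show p / w = q / w by omega] at dp
    rw [if_neg (by omega)]
    exact .lit_zero

/-- With p = w·a + b and w = k·(w/k) + w%k, one has p = k·(a·(w/k)) + (a·(w%k) + b). The last
summand fits into a word: a < 2^k and, unless `k` divides `w`, a·(w%k) ≤ 2^k·(w − k) ≤ 2^(w−1). -/
theorem Pos.ev_divMod (h3 : env 3 = BitVec.ofNat w w) {k : ℕ} (hk : Ev D env (.var 4) k)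
    (hk1 : 1 ≤ k) (hkw : k ≤ w) (hP : Pos D env P p) (hp : p < 2 ^ k * k) :
    Ev D env (posDiv P) (p / k) ∧ Ev D env (posMod P) (p % k) := by
  have hw0 : 0 < w := by omega
  have hpw : p / w < 2 ^ k := by
    rw [Nat.div_lt_iff_lt_mul hw0]
    exact lt_of_lt_of_le hp (Nat.mul_le_mul_left _ hkw)
  have hkw2 : 2 ^ k ≤ 2 ^ w := Nat.pow_le_pow_right (by norm_num) hkw
  have ew := ev_word (D := D) h3
  have eword := hP.word.congr (Nat.mod_eq_of_lt (hpw.trans_le hkw2))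
  have hb := Nat.mod_lt p hw0
  have hdw := Nat.div_add_mod w k
  have hα : 1 ≤ w / k := Nat.div_pos hkw hk1
  have hβ : w % k + k ≤ w := by nlinarith
  have h2w := two_mul_le_two_pow (show 1 ≤ w from hw0)
  have hlt : p / w * (w % k) + p % w < 2 ^ w := by
    rcases Nat.eq_zero_or_pos (w % k) with h0 | h0
    · rw [h0, mul_zero, zero_add]
      exact hb.trans Nat.lt_two_pow_self
    · have h1 := two_mul_le_two_pow (show 1 ≤ w - k by omega)
      have h2 : 2 ^ k * 2 ^ (w - k) = 2 ^ w := by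
        rw [← pow_add]
        congr 1
        omega
      have h4 : p / w * (w % k) ≤ 2 ^ k * (w - k) := Nat.mul_le_mul hpw.le (by omega)
      have h5 : 2 ^ k * (2 * (w - k)) ≤ 2 ^ k * 2 ^ (w - k) := Nat.mul_le_mul_left _ h1
      rw [show 2 ^ k * (2 * (w - k)) = 2 * (2 ^ k * (w - k)) by ring] at h5
      omega
  have hdecomp : p = k * (p / w * (w / k)) + (p / w * (w % k) + p % w) := by
    conv_lhs => rw [← Nat.div_add_mod p w]
    nth_rewrite 1 [← hdw]
    ring
  have hrest : Ev D env (posRest P) (p / w * (w % k) + p % w) :=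
    (eword.mul (ew.mod hk) (by omega)).add hP.bit hlt
  have hdiv : p / k = p / w * (w / k) + (p / w * (w % k) + p % w) / k := by
    conv_lhs => rw [hdecomp]
    rw [Nat.mul_add_div (by omega)]
  have hmod : p % k = (p / w * (w % k) + p % w) % k := by
    conv_lhs => rw [hdecomp]
    rw [Nat.mul_add_mod]
  have hpk : p / k < 2 ^ w := lt_of_lt_of_le ((Nat.div_lt_iff_lt_mul hk1).2 hp) hkw2
  constructor
  · rw [hdiv] at hpk ⊢
    exact (eword.mul (ew.div hk) (lt_of_le_of_lt (Nat.le_add_right _ _) hpk)).add (hrest.div hk) hpk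
  · rw [hmod]
    exact hrest.mod hk

end

/-- The part that the element with index `e + k` has in the word that starts in the element with
index `e` at its bit `b`. -/
def verbPiece (e b : Expr) : ℕ → Expr
  | 0 => auxElt e >>> b
  | k + 1 => auxElt (e + .lit (k + 1)) <<< (.lit (k + 1) * .var 4 - b)

/-- The word of the verbatim representation that starts in the element with index `e` at its bit
`b`, where elements up to the index `e + k` are taken into account. -/
def verbWord (e b : Expr) : ℕ → Expr
  | 0 => .ite (.lit 0) (.var 1 - e) (verbPiece e b 0) (.lit 0)
  | k + 1 => verbWord e b k ||| .ite (.lit (k + 1)) (.var 1 - e) (verbPiece e b (k + 1)) (.lit 0)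

section

variable {w : ℕ} {D : List Bool} {env : Fin 8 → BitVec w} {m : ℕ} {X : Finset ℕ} {p : ℕ}
  {Z : Finset ℕ} {flag : ℕ}

theorem Ev.getLsbD {e : Expr} {v : ℕ} (h : Ev D env e v) (i : ℕ) :
    (e.eval D env).getLsbD i = v.testBit i := by rw [← BitVec.testBit_toNat, h]

theorem getLsbD_or (a b : Expr) (i : ℕ) : ((a ||| b).eval D env).getLsbD i =
    ((a.eval D env).getLsbD i || (b.eval D env).getLsbD i) := BitVec.getLsbD_or

theorem getLsbD_shiftRight {a b : Expr} {y : ℕ} (hb : Ev D env b y) (i : ℕ) :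
    ((a >>> b).eval D env).getLsbD i = (a.eval D env).getLsbD (y + i) := by
  change (a.eval D env >>> (b.eval D env).toNat).getLsbD i = _
  rw [BitVec.getLsbD_ushiftRight, hb]

theorem getLsbD_shiftLeft {a b : Expr} {y : ℕ} (hb : Ev D env b y) {i : ℕ} (hi : i < w) :
    ((a <<< b).eval D env).getLsbD i = (!decide (i < y) && (a.eval D env).getLsbD (i - y)) := by
  change (a.eval D env <<< (b.eval D env).toNat).getLsbD i = _
  rw [BitVec.getLsbD_shiftLeft, hb, decide_eq_true hi, Bool.true_and]

theorem getLsbD_ite {a b c d : Expr} {x y : ℕ} (ha : Ev D env a x) (hb : Ev D env b y) (i : ℕ) :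
    ((Expr.ite a b c d).eval D env).getLsbD i =
      if x < y then (c.eval D env).getLsbD i else (d.eval D env).getLsbD i := by
  rw [Expr.eval, ha, hb]
  split_ifs <;> rfl

variable {e b : Expr} {ε β : ℕ}

theorem SetContext.ev_size (h : SetContext D env m X p Z flag) : Ev D env (.var 4) m.size :=
  h.toIndexContext.ev_size

theorem SetContext.getLsbD_verbPiece (h : SetContext D env m X p Z flag) (he : Ev D env e ε)
    (hb : Ev D env b β) (hβ : β < m.size) {k : ℕ} (hk : k * m.size < 2 ^ w)
    (hεk : ε + k < X.card) {i : ℕ} (hi : i < w) :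
    ((verbPiece e b k).eval D env).getLsbD i =
      (decide (k * m.size ≤ β + i) && (Z.elt (ε + k)).testBit (β + i - k * m.size)) := by
  have hc := h.toIndexContext.card_lt
  cases k with
  | zero =>
    rw [verbPiece, getLsbD_shiftRight hb, (h.ev_auxElt he (by omega)).getLsbD]
    simp
  | succ k =>
    have hle : m.size ≤ (k + 1) * m.size := Nat.le_mul_of_pos_left _ (by omega)
    have el : Ev D env (.lit (k + 1)) (k + 1) := .lit (by omega)
    have es : Ev D env (.lit (k + 1) * .var 4 - b) ((k + 1) * m.size - β) :=
      (el.mul h.ev_size hk).sub hb (by omega)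
    rw [verbPiece, getLsbD_shiftLeft es hi,
      (h.ev_auxElt (he.add el (by omega)) hεk).getLsbD]
    rcases Nat.lt_or_ge (β + i) ((k + 1) * m.size) with h1 | h1
    · rw [decide_eq_true (show i < (k + 1) * m.size - β by omega), decide_eq_false (by omega)]
      rfl
    · rw [decide_eq_false (show ¬ i < (k + 1) * m.size - β by omega), decide_eq_true h1,
        show i - ((k + 1) * m.size - β) = β + i - (k + 1) * m.size by omega]
      rfl

/-- Elements have at most size m bits, so after shifting each one fills exactly its own slot and the
pieces can be joined by a bitwise or. Slots past the last element are suppressed by the guard. -/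
theorem SetContext.getLsbD_ite_verbPiece (h : SetContext D env m X p Z flag) (he : Ev D env e ε)
    (hε : ε < X.card) (hb : Ev D env b β) (hβ : β < m.size) {k : ℕ} (hk : k * m.size < 2 ^ w)
    {i : ℕ} (hi : i < w) :
    ((Expr.ite (.lit k) (.var 1 - e) (verbPiece e b k) (.lit 0)).eval D env).getLsbD i =
      ((verbatim m Z).getD (ε * m.size + β + i) false && decide ((β + i) / m.size = k)) := by
  have hm : 0 < m.size := by omega
  have hkw : k < 2 ^ w := lt_of_le_of_lt (Nat.le_mul_of_pos_right _ hm) hk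
  have hZ := h.aux.card
  rw [getLsbD_ite (.lit hkw) (h.toIndexContext.ev_card.sub he hε.le)]
  have hdm := Nat.div_add_mod' (β + i) m.size
  have hmod := Nat.mod_lt (β + i) hm
  have hpos : ε * m.size + β + i =
      (ε + (β + i) / m.size) * m.size + (β + i) % m.size := by
    rw [add_mul]
    omega
  rw [hpos]
  split_ifs with hlt
  · rw [h.getLsbD_verbPiece he hb hβ hk (by omega) hi]
    rcases lt_trichotomy k ((β + i) / m.size) with h1 | h1 | h1
    · have h2 : (k + 1) * m.size ≤ (β + i) / m.size * m.size := Nat.mul_le_mul_right _ h1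
      rw [add_mul, one_mul] at h2
      rw [decide_eq_false (show ¬ (β + i) / m.size = k by omega), Bool.and_false,
        Nat.testBit_lt_two_pow, Bool.and_false]
      exact lt_of_lt_of_le (lt_of_le_of_lt (elt_le' h.aux.sub (by omega)) (Nat.lt_size_self m))
        (Nat.pow_le_pow_right (by norm_num) (by omega))
    · rw [decide_eq_true h1.symm, Bool.and_true, ← h1, getD_verbatim (by omega) hmod]
      rw [← h1] at hdm
      rw [decide_eq_true (by omega), Bool.true_and]
      congr 1
      omega
    · have h2 : ((β + i) / m.size + 1) * m.size ≤ k * m.size := Nat.mul_le_mul_right _ h1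
      rw [add_mul, one_mul] at h2
      rw [decide_eq_false (show ¬ (β + i) / m.size = k by omega), Bool.and_false,
        decide_eq_false (by omega), Bool.false_and]
  · rw [Ev.lit_zero.getLsbD, Nat.zero_testBit]
    by_cases h1 : (β + i) / m.size = k
    · rw [List.getD_eq_default, Bool.false_and]
      rw [length_verbatim, hZ]
      exact (Nat.mul_le_mul_right _ (by omega)).trans (Nat.le_add_right _ _)
    · rw [decide_eq_false h1, Bool.and_false]

theorem SetContext.getLsbD_verbWord (h : SetContext D env m X p Z flag) (he : Ev D env e ε)
    (hε : ε < X.card) (hb : Ev D env b β) (hβ : β < m.size) {k : ℕ} (hk : k * m.size < 2 ^ w)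
    {i : ℕ} (hi : i < w) :
    ((verbWord e b k).eval D env).getLsbD i =
      ((verbatim m Z).getD (ε * m.size + β + i) false && decide ((β + i) / m.size ≤ k)) := by
  induction k with
  | zero =>
    rw [verbWord, h.getLsbD_ite_verbPiece he hε hb hβ hk hi]
    simp
  | succ k ih =>
    rw [verbWord, getLsbD_or, ih (lt_of_le_of_lt (Nat.mul_le_mul_right _ (by omega)) hk),
      h.getLsbD_ite_verbPiece he hε hb hβ hk hi, ← Bool.and_or_distrib_left]
    congr 1
    rw [← Bool.decide_or]
    congr 1
    exact propext (by omega)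

end

end WordRAM

/-! ### Dictionaries from set-preserving predecessor structures -/

namespace WordRAM

/-- The position of the word with the index in the variable `5`. -/
def herePos : PosExpr := ⟨.var 5, .lit 0⟩

/-- The number of bits of the verbatim representation. -/
def blockPos : PosExpr := .mul (.var 1) (.var 4)

/-- The position of the word relative to the verbatim representation, which has the starting
position in the variable `6`. -/
def offPos : PosExpr := herePos - .mul (.var 6) (.lit 1)

/-- The word with the index in the variable `5`, if it lies behind the verbatim representation. -/
def behindWord : Expr := readWord (endPos + herePos - blockPos)

/-- The number of bits from the beginning of the word to the beginning of the verbatim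
representation. -/
def beforeLen : Expr := .var 6 - .var 5 * .var 3

/-- The word with the index in the variable `5` of a bit string of which the verbatim
representation of the auxiliary set has been removed. -/
def cutWord (κ : ℕ) : Expr :=
  .ite (.var 5) (.var 6 / .var 3 + .ite (.lit 0) (.var 6 % .var 3) (.lit 1) (.lit 0))
    (readWord (endPos + herePos) &&& (.lit 1 <<< beforeLen - .lit 1) |||
      verbWord (.lit 0) (.lit 0) κ <<< beforeLen)
    (.ite (.lit 0) (posLt offPos blockPos)
      (.ite (.lit 0) (blockPos - offPos).word (verbWord (posDiv offPos) (posMod offPos) κ)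
        (verbWord (posDiv offPos) (posMod offPos) κ |||
          behindWord >>> (blockPos - offPos).bit <<< (blockPos - offPos).bit))
      behindWord)

/-- The index is no longer than the block it replaces, so moving the rest of the encoding never
pushes it out of the address space, and no bound on the encoding is required. -/
theorem indexLen_le_mul_size {m n : ℕ} (h : n ≤ m) (h93 : 93 ≤ n.size) :
    indexLen m n ≤ n * m.size := by
  have := Nat.size_le_size h
  rw [indexLen, ← mul_add]
  exact Nat.mul_le_mul_left _ (by omega)

/-- A word of the original encoding is composed of bits before the verbatim block, which now lie
behind the index, bits of the block, recomputed from elements of `Z`, and bits after it, displaced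
by the index length minus the block length. Since the block has at least `w` bits, a word never
meets all three. The word starts inside at most one element, and `κ` further elements cover it. -/
theorem simulates_cutWord {w : ℕ} {A pre post : List Bool} {env : Fin 8 → BitVec w} {m : ℕ}
    {X : Finset ℕ} {p : ℕ} {Z : Finset ℕ} {flag κ : ℕ} (hA : A.length = indexLen m X.card)
    (h : ∀ env : Fin 8 → BitVec w, HasParams X.card m env →
      SetContext (A ++ (pre ++ post)) env m X p Z flag)
    (henv : HasParams X.card m env) (h6 : (env 6).toNat = pre.length) (hκ : w ≤ κ * m.size)
    (hκw : κ * m.size < 2 ^ w) (hκc : κ ≤ X.card) :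
    Simulates (A ++ (pre ++ post)) (pre ++ verbatim m Z ++ post) (cutWord κ) env := by
  intro a
  have hc := h _ (henv.update a)
  have hi := hc.toIndexContext
  have hw := hi.one_le_word
  have hw0 : 0 < w := hw
  have hlenV : (verbatim m Z).length = X.card * m.size := by rw [length_verbatim, hc.aux.card]
  have hI := indexLen_le_mul_size hc.card_le (by have := hc.large; omega)
  have hI' := hc.indexLen_le
  have hwV : w ≤ X.card * m.size := hκ.trans (Nat.mul_le_mul_right _ hκc)
  have hn0 : 0 < X.card := hc.one_le_card
  have hV : X.card * m.size < w * 2 ^ w := by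
    rw [mul_comm w]
    exact Nat.mul_lt_mul_of_lt_of_le hi.card_lt hc.size_le hw0
  have hnm : X.card < 2 ^ m.size := lt_of_le_of_lt hc.card_le (Nat.lt_size_self m)
  have hms : 1 ≤ m.size := Nat.pos_of_ne_zero fun h0 => by
    rw [h0, mul_zero] at hwV
    omega
  have hP : pre.length < 2 ^ w := h6 ▸ (env 6).isLt
  have h200 : 200 * 2 ^ w ≤ w * 2 ^ w := Nat.mul_le_mul_right _ hc.two_hundred_le
  set D := A ++ (pre ++ post) with hD
  have g1 (b : ℕ) (hb : b < pre.length) :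
      (pre ++ verbatim m Z ++ post).getD b false = D.getD (indexLen m X.card + b) false := by
    rw [hD, List.append_assoc, List.getD_append _ _ _ _ hb,
      List.getD_append_right _ _ _ _ (by omega), List.getD_append _ _ _ _ (by omega), hA,
      Nat.add_sub_cancel_left]
  have g2 (b : ℕ) (hb : pre.length ≤ b) (hb' : b < pre.length + X.card * m.size) :
      (pre ++ verbatim m Z ++ post).getD b false =
        (verbatim m Z).getD (b - pre.length) false := by
    rw [List.append_assoc, List.getD_append_right _ _ _ _ hb,
      List.getD_append _ _ _ _ (by omega)]
  have g3 (b : ℕ) (hb : pre.length + X.card * m.size ≤ b) :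
      (pre ++ verbatim m Z ++ post).getD b false =
        D.getD (indexLen m X.card + b - X.card * m.size) false := by
    rw [hD, List.getD_append_right _ _ _ _ (by rw [List.length_append]; omega),
      List.getD_append_right A _ _ _ (by omega), List.getD_append_right pre _ _ _ (by omega),
      List.length_append]
    congr 1
    omega
  have e5 : Ev D (Function.update env 5 a) (.var 5) a.toNat := .var (by simp)
  have e6 : Ev D (Function.update env 5 a) (.var 6) pre.length := .var (by
    rw [Function.update_of_ne (by decide)]
    exact h6)
  have e3 := ev_word (D := D) hi.word
  have hhere : Pos D (Function.update env 5 a) herePos (w * a.toNat) :=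
    ⟨e5.congr (by rw [Nat.mul_div_cancel_left _ hw0, Nat.mod_eq_of_lt a.isLt]),
      Ev.lit_zero.congr (by rw [Nat.mul_mod_right])⟩
  have hpre : Pos D (Function.update env 5 a) (.mul (.var 6) (.lit 1)) pre.length := by
    simpa only [mul_one] using Pos.mul hi.word hw e6 (.lit_one hw) hw
  have hblock : Pos D (Function.update env 5 a) blockPos (X.card * m.size) :=
    .mul hi.word hw hi.ev_card hc.ev_size hc.size_le
  have hsum := Pos.add hi.word hw hc.pos_endPos hhere
  have haw : w * (a.toNat + 1) ≤ w * 2 ^ w := Nat.mul_le_mul_left _ a.isLt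
  rw [mul_add, mul_one] at haw
  -- If the word begins before the end of the block, its displaced starting position can be
  -- negative. Subtraction and reading both work modulo the address space, so the bits after the
  -- block are still correct.
  have hbehind {i : ℕ} (hiw : i < w) (hge : pre.length + X.card * m.size ≤ w * a.toNat + i) :
      (behindWord.eval D (Function.update env 5 a)).getLsbD i =
        (pre ++ verbatim m Z ++ post).getD (w * a.toNat + i) false := by
    have hr := Pos.sub_add hi.word hw hsum hblock
      (r := indexLen m X.card + w * a.toNat + w * 2 ^ w - X.card * m.size) (by omega)
    rw [behindWord, getLsbD_readWord hi.word hw hr hiw, g3 _ hge,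
      show indexLen m X.card + w * a.toNat + w * 2 ^ w - X.card * m.size + i =
        indexLen m X.card + (w * a.toNat + i) - X.card * m.size + w * 2 ^ w by omega,
      Nat.add_mod_right, Nat.mod_eq_of_lt (by omega)]
  refine BitVec.eq_of_getLsbD_eq fun i hiw => ?_
  rw [getLsbD_dataWord _ _ hiw, mul_comm a.toNat w, cutWord]
  have hdm := Nat.div_add_mod pre.length w
  have hmod := Nat.mod_lt pre.length hw0
  -- Comparing the word index with the start divided by `w`, rounded up, tests whether the word
  -- begins before the block without forming a product that may overflow.
  have htest : Ev D (Function.update env 5 a)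
      (.var 6 / .var 3 + .ite (.lit 0) (.var 6 % .var 3) (.lit 1) (.lit 0))
      (pre.length / w + if 0 < pre.length % w then 1 else 0) := by
    refine (e6.div e3).add (Ev.lit_zero.ite (e6.mod e3) (fun h0 => ?_) fun h0 => ?_) ?_
    · rw [if_pos h0]
      exact .lit_one hw
    · rw [if_neg h0]
      exact .lit_zero
    · have h1 : pre.length / w * 2 ≤ pre.length / w * w :=
        Nat.mul_le_mul_left _ (by have := hc.two_hundred_le; omega)
      rw [mul_comm _ w] at h1
      have h2 := two_mul_le_two_pow hw
      have h3 := hc.two_hundred_le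
      split_ifs <;> omega
  rw [getLsbD_ite e5 htest]
  by_cases hlt : w * a.toNat < pre.length
  · have h1 : a.toNat < pre.length / w + if 0 < pre.length % w then 1 else 0 := by
      by_contra hge
      split_ifs at hge with h0
      · have : w * (pre.length / w + 1) ≤ w * a.toNat := Nat.mul_le_mul_left _ (not_lt.1 hge)
        rw [mul_add, mul_one] at this
        omega
      · have : w * (pre.length / w) ≤ w * a.toNat := Nat.mul_le_mul_left _ (not_lt.1 hge)
        omega
    have er : Ev D (Function.update env 5 a) beforeLen (pre.length - w * a.toNat) := by
      have := e5.mul e3 (by rw [mul_comm]; omega)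
      rw [mul_comm] at this
      exact e6.sub this hlt.le
    rw [if_pos h1, getLsbD_or, getLsbD_and_mask hw er hiw, getLsbD_shiftLeft er hiw,
      getLsbD_readWord hi.word hw hsum hiw]
    rcases Nat.lt_or_ge i (pre.length - w * a.toNat) with h2 | h2
    · rw [decide_eq_true h2, Bool.and_true, Bool.not_true, Bool.false_and, Bool.or_false,
        Nat.mod_eq_of_lt (by omega), g1 _ (by omega), add_assoc]
    · rw [decide_eq_false (not_lt.2 h2), Bool.and_false, Bool.false_or, Bool.not_false,
        Bool.true_and, hc.getLsbD_verbWord .lit_zero hn0 .lit_zero hms hκw (by omega),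
        decide_eq_true, Bool.and_true, g2 _ (by omega) (by omega)]
      · congr 1
        omega
      · exact (Nat.div_lt_of_lt_mul (by rw [mul_comm m.size]; omega)).le
  · have h1 : ¬ a.toNat < pre.length / w + if 0 < pre.length % w then 1 else 0 := by
      intro h1
      split_ifs at h1 with h0
      · have : w * a.toNat ≤ w * (pre.length / w) := Nat.mul_le_mul_left _ (by omega)
        omega
      · have : w * (a.toNat + 1) ≤ w * (pre.length / w) := Nat.mul_le_mul_left _ h1
        rw [mul_add, mul_one] at this
        omega
    have hoff : Pos D (Function.update env 5 a) offPos (w * a.toNat - pre.length) :=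
      .sub hi.word hw hhere hpre (by omega)
    set δ := w * a.toNat - pre.length with hδ
    rw [if_neg h1, getLsbD_ite .lit_zero (Pos.ev_lt hw hoff hblock (by omega) hV)]
    by_cases hδV : δ < X.card * m.size
    · have hcut := Pos.sub hi.word hw hblock hoff hδV.le
      obtain ⟨ed, em⟩ := hoff.ev_divMod hi.word hc.ev_size hms hc.size_le
        (lt_of_lt_of_le hδV (Nat.mul_le_mul_right _ hnm.le))
      have hverb : ((verbWord (posDiv offPos) (posMod offPos) κ).eval D
          (Function.update env 5 a)).getLsbD i = (verbatim m Z).getD (δ + i) false := by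
        have hδm := Nat.mod_lt δ hms
        rw [hc.getLsbD_verbWord ed ((Nat.div_lt_iff_lt_mul hms).2 hδV) em hδm hκw hiw,
          Nat.div_add_mod', decide_eq_true, Bool.and_true]
        refine Nat.le_of_lt_succ (Nat.div_lt_of_lt_mul ?_)
        rw [Nat.mul_succ, mul_comm]
        omega
      have hword := hcut.word.congr (Nat.mod_eq_of_lt (Nat.div_lt_of_lt_mul (by omega)))
      -- The word part of the distance to the end of the block is positive exactly if the whole word
      -- lies inside the block.
      rw [if_pos hδV, if_pos one_pos, getLsbD_ite .lit_zero hword]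
      have hdm' := Nat.div_add_mod (X.card * m.size - δ) w
      have hmod' := Nat.mod_lt (X.card * m.size - δ) hw0
      split_ifs with h2
      · have h3 : w ≤ X.card * m.size - δ := ((Nat.div_pos_iff).1 h2).2
        rw [hverb, g2 _ (by omega) (by omega)]
        congr 1
        omega
      · rw [Nat.eq_zero_of_not_pos h2, mul_zero, zero_add] at hdm'
        -- Shifting right and then left by the number of remaining block bits clears the part of the
        -- displaced word that the block bits occupy.
        have hbit := hcut.bit.congr hdm'
        rw [getLsbD_or, hverb, getLsbD_shiftLeft hbit hiw]
        rcases Nat.lt_or_ge i (X.card * m.size - δ) with h3 | h3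
        · rw [decide_eq_true h3, Bool.not_true, Bool.false_and, Bool.or_false,
            g2 _ (by omega) (by omega)]
          congr 1
          omega
        · rw [decide_eq_false (not_lt.2 h3), Bool.not_false, Bool.true_and,
            getLsbD_shiftRight hbit, List.getD_eq_default _ _ (by omega), Bool.false_or,
            show X.card * m.size - δ + (i - (X.card * m.size - δ)) = i by omega,
            hbehind hiw (by omega)]
    · rw [if_neg hδV, if_neg (by omega), hbehind hiw (by omega)]

/-- Lookups in a predecessor structure of which the verbatim representation of the set has been
removed; it had the starting position that the program `loc` finds. -/
def cutLookup (κ : ℕ) (loc pred : Prog) (φ : Expr) : Prog :=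
  .seq (assign (varReg 7) φ) (.seq (call 1 (.lit 0) loc (.lit 0) 6)
    (call 2 (cutWord κ) pred (.var 7) 7))

/-- The factor by which lookups take more time than queries. -/
def cutCost (κ : ℕ) (φ : Expr) : ℕ := φ.cost + (cutWord κ).cost + 28

/-- The location program is specified on empty data, where every access yields zero; it can
therefore be run next to any actual data. -/
theorem simulates_nil {w : ℕ} (D : List Bool) (env : Fin 8 → BitVec w) :
    Simulates D [] (.lit 0) env := by
  intro a
  refine BitVec.eq_of_getLsbD_eq fun i hi => ?_
  rw [getLsbD_dataWord _ _ hi]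
  simp [Expr.eval]

theorem isLookup_cut {w m : ℕ} {X : Finset ℕ} {p : ℕ} {Z : Finset ℕ} {loc pred : Prog} {t : ℝ}
    {A pre post : List Bool} {flag κ : ℕ} (hA : A.length = indexLen m X.card)
    (h : ∀ env : Fin 8 → BitVec w, HasParams X.card m env →
      SetContext (A ++ (pre ++ post)) env m X p Z flag)
    (hκ : w ≤ κ * m.size) (hκw : κ * m.size < 2 ^ w) (hκc : κ ≤ X.card)
    (hloc : Answers w X.card m [] loc 0 t fun a _ => a = pre.length)
    (hpred : ∀ y ∈ Icc 1 m, Answers w X.card m (pre ++ verbatim m Z ++ post) pred y t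
      (IsPredecessor Z y)) (φ : Expr) :
    IsLookup (w := w) (A ++ (pre ++ post)) m X Z (cutLookup κ loc pred) φ (cutCost κ φ * t) := by
  intro q y σ hσ hφ hy
  have ht := hloc.one_le
  have hZ := (h _ hσ.toHasParams).aux.sub
  refine ((runs_assign _ (varReg 7) φ σ).seq (T₂ := (14 + ((cutWord κ).cost + 13)) * t)
    fun σ₁ h₁ => ?_).mono ?_ fun _ h => h
  · have hsame : ∀ i : Fin 8, i ≠ 7 → σ₁.env i = σ.env i := by
      intro i hi
      refine h₁.2.2 _ ?_
      rintro (h | h)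
      · rw [varReg_inj] at h
        omega
      · rw [varReg_mem_tempRegs] at h
        omega
    have hclear (c : ℕ) (hc : c = 1 ∨ c = 2) (h : ClassClear c σ) : ClassClear c σ₁ := by
      intro r
      rw [h₁.2.2, h]
      rintro (h | ⟨j, -, h⟩)
      · exact classReg_ne_varReg hc h
      · exact classReg_ne_varReg hc h
    have hpar : HasParams X.card m σ₁.env := hσ.toHasParams.congr fun i _ hi =>
      hsame i (by omega)
    have e7 : Ev (A ++ (pre ++ post)) σ₁.env (.var 7) y := by
      refine Ev.var ?_
      change (σ₁.reg (varReg 7)).toNat = _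
      rw [h₁.1]
      exact hφ
    refine ((runs_call (Or.inl rfl) (out := 6) hpar (hclear 1 (Or.inl rfl) hσ.clear_one)
      Ev.lit_zero.eval_eq (simulates_nil _ _) hloc).seq (T₂ := ((cutWord κ).cost + 13) * t)
      fun σ₂ h₂ => ?_).mono ?_ fun _ h => h
    · obtain ⟨⟨-, h6⟩, hsame₂, hclear₂⟩ := h₂
      have hpar₂ : HasParams X.card m σ₂.env := hpar.congr fun i _ hi =>
        hsame₂ i (by omega) (by omega)
      have e7' : Ev (A ++ (pre ++ post)) σ₂.env (.var 7) y := by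
        refine Ev.var ?_
        rw [hsame₂ 7 (by decide) (by decide)]
        exact e7
      refine (runs_call (Or.inr rfl) (out := 7) hpar₂
        (hclear₂ 2 (Or.inr rfl) (by norm_num) (hclear 2 (Or.inr rfl) hσ.clear_two))
        e7'.eval_eq (simulates_cutWord hA h hpar₂ h6 hκ hκw hκc) (hpred y hy)).mono ?_
        fun τ hτ => ?_
      · simp only [show (Expr.var 7).cost = 1 from rfl]
        push_cast
        linarith
      · obtain ⟨⟨v, hv⟩, hsame₃, -⟩ := hτ
        have := hv.eq_countBelow hZ
        refine ⟨by omega, by omega, hpar₂.congr fun i hi hi' =>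
          hsame₃ i (by omega) (by omega), ?_⟩
        rw [hsame₃ 0 (by decide) (by decide), hsame₂ 0 (by decide) (by decide),
          hsame 0 (by decide)]
        exact hσ.query
    · simp only [show (Expr.lit 0).cost = 1 from rfl]
      push_cast
      linarith
  · have h1 : (0 : ℝ) ≤ φ.cost := Nat.cast_nonneg _
    unfold cutCost
    push_cast
    nlinarith

end WordRAM

theorem mul_self_lt_two_pow {w : ℕ} (hw : 5 ≤ w) : w * w < 2 ^ w := by
  induction w, hw using Nat.le_induction with
  | base => norm_num
  | succ w hw ih =>
    rw [pow_succ]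
    nlinarith

/-- Removing the block saves n · size m ≥ n log m bits, which cancels the leading term of the index
length and leaves s − n log n + O(n). For small `n`, the verbatim copy is itself part of the
encoding, hence at most `s` bits long, and n log n ≤ νn. -/
theorem IsPRED.exists_dictData_of_preserving {w : ℕ → ℕ} {κ : ℕ}
    (hw : ∀ m : ℕ, 1 ≤ m → m.size ≤ w m ∧ w m ≤ κ * m.size) {𝒟 : Set (ℕ × ℕ)}
    {t s : ℕ → ℕ → ℝ} {enc : ℕ → Finset ℕ → List Bool} {pred loc : Prog}
    (h : IsPRED w 𝒟 t s enc pred)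
    (hloc : ∀ (m : ℕ) (X : Finset ℕ), IsInstance 𝒟 m X →
      ∃ pre post : List Bool, enc m X = pre ++ verbatim m X ++ post ∧
        Answers (w m) X.card m [] loc 0 (t X.card m) fun a _ => a = pre.length)
    {ν : ℕ} (hν : 1024 ≤ ν) (hκν : κ ≤ ν) {m : ℕ} {X : Finset ℕ} (hX : IsInstance 𝒟 m X) :
    ∃ D : List Bool,
      (D.length : ℝ) ≤ s X.card m - X.card * Real.logb 2 X.card + (ν + 94) * X.card ∧
      IsDictData (w m) D m X ν (cutLookup κ loc pred)
        ((cutCost κ rankBound + cutCost κ zeroBound) * t X.card m) := by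
  have hcard := card_le_of_subset hX.2.1
  have hm := hX.1
  have ht := h.one_le hX
  have hνn : (0 : ℝ) ≤ ν * X.card := by positivity
  have hn0 : (0 : ℝ) ≤ X.card := by positivity
  rcases Nat.lt_or_ge X.card (2 ^ ν) with hn | hn
  · refine ⟨verbatim m X, ?_, fun _ => rfl, fun h => absurd hn (by omega)⟩
    obtain ⟨pre, post, he, -⟩ := hloc m X hX
    have h1 := (h m X hX).1
    rw [he, List.length_append, List.length_append] at h1
    push_cast at h1
    have h2 := logb_le_size X.card
    have h3 : (X.card.size : ℝ) ≤ ν := by exact_mod_cast Nat.size_le.2 hn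
    have h4 : X.card * Real.logb 2 X.card ≤ X.card * ν :=
      mul_le_mul_of_nonneg_left (h2.trans h3) hn0
    linarith [show (0 : ℝ) ≤ pre.length by positivity, show (0 : ℝ) ≤ post.length by positivity]
  have h4 : 2 ^ 2 ≤ X.card := (Nat.pow_le_pow_right (by norm_num) (by omega)).trans hn
  obtain ⟨p, Z, hZ⟩ := exists_isAux hX.2.1 h4
  have hZI := hX.isAux hZ
  obtain ⟨hlen, hpred⟩ := h m Z hZI
  obtain ⟨pre, post, he, hl⟩ := hloc m Z hZI
  rw [hZ.card] at hlen hpred hl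
  rw [he] at hpred
  obtain ⟨hw1, hw2⟩ := hw m hm
  -- As 2^ν ≤ n ≤ m, the constant κ ≤ ν is less than size m, hence κ · size m ≤ w² < 2^w.
  have hνm : ν < m.size := Nat.lt_size.2 (hn.trans hcard)
  have hκw : κ * m.size < 2 ^ w m :=
    lt_of_le_of_lt (Nat.mul_le_mul (by omega) hw1) (mul_self_lt_two_pow (by omega))
  have hκc : κ ≤ X.card := hκν.trans (Nat.lt_two_pow_self.le.trans hn)
  obtain ⟨A, hA, hctx⟩ := exists_setContext (w := w m) hX.2.1 hw1 hν hn hZ (flag := 0) zero_le_one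
  have hlk (φ : Expr) := isLookup_cut hA (hctx (pre ++ post)) hw2 hκw hκc hl hpred φ
  refine ⟨A ++ (pre ++ post), ?_, fun h => absurd hn (by omega), fun _ => ⟨p, Z, 0, hctx _,
    fun q y σ h1 h2 h3 => (hlk rankBound q y σ h1 h2 h3).mono ?_ fun _ h => h,
    fun q y σ h1 h2 h3 => (hlk zeroBound q y σ h1 h2 h3).mono ?_ fun _ h => h⟩⟩
  · have h1 := indexLen_le_logb hm hcard
    have h2 : X.card * Real.logb 2 m ≤ X.card * m.size :=
      mul_le_mul_of_nonneg_left (logb_le_size m) hn0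
    rw [he] at hlen
    simp only [List.length_append, length_verbatim, hZ.card, hA] at hlen ⊢
    push_cast at hlen ⊢
    linarith
  · exact mul_le_mul_of_nonneg_right (le_add_of_nonneg_right (Nat.cast_nonneg _)) (by linarith)
  · exact mul_le_mul_of_nonneg_right (le_add_of_nonneg_left (Nat.cast_nonneg _)) (by linarith)

theorem HasSetPreservingPRED.hasFID {w : ℕ → ℕ} {κ : ℕ}
    (hw : ∀ m : ℕ, 1 ≤ m → m.size ≤ w m ∧ w m ≤ κ * m.size) {𝒟 : Set (ℕ × ℕ)}
    {t s : ℕ → ℕ → ℝ} (h : HasSetPreservingPRED w 𝒟 t s) {C : ℝ}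
    (hC : queryCost (1024 + κ) + (cutCost κ rankBound + cutCost κ zeroBound) ≤ C)
    (hC' : 1118 + κ ≤ C) :
    HasFID w 𝒟 (fun n m => C * t n m) (fun _ _ => C)
      fun n m => s n m - n * Real.logb 2 n + C * n := by
  classical
  obtain ⟨enc, pred, h, loc, hloc⟩ := h
  have hd := fun (m : ℕ) (X : Finset ℕ) (hX : IsInstance 𝒟 m X) =>
    h.exists_dictData_of_preserving hw hloc (Nat.le_add_right 1024 κ) (Nat.le_add_left κ 1024) hX
  refine hasFID_of_isDictData (enc := fun m X => if hX : IsInstance 𝒟 m X then (hd m X hX).choose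
    else []) (lk := cutLookup κ loc pred) (fun m hm => (hw m hm).1)
    (add_nonneg (Nat.cast_nonneg _) (Nat.cast_nonneg _)) hC (fun m X hX => h.one_le hX)
    (fun m X hX => ?_) fun m X hX => ?_
  · rw [dif_pos hX]
    refine (hd m X hX).choose_spec.1.trans ?_
    have : (0 : ℝ) ≤ X.card := by positivity
    push_cast
    nlinarith
  · rw [dif_pos hX]
    exact (hd m X hX).choose_spec.2

theorem HasFID.mono_space {w : ℕ → ℕ} {𝒟 : Set (ℕ × ℕ)} {t t₁ s s' : ℕ → ℕ → ℝ}
    (h : HasFID w 𝒟 t t₁ s) (hs : ∀ n m, n ≤ m → s n m ≤ s' n m) : HasFID w 𝒟 t t₁ s' := by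
  obtain ⟨enc, rk, sel, h⟩ := h
  exact ⟨enc, rk, sel, fun m X hX => ⟨(h m X hX).1.trans (hs _ _ (card_le_of_subset hX.2.1)),
    (h m X hX).2⟩⟩

theorem theorem2p2 (κ : ℕ) :
    ∃ C : ℝ, 0 < C ∧
      ∀ w : ℕ → ℕ, (∀ m : ℕ, 1 ≤ m → m.size ≤ w m ∧ w m ≤ κ * m.size) →
      ∀ (𝒟 : Set (ℕ × ℕ)) (t s : ℕ → ℕ → ℝ),
        (HasFID w 𝒟 t t s → HasPRED w 𝒟 (fun n m => C * t n m) s) ∧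
        (HasSetPreservingPRED w 𝒟 t s →
          HasFID w 𝒟 (fun n m => C * t n m) (fun _ _ => C)
            (fun n m => s n m - n * Real.logb 2 n + C * n) ∧
          HasFID w 𝒟 (fun n m => C * t n m) (fun _ _ => C)
            (fun n m => infoBound n m + (s n m - n * Real.logb 2 m + C * n))) ∧
        (HasPRED w 𝒟 t s →
          HasFID w 𝒟 (fun n m => C * t n m) (fun _ _ => C)
            (fun n m => 2 * s n m + C * n)) := by
  obtain ⟨C, hC⟩ : ∃ C : ℝ, C = 1179 + κ +
      ((queryCost 1024 : ℝ) + (structCost rankBound + structCost zeroBound)) +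
      (queryCost (1024 + κ) + (cutCost κ rankBound + cutCost κ zeroBound)) := ⟨_, rfl⟩
  have h1 : (0 : ℝ) ≤ (queryCost 1024 : ℝ) + (structCost rankBound + structCost zeroBound) :=
    add_nonneg (Nat.cast_nonneg _) (add_nonneg (Nat.cast_nonneg _) (Nat.cast_nonneg _))
  have h2 : (0 : ℝ) ≤ (queryCost (1024 + κ) : ℝ) + (cutCost κ rankBound + cutCost κ zeroBound) :=
    add_nonneg (Nat.cast_nonneg _) (add_nonneg (Nat.cast_nonneg _) (Nat.cast_nonneg _))
  have h3 : (0 : ℝ) ≤ κ := Nat.cast_nonneg _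
  refine ⟨C, by linarith, fun w hw 𝒟 t s => ⟨fun h => ?_, fun h => ?_, fun h => ?_⟩⟩
  · exact h.hasPRED (fun m hm => (hw m hm).1) (by linarith)
  · have hfid := h.hasFID hw (C := C) (by linarith) (by linarith)
    -- The second space bound follows from the first by n log m − n log n ≤ log binom(m, n).
    refine ⟨hfid, hfid.mono_space fun n m hnm => ?_⟩
    have h4 := mul_logb_sub_le_logb_choose hnm
    have h5 := Nat.le_ceil (Real.logb 2 (m.choose n))
    unfold infoBound
    linarith
  · exact h.hasFID (fun m hm => (hw m hm).1) (by linarith) (by linarith)
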